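/- Let $k\in\mathbb Z$, $k\neq -1,0$, and let $K$ be the $(-2,3,2k+1)$ pretzel knot: its standard diagram consists of three vertical two-strand columns of $-2$, $3$ and $2k+1$ half twists, neighbouring columns being joined by arcs at the top and at the bottom and the first column being joined to the last by an outer arc at the top and at the bottom, where a half twist is counted positively if the strand from lower left to upper right is the over strand (so the diagram has writhe $2k+6$). Let $\pi_K$ be the knot group of $K$, let $m\in\pi_K$ be a meridian, and let $\ell\in\pi_K$ be the $0$-framed longitude that commutes with $m$, with $m$ and $\ell$ oriented compatibly (so that $m$ has linking number $+1$ with $K$ when $K$ is oriented parallel to $\ell$). A *KCH representation of degree $n$* is a homomorphism $\rho:\pi_K\to \mathrm{GL}(V)$, $V$ a complex vector space of dimension $n$, such that $\rho(m)$ is diagonalizable and has $1$ as an eigenvalue of multiplicity exactly $n-1$. Let $\mu_0\ne 1$ be the remaining eigenvalue of $\rho(m)$, $e_1$ a corresponding eigenvector, and $\lambda_0$ the eigenvalue of $\rho(\ell)$ on $e_1$. Let $U_K^n\subset(\mathbb C^*)^2$ be the set of all pairs $(\lambda_0,\mu_0)$ that arise from KCH representations of degree $n$. The *$n$-dimensional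 $A$-polynomial* $A_K^n(\lambda,\mu)\in\mathbb C[\lambda^{\pm1},\mu^{\pm1}]$ is the polynomial without repeated factors, unique up to units, whose zero locus in $(\mathbb C^*)^2$ is contained in the Zariski closure of $U_K^n$ and contains all but finitely many points of it ($A_K^n=0$ if $U_K^n$ is Zariski dense in $(\mathbb C^*)^2$). The *meridional rank* of $K$ is the least number of meridians that generate $\pi_K$, and the *bridge number* is the least number of local maxima of the height function among all diagrams of $K$. Theorem. There is an irreducible KCH representation of $\pi_K$ of degree $3$. The polynomial $A^3_K(\lambda,\mu)$ exists, and $1-\lambda\mu^{2k+6}$ divides $A_K^3(\lambda,\mu)$ in $\mathbb C[\lambda^{\pm1},\mu^{\pm1}]$. The meridional rank and the bridge number of $K$ are both equal to $3$. -/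

import Mathlib

/-! ## Link diagrams

A link diagram in the plane, in general position with respect to the height function, is cut by
horizontal lines into elementary pieces.  It is recorded as a list of pieces, read from the bottom
to the top.  Strands on a horizontal level are numbered `0, 1, 2, …` from left to right. -/

/-- The elementary pieces: a local minimum, a local maximum, and the two crossings.
In `cross true` the strand going from lower left to upper right passes over; in `cross false` the
strand going from lower right to upper left passes over. -/
inductive Piece
  | cup
  | cap
  | cross (b : Bool)

/-- Number of strands of the piece at its bottom. -/
def Piece.ins : Piece → ℕ
  | cup => 0
  | cap => 2
  | cross _ => 2

/-- Number of strands of the piece at its top. -/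
def Piece.outs : Piece → ℕ
  | cup => 2
  | cap => 0
  | cross _ => 2

/-- Reflection in a horizontal line as far as the course of the strands is concerned. -/
def Piece.flip : Piece → Piece
  | cup => cap
  | cap => cup
  | cross b => cross b

/-- A horizontal slice of a diagram: one elementary piece, having `pos` vertical strands to its
left and any number of vertical strands to its right. -/
structure Slice where
  piece : Piece
  pos : ℕ

namespace Slice

/-- The slice can be put on top of `n` strands. -/
def Fits (s : Slice) (n : ℕ) : Prop := s.pos + s.piece.ins ≤ n

/-- Number of strands above the slice if there are `n` below it. -/
def width (s : Slice) (n : ℕ) : ℕ := n - s.piece.ins + s.piece.outs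

end Slice

/-- The list of slices `w` is a tangle diagram with `n` bottom and `m` top end points. -/
def IsTangle : ℕ → List Slice → ℕ → Prop
  | n, [], m => n = m
  | n, s :: w, m => s.Fits n ∧ IsTangle (s.width n) w m

/-- A link diagram: a tangle diagram without end points. -/
structure LinkDiagram where
  slices : List Slice
  closed : IsTangle 0 slices 0

/-! ## Link types

Two diagrams represent isotopic links iff they are related by planar isotopies that preserve or
change the height function (exchange of distant pieces, cancellation of a minimum against a
maximum, sliding a strand across a maximum or a minimum) and the three Reidemeister moves. -/

/-- The local moves on lists of slices. -/
inductive LocalMove : List Slice → List Slice → Prop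
  /-- Two pieces that lie beside each other may exchange their heights. -/
  | exchange (s t : Piece) (p d : ℕ) :
      LocalMove [⟨s, p⟩, ⟨t, p + s.outs + d⟩] [⟨t, p + s.ins + d⟩, ⟨s, p⟩]
  | zigzagLeft (p : ℕ) : LocalMove [⟨.cup, p + 1⟩, ⟨.cap, p⟩] []
  | zigzagRight (p : ℕ) : LocalMove [⟨.cup, p⟩, ⟨.cap, p + 1⟩] []
  | slideCap (b : Bool) (p : ℕ) :
      LocalMove [⟨.cross b, p⟩, ⟨.cap, p + 1⟩] [⟨.cross (!b), p + 1⟩, ⟨.cap, p⟩]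
  | slideCup (b : Bool) (p : ℕ) :
      LocalMove [⟨.cup, p + 1⟩, ⟨.cross b, p⟩] [⟨.cup, p⟩, ⟨.cross (!b), p + 1⟩]
  | reidemeisterOneCap (b : Bool) (p : ℕ) :
      LocalMove [⟨.cross b, p⟩, ⟨.cap, p⟩] [⟨.cap, p⟩]
  | reidemeisterOneCup (b : Bool) (p : ℕ) :
      LocalMove [⟨.cup, p⟩, ⟨.cross b, p⟩] [⟨.cup, p⟩]
  | reidemeisterTwo (b : Bool) (p : ℕ) :
      LocalMove [⟨.cross b, p⟩, ⟨.cross (!b), p⟩] []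
  | reidemeisterThree (b : Bool) (p : ℕ) :
      LocalMove [⟨.cross b, p⟩, ⟨.cross b, p + 1⟩, ⟨.cross b, p⟩]
        [⟨.cross b, p + 1⟩, ⟨.cross b, p⟩, ⟨.cross b, p + 1⟩]

namespace LinkDiagram

/-- `D'` arises from `D` by one local move. -/
def Move (D D' : LinkDiagram) : Prop :=
  ∃ u l r v : List Slice, LocalMove l r ∧ D.slices = u ++ l ++ v ∧ D'.slices = u ++ r ++ v

/-- The two diagrams represent the same link type. -/
def Isotopic : LinkDiagram → LinkDiagram → Prop := Relation.EqvGen Move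

/-- The number of local maxima of a diagram. -/
def maxima (D : LinkDiagram) : ℕ :=
  D.slices.countP fun s => match s.piece with
    | .cap => true
    | _ => false

/-- The bridge number of the link represented by `D`: the least number of local maxima of the
height function among all diagrams of the link. -/
noncomputable def bridgeNumber (D : LinkDiagram) : ℕ :=
  sInf {b | ∃ D' : LinkDiagram, D.Isotopic D' ∧ D'.maxima = b}

/-- The number of strands on level `j`, that is, below the slice number `j`
(slices and levels are numbered from `0`). -/
def strandCount (D : LinkDiagram) (j : ℕ) : ℕ :=
  (D.slices.take j).foldl (fun n s => s.width n) 0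

end LinkDiagram

/-! ## The fundamental group of the complement

The Wirtinger presentation.  The generator `(j, i)` is the loop that starts at the eye of the
reader (above the plane), passes under the strand `i` of level `j` from right to left, and comes
back.  It is the positive (right-handed) meridian of this strand if the strand is directed
upwards.  In a product `x * y` the loop `x` is run through first. -/

/-- Relators of a piece with bottom labels `b₀, b₁` and top labels `t₀, t₁` (from left to right).
At a maximum or a minimum the two legs have opposite vertical directions.  At a crossing the over
strand keeps its label, and passing below both strands under the crossing is the same as doing so
above the crossing. -/
def Piece.relators {F : Type*} [Group F] (b₀ b₁ t₀ t₁ : F) : Piece → Set F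
  | cup => {t₁ * t₀}
  | cap => {b₁ * b₀}
  | cross true => {t₁ * b₀⁻¹, b₁ * b₀ * (t₁ * t₀)⁻¹}
  | cross false => {t₀ * b₁⁻¹, b₁ * b₀ * (t₁ * t₀)⁻¹}

/-- Relators of a slice with bottom labels `b` and top labels `t`: those of its piece, and
equality of the two labels of each vertical strand. -/
def Slice.relators {F : Type*} [Group F] (s : Slice) (b t : ℕ → F) : Set F :=
  s.piece.relators (b s.pos) (b (s.pos + 1)) (t s.pos) (t (s.pos + 1)) ∪
    {r | ∃ i < s.pos, r = t i * (b i)⁻¹} ∪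
    {r | ∃ i, r = t (s.pos + s.piece.outs + i) * (b (s.pos + s.piece.ins + i))⁻¹}

namespace LinkDiagram

/-- The Wirtinger relators.  Pairs `(j, i)` that are not strands of the diagram are killed. -/
def relators (D : LinkDiagram) : Set (FreeGroup (ℕ × ℕ)) :=
  {r | ∃ j i, D.strandCount j ≤ i ∧ r = FreeGroup.of (j, i)} ∪
    {r | ∃ (j : ℕ) (s : Slice), D.slices[j]? = some s ∧
      r ∈ s.relators (fun i => FreeGroup.of (j, i)) (fun i => FreeGroup.of (j + 1, i))}

/-- The group of the link. -/
abbrev linkGroup (D : LinkDiagram) : Type := PresentedGroup D.relators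

/-- The Wirtinger generator of the strand `i` of level `j`. -/
def gen (D : LinkDiagram) (j i : ℕ) : D.linkGroup := PresentedGroup.of (j, i)

/-- `g` is a meridian (of either orientation): a conjugate of a Wirtinger generator of a strand of
the diagram or of its inverse. -/
def IsMeridian (D : LinkDiagram) (g : D.linkGroup) : Prop :=
  ∃ j i, i < D.strandCount j ∧ (IsConj (D.gen j i) g ∨ IsConj (D.gen j i)⁻¹ g)

/-- The meridional rank: the least size of a generating set that consists of meridians. -/
noncomputable def meridionalRank (D : LinkDiagram) : ℕ :=
  sInf {r | ∃ S : Finset D.linkGroup,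
    S.card = r ∧ (∀ g ∈ S, D.IsMeridian g) ∧ Subgroup.closure (S : Set D.linkGroup) = ⊤}

end LinkDiagram

/-! ## Longitudes -/

/-- A traveller on the diagram: on the strand `pos` of level `level`, moving up or down. -/
structure Traveller where
  level : ℕ
  pos : ℕ
  up : Bool

namespace Slice

/-- Entering the slice from below at position `i`, the traveller leaves it at the top
(`Sum.inl`), or turns around at a maximum and leaves it at the bottom (`Sum.inr`). -/
def travelUp (s : Slice) (i : ℕ) : ℕ ⊕ ℕ :=
  if i < s.pos then .inl i
  else if s.pos + s.piece.ins ≤ i then .inl (i - s.piece.ins + s.piece.outs)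
  else match s.piece with
    | .cap => .inr (2 * s.pos + 1 - i)
    | _ => .inl (2 * s.pos + 1 - i)

/-- Entering the slice from above at position `i`, the traveller leaves it at the bottom
(`Sum.inl`), or turns around at a minimum and leaves it at the top (`Sum.inr`). -/
def travelDown (s : Slice) (i : ℕ) : ℕ ⊕ ℕ := travelUp ⟨s.piece.flip, s.pos⟩ i

end Slice

namespace LinkDiagram

/-- The traveller passes through one slice. -/
def step (D : LinkDiagram) (a : Traveller) : Traveller :=
  if a.up then
    match D.slices[a.level]? with
    | none => a
    | some s => match s.travelUp a.pos with
      | .inl i => ⟨a.level + 1, i, true⟩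
      | .inr i => ⟨a.level, i, false⟩
  else
    match a.level with
    | 0 => a
    | j + 1 => match D.slices[j]? with
      | none => a
      | some s => match s.travelDown a.pos with
        | .inl i => ⟨j, i, false⟩
        | .inr i => ⟨j + 1, i, true⟩

/-- The contribution of one step to the loop that runs parallel to the link in the plane of the
diagram: when the traveller passes under a strand from right to left, the generator of this
strand; from left to right, its inverse; otherwise `1`. -/
def letter (D : LinkDiagram) (a : Traveller) : D.linkGroup :=
  if a.up then
    match D.slices[a.level]? with
    | some ⟨.cross true, p⟩ => if a.pos = p + 1 then D.gen a.level p else 1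
    | some ⟨.cross false, p⟩ => if a.pos = p then (D.gen a.level (p + 1))⁻¹ else 1
    | _ => 1
  else
    match a.level with
    | 0 => 1
    | j + 1 => match D.slices[j]? with
      | some ⟨.cross true, p⟩ => if a.pos = p then (D.gen j p)⁻¹ else 1
      | some ⟨.cross false, p⟩ => if a.pos = p + 1 then D.gen j (p + 1) else 1
      | _ => 1

/-- The meridian at the traveller, positive with respect to the direction of travel. -/
def meridianAt (D : LinkDiagram) (a : Traveller) : D.linkGroup :=
  if a.up then D.gen a.level a.pos else (D.gen a.level a.pos)⁻¹

/-- The blackboard framed longitude that starts at the traveller: the product of all letters until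
the first return. -/
noncomputable def blackboardLongitude (D : LinkDiagram) (a : Traveller) : D.linkGroup :=
  ((List.range (Function.minimalPeriod D.step a)).map fun k => D.letter (D.step^[k] a)).prod

/-- For a knot diagram: `m` and `l` are a meridian and the `0`-framed longitude belonging to the
same base point of the knot and the same orientation.  The `0`-framed longitude is the parallel
of the knot that is null-homologous in the complement. -/
def IsPeripheralPair (D : LinkDiagram) (m l : D.linkGroup) : Prop :=
  ∃ a : Traveller, a.pos < D.strandCount a.level ∧ m = D.meridianAt a ∧
    (∃ e : ℤ, l = D.blackboardLongitude a * m ^ e) ∧ l ∈ commutator D.linkGroup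

/-! ## KCH representations -/

/-- `ρ (m)` is diagonalizable and has `1` as an eigenvalue of multiplicity `dim V - 1`, for a
meridian `m`. -/
def IsKCH (D : LinkDiagram) {V : Type*} [AddCommGroup V] [Module ℂ V]
    (ρ : Representation ℂ D.linkGroup V) : Prop :=
  ∃ m, D.IsMeridian m ∧ (⨆ c : ℂ, Module.End.eigenspace (ρ m) c) = ⊤ ∧
    Module.finrank ℂ (Module.End.eigenspace (ρ m) 1) + 1 = Module.finrank ℂ V

/-- The set of pairs `(λ₀, μ₀)` given by KCH representations of degree `n`: `μ₀ ≠ 1` is the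
remaining eigenvalue of `ρ (m)`, with eigenvector `v`, and `λ₀` is the eigenvalue of the longitude
on `v`.  (The set does not change if one base point and one orientation of the knot are fixed:
reversing the orientation corresponds to passing to the dual representation.) -/
def kchPoints (D : LinkDiagram) (n : ℕ) : Set (ℂˣ × ℂˣ) :=
  {p | ∃ ρ : Representation ℂ D.linkGroup (Fin n → ℂ), D.IsKCH ρ ∧
    ∃ m l, D.IsPeripheralPair m l ∧ p.2 ≠ 1 ∧
      ∃ v : Fin n → ℂ, v ≠ 0 ∧ ρ m v = (p.2 : ℂ) • v ∧ ρ l v = (p.1 : ℂ) • v}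

end LinkDiagram

/-! ## The `n`-dimensional `A`-polynomial -/

/-- The Laurent polynomials `ℂ[λ^{±1}, μ^{±1}]`; the exponent of `λ^a μ^b` is `(a, b)`. -/
abbrev Laurent2 : Type := AddMonoidAlgebra ℂ (ℤ × ℤ)

/-- The monomial `c λ^a μ^b`. -/
noncomputable def Laurent2.monomial (c : ℂ) (a b : ℤ) : Laurent2 := AddMonoidAlgebra.single (a, b) c

/-- Evaluation at a point `(λ₀, μ₀)` of `(ℂ*)²`. -/
noncomputable def Laurent2.evalAt (p : ℂˣ × ℂˣ) : Laurent2 →ₐ[ℂ] ℂ :=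
  AddMonoidAlgebra.lift ℂ ℂ (ℤ × ℤ)
    { toFun := fun e => ((p.1 ^ e.toAdd.1 * p.2 ^ e.toAdd.2 : ℂˣ) : ℂ)
      map_one' := by simp
      map_mul' := fun e f => by
        rw [← Units.val_mul, toAdd_mul, Prod.fst_add, Prod.snd_add, zpow_add, zpow_add,
          mul_mul_mul_comm] }

/-- The zero locus of a Laurent polynomial in `(ℂ*)²`. -/
def Laurent2.zeroLocus (A : Laurent2) : Set (ℂˣ × ℂˣ) := {p | Laurent2.evalAt p A = 0}

/-- The Zariski closure in `(ℂ*)²`. -/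
def zariskiClosure (U : Set (ℂˣ × ℂˣ)) : Set (ℂˣ × ℂˣ) :=
  {p | ∀ f : Laurent2, (∀ q ∈ U, Laurent2.evalAt q f = 0) → Laurent2.evalAt p f = 0}

/-- `A` is the `n`-dimensional `A`-polynomial of `D`: it has no repeated factors, and its zero locus
is the one-dimensional part of the Zariski closure of the set of points given by KCH representations
of degree `n`, that is, the closure up to finitely many points.  It is unique up to units.
(`A = 0` is possible only if this closure is all of `(ℂ*)²`.) -/
def LinkDiagram.IsAPolynomial (D : LinkDiagram) (n : ℕ) (A : Laurent2) : Prop :=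
  (A = 0 ∨ Squarefree A) ∧ A.zeroLocus ⊆ zariskiClosure (D.kchPoints n) ∧
    (zariskiClosure (D.kchPoints n) \ A.zeroLocus).Finite

/-! ## Pretzel links -/

/-- `c` half twists of the strands `p` and `p + 1`, all crossings of type `cross true` if `0 ≤ c`
and of type `cross false` if `c < 0`. -/
def twists (p : ℕ) (c : ℤ) : List Slice := List.replicate c.natAbs ⟨.cross (decide (0 ≤ c)), p⟩

theorem isTangle_append (n : ℕ) (u v : List Slice) (m k : ℕ) (hu : IsTangle n u m)
    (hv : IsTangle m v k) : IsTangle n (u ++ v) k := by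
  induction u generalizing n with
  | nil => cases hu; exact hv
  | cons s w ih => exact ⟨hu.1, ih _ hu.2⟩

theorem isTangle_twists (n p : ℕ) (c : ℤ) (h : p + 2 ≤ n) : IsTangle n (twists p c) n := by
  unfold twists
  induction c.natAbs with
  | zero => rfl
  | succ k ih =>
    refine ⟨h, ?_⟩
    have : Slice.width ⟨.cross (decide (0 ≤ c)), p⟩ n = n := by
      simp only [Slice.width, Piece.ins, Piece.outs]; omega
    rw [this]
    exact ih

/-- The standard diagram of the `(a, b, c)` pretzel link: three vertical columns of `a`, `b` and `c`
half twists side by side, neighbouring columns joined by arcs at the top and at the bottom, and the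
first column joined to the last one by an outer arc at the top and at the bottom. -/
def pretzel (a b c : ℤ) : LinkDiagram where
  slices := [⟨.cup, 0⟩, ⟨.cup, 1⟩, ⟨.cup, 3⟩] ++
    (twists 0 a ++ (twists 2 b ++ (twists 4 c ++ [⟨.cap, 1⟩, ⟨.cap, 1⟩, ⟨.cap, 0⟩])))
  closed := by
    refine isTangle_append _ _ _ 6 _ (by simp [IsTangle, Slice.Fits, Slice.width, Piece.ins,
      Piece.outs]) ?_
    refine isTangle_append _ _ _ 6 _ (isTangle_twists 6 0 a (by norm_num)) ?_
    refine isTangle_append _ _ _ 6 _ (isTangle_twists 6 2 b (by norm_num)) ?_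
    refine isTangle_append _ _ _ 6 _ (isTangle_twists 6 4 c (by norm_num)) ?_
    simp [IsTangle, Slice.Fits, Slice.width, Piece.ins, Piece.outs]

/-! ## Laurent polynomials in two variables -/

/-! Representation. Labels for the pretzel diagram are obtained from elements A, B, C, up to
inversion attached to its three minima, such that A and B commute, CBC = BCB and A(CA)^k = (CA)^k C:
Artin relations of lengths 2, 3 and 2k+1, one for each column. In GL₃ one takes reflections x ↦ x +
ψ_i(x) e_i with nontrivial eigenvalue μ. All relations depend only on the matrix ψ_i(e_j). They hold
if suitable products of off-diagonal entries are 0, -μ and -μt², where t = ξ + ξ⁻¹ and ξ is, up to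
sign, a root of unity of order |2k+1| (`reflectionUnit_commute`, `reflectionUnit_braid`,
`reflectionUnit_zpow`). For real μ > 0, μ ≠ 1, the matrix is invertible and its off-diagonal pattern
is connected, whence irreducibility (`isIrreducible_of_reflections`).

Longitude. Each strand of the diagram carries, besides its label, a vector that changes only at
undercrossings, where the label of the over strand transports it. If these vectors fit together
around the whole diagram, the blackboard longitude fixes them (`blackboardLongitude_smul`); for the
reflections this happens with e_0, e_1, e_2 at the minima. The same formalism, with ℤ acting on
itself by translations, computes the linking number: the integers fail to fit at one minimum, and
the gap 2k+6 is the framing (`exists_linking_hom`). Hence the 0-framed longitude is the blackboard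
one times m^(-(2k+6)), and λ = μ^(-(2k+6)) for infinitely many μ. All but finitely many of these
points are zeros of the A-polynomial, which is therefore divisible by 1 - λμ^(2k+6)
(`one_sub_monomial_dvd`).

Existence of the A-polynomial. The ring of Laurent polynomials is factorial, Noetherian and of
dimension at most 2, so curves without common component meet in finitely many points
(`finite_zeroLocus_inter`). From one nonzero equation of the closure, if there is any, one keeps the
prime factors whose curves lie in the closure.

Rank and bridge number. The diagram has three maxima, and as many meridians as there are maxima
generate the group. Conversely, fewer than three reflections of ℂ³ have a common nonzero fixed
vector, which an irreducible representation forbids. For the bridge number this argument is applied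
to an arbitrary isotopic diagram: colourings are carried through the local moves, and the moves
preserve the property that all labels lie in a given set closed under inversion and conjugation
(`Isotopic.exists_isColoring`). -/

theorem ringKrullDim_le_of_isLocalization {R S : Type*} [CommRing R] [CommRing S] [Algebra R S]
    (M : Submonoid R) [IsLocalization M S] : ringKrullDim S ≤ ringKrullDim R := by
  refine Order.krullDim_le_of_strictMono (PrimeSpectrum.comap (algebraMap R S)) ?_
  refine Monotone.strictMono_of_injective (fun I J h => Ideal.comap_mono h) ?_
  exact PrimeSpectrum.localization_comap_injective S M

namespace LaurentPolynomial

open scoped LaurentPolynomial Polynomial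

instance {R : Type*} [CommRing R] [IsDomain R] [UniqueFactorizationMonoid R] :
    UniqueFactorizationMonoid R[T;T⁻¹] :=
  UniqueFactorizationMonoid.of_isLocalization (Submonoid.powers (Polynomial.X : R[X])) R[T;T⁻¹]

instance {R : Type*} [CommRing R] [IsNoetherianRing R] : IsNoetherianRing R[T;T⁻¹] :=
  IsLocalization.isNoetherianRing (Submonoid.powers (Polynomial.X : R[X])) R[T;T⁻¹] inferInstance

theorem ringKrullDim_le {R : Type*} [CommRing R] [IsNoetherianRing R] :
    ringKrullDim R[T;T⁻¹] ≤ ringKrullDim R + 1 :=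
  (ringKrullDim_le_of_isLocalization (Submonoid.powers (Polynomial.X : R[X]))).trans
    Polynomial.ringKrullDim_of_isNoetherianRing.le

/-- A Laurent polynomial over a field with infinitely many zeros vanishes. -/
theorem eq_zero_of_infinite_zeros {K : Type*} [Field K] (B : K[T;T⁻¹]) (S : Set Kˣ)
    (hS : S.Infinite) (h : ∀ x ∈ S, eval₂ (RingHom.id K) x B = 0) : B = 0 := by
  obtain ⟨n, P, hP⟩ := B.exists_T_pow
  have hP0 : P = 0 := by
    refine Polynomial.eq_zero_of_infinite_isRoot P
      ((hS.image Units.val_injective.injOn).mono ?_)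
    rintro _ ⟨x, hx, rfl⟩
    have h1 := congrArg (eval₂ (RingHom.id K) x) hP
    rw [map_mul, h x hx, zero_mul, eval₂_toLaurent] at h1
    exact h1
  rw [hP0, map_zero] at hP
  exact ((isUnit_T (R := K) n).mul_left_eq_zero).1 hP.symm

end LaurentPolynomial

namespace Laurent2

/-- Laurent polynomials in two variables as iterated Laurent polynomials in one variable. -/
noncomputable def iteratedEquiv : Laurent2 ≃+* LaurentPolynomial (LaurentPolynomial ℂ) :=
  AddMonoidAlgebra.curryRingEquiv

instance : UniqueFactorizationMonoid Laurent2 :=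
  MulEquiv.uniqueFactorizationMonoid iteratedEquiv.symm.toMulEquiv inferInstance

instance : IsNoetherianRing Laurent2 := isNoetherianRing_of_ringEquiv _ iteratedEquiv.symm

theorem ringKrullDim_le : ringKrullDim Laurent2 ≤ 2 := by
  rw [ringKrullDim_eq_of_ringEquiv iteratedEquiv]
  refine LaurentPolynomial.ringKrullDim_le.trans ?_
  have h : ringKrullDim (LaurentPolynomial ℂ) ≤ 1 :=
    LaurentPolynomial.ringKrullDim_le.trans (by simp)
  calc _ ≤ (1 : WithBot ℕ∞) + 1 := by gcongr
    _ = 2 := by norm_num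

@[simp]
theorem evalAt_single (p : ℂˣ × ℂˣ) (a b : ℤ) (c : ℂ) :
    evalAt p (AddMonoidAlgebra.single (a, b) c) = c * ((p.1 ^ a * p.2 ^ b : ℂˣ) : ℂ) := by
  rw [evalAt, AddMonoidAlgebra.lift_single]
  rfl

theorem mem_zeroLocus {A : Laurent2} {p : ℂˣ × ℂˣ} : p ∈ A.zeroLocus ↔ evalAt p A = 0 := Iff.rfl

/-- The kernel contains λ - λ₀ and μ - μ₀, and these determine the point. -/
theorem evalAt_ker_injective :
    Function.Injective fun p : ℂˣ × ℂˣ => RingHom.ker (evalAt p) := by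
  intro p q h
  have key : ∀ f : Laurent2, evalAt p f = 0 → evalAt q f = 0 := fun f hf => by
    have : f ∈ RingHom.ker (evalAt p) := hf
    rw [show RingHom.ker (evalAt p) = RingHom.ker (evalAt q) from h] at this
    exact this
  refine Prod.ext (Units.ext ?_) (Units.ext ?_)
  · have := key (AddMonoidAlgebra.single (1, 0) 1 - AddMonoidAlgebra.single (0, 0) (p.1 : ℂ))
      (by simp)
    simp only [map_sub, evalAt_single] at this
    simpa [sub_eq_zero, eq_comm] using this
  · have := key (AddMonoidAlgebra.single (0, 1) 1 - AddMonoidAlgebra.single (0, 0) (p.2 : ℂ))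
      (by simp)
    simp only [map_sub, evalAt_single] at this
    simpa [sub_eq_zero, eq_comm] using this

/-- Two curves without common component meet in finitely many points. -/
theorem finite_zeroLocus_inter {P H : Laurent2} (hP : Prime P) (hH : ¬ P ∣ H) :
    (P.zeroLocus ∩ H.zeroLocus).Finite := by
  let J : Ideal Laurent2 := Ideal.span {P, H}
  have hPJ : P ∈ J := Ideal.subset_span (by simp)
  have hHJ : H ∈ J := Ideal.subset_span (by simp)
  -- A nonmaximal prime Q above J would give the chain 0 < (P) < Q < M of length 3 in a ring of
  -- dimension at most 2.
  have hmax : ∀ Q : Ideal Laurent2, Q.IsPrime → J ≤ Q → Q.IsMaximal := by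
    intro Q hQ hJQ
    by_contra hnot
    obtain ⟨M, hM, hQM⟩ := Ideal.exists_le_maximal Q hQ.ne_top
    have hlt : Q < M := lt_of_le_of_ne hQM fun h => hnot (h ▸ hM)
    have hPp : (Ideal.span {P}).IsPrime := (Ideal.span_singleton_prime hP.ne_zero).2 hP
    have h2 : Ideal.span {P} < Q := by
      refine lt_of_le_of_ne ((Ideal.span_singleton_le_iff_mem _).2 (hJQ hPJ)) fun h => ?_
      exact hH (Ideal.mem_span_singleton.1 (h ▸ hJQ hHJ))
    have h1 : (⊥ : Ideal Laurent2) < Ideal.span {P} := by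
      rw [bot_lt_iff_ne_bot, Ne, Ideal.span_singleton_eq_bot]
      exact hP.ne_zero
    let q : Fin 4 → PrimeSpectrum Laurent2 :=
      ![⟨⊥, Ideal.isPrime_bot⟩, ⟨_, hPp⟩, ⟨Q, hQ⟩, ⟨M, hM.isPrime⟩]
    have hq : StrictMono q := by
      refine Fin.strictMono_iff_lt_succ.2 fun i => ?_
      fin_cases i
      exacts [h1, h2, hlt]
    have hs : ((3 : ℕ) : WithBot ℕ∞) ≤ ringKrullDim Laurent2 :=
      Order.LTSeries.length_le_krullDim (LTSeries.mk 3 q hq)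
    have h3 : ((3 : ℕ) : WithBot ℕ∞) ≤ 2 := hs.trans ringKrullDim_le
    exact absurd (by exact_mod_cast h3 : (3 : ℕ) ≤ 2) (by norm_num)
  have hdim : Ring.KrullDimLE 0 (Laurent2 ⧸ J) := by
    refine Ring.KrullDimLE.mk₀ fun I hI => ?_
    have hmap : Function.Surjective (Ideal.Quotient.mk J) := Ideal.Quotient.mk_surjective
    have hc : (I.comap (Ideal.Quotient.mk J)).IsMaximal := by
      refine hmax _ (hI.comap _) fun x hx => ?_
      rw [Ideal.mem_comap, Ideal.Quotient.eq_zero_iff_mem.2 hx]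
      exact I.zero_mem
    rw [← Ideal.map_comap_of_surjective _ hmap I]
    exact (Ideal.map_eq_top_or_isMaximal_of_surjective _ hmap hc).resolve_left fun h =>
      hI.ne_top (by rwa [Ideal.map_comap_of_surjective _ hmap] at h)
  -- The quotient by J is Artinian, so it has finitely many primes, and common zeros of P and H give
  -- distinct primes of it.
  have hart : IsArtinianRing (Laurent2 ⧸ J) :=
    isArtinianRing_iff_isNoetherianRing_krullDimLE_zero.2 ⟨inferInstance, hdim⟩
  have hfin : Finite (PrimeSpectrum (Laurent2 ⧸ J)) := inferInstance
  have hle : ∀ p ∈ P.zeroLocus ∩ H.zeroLocus, ∀ x ∈ J, evalAt p x = 0 := by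
    intro p hp x hx
    have : J ≤ RingHom.ker (evalAt p) := by
      rw [Ideal.span_le]
      rintro y (rfl | rfl)
      · exact hp.1
      · exact hp.2
    exact this hx
  let F : ↥(P.zeroLocus ∩ H.zeroLocus) → PrimeSpectrum (Laurent2 ⧸ J) := fun p =>
    ⟨RingHom.ker (Ideal.Quotient.lift J (evalAt p.1).toRingHom (hle p.1 p.2)),
      RingHom.ker_isPrime _⟩
  refine Set.finite_coe_iff.1
    (Finite.of_injective F fun p q h => Subtype.ext (evalAt_ker_injective ?_))
  have h' := congrArg (fun I => I.asIdeal.comap (Ideal.Quotient.mk J)) h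
  ext x
  have := Ideal.ext_iff.1 h' x
  simpa [F, Ideal.mem_comap, RingHom.mem_ker] using this

end Laurent2

/-! ### Zariski closures in the torus -/

theorem subset_zariskiClosure (U : Set (ℂˣ × ℂˣ)) : U ⊆ zariskiClosure U :=
  fun p hp _ hf => hf p hp

/-- The one-dimensional part of a Zariski closed set is given by an equation without repeated
factors. -/
theorem exists_squarefree_zeroLocus (U : Set (ℂˣ × ℂˣ)) :
    ∃ A : Laurent2, (A = 0 ∨ Squarefree A) ∧ A.zeroLocus ⊆ zariskiClosure U ∧
      (zariskiClosure U \ A.zeroLocus).Finite := by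
  classical
  by_cases hU : ∀ f : Laurent2, (∀ q ∈ U, Laurent2.evalAt q f = 0) → f = 0
  · refine ⟨0, .inl rfl, fun p _ f hf => by rw [hU f hf, map_zero], ?_⟩
    convert Set.finite_empty
    refine Set.eq_empty_of_forall_notMem fun p hp => hp.2 ?_
    exact map_zero _
  push Not at hU
  obtain ⟨f, hf, hf0⟩ := hU
  let : StrongNormalizationMonoid Laurent2 :=
    UniqueFactorizationMonoid.strongNormalizationMonoid
  let s : Finset Laurent2 := (UniqueFactorizationMonoid.normalizedFactors f).toFinset
  have hs : ∀ P ∈ s, Prime P := fun P hP =>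
    UniqueFactorizationMonoid.prime_of_normalized_factor P (Multiset.mem_toFinset.1 hP)
  -- Only those irreducible components of the curve f = 0 are kept that lie entirely in the closure.
  let s' := s.filter fun P => P.zeroLocus ⊆ zariskiClosure U
  have hloc : ∀ p, Laurent2.evalAt p (∏ P ∈ s', P) = 0 ↔ ∃ P ∈ s', p ∈ P.zeroLocus := by
    intro p
    rw [map_prod, Finset.prod_eq_zero_iff]
    rfl
  refine ⟨∏ P ∈ s', P, .inr ?_, ?_, ?_⟩
  · refine Finset.squarefree_prod_of_pairwise_isCoprime (fun P hP Q hQ hPQ => ?_) fun P hP =>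
      (hs P (Finset.mem_filter.1 hP).1).squarefree
    have hP' := (Finset.mem_filter.1 hP).1
    have hQ' := (Finset.mem_filter.1 hQ).1
    refine (hs P hP').irreducible.isRelPrime_iff_not_dvd.2 fun hdvd => hPQ ?_
    exact UniqueFactorizationMonoid.mem_normalizedFactors_eq_of_associated
      (Multiset.mem_toFinset.1 hP') (Multiset.mem_toFinset.1 hQ')
      ((hs P hP').irreducible.associated_of_dvd (hs Q hQ').irreducible hdvd)
  · intro p hp
    obtain ⟨P, hP, hpP⟩ := (hloc p).1 hp
    exact (Finset.mem_filter.1 hP).2 hpP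
  -- A discarded component P fails to satisfy some equation H of U, so P does not divide H and the
  -- closure meets P = 0 only in the finite set P = H = 0.
  · have hex : ∀ P ∈ s \ s', ∃ H : Laurent2, (∀ q ∈ U, Laurent2.evalAt q H = 0) ∧ ¬ P ∣ H := by
      intro P hP
      rw [Finset.mem_sdiff, Finset.mem_filter, not_and] at hP
      have := hP.2 hP.1
      obtain ⟨p, hpP, hp⟩ := Set.not_subset.1 this
      obtain ⟨H, hH'⟩ := not_forall.1 hp
      obtain ⟨hH, hne⟩ := Classical.not_imp.1 hH'
      refine ⟨H, hH, ?_⟩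
      rintro ⟨c, rfl⟩
      rw [map_mul, Laurent2.mem_zeroLocus.1 hpP, zero_mul] at hne
      exact hne rfl
    choose! H hH hPH using hex
    have hfin : (⋃ P ∈ s \ s', P.zeroLocus ∩ (H P).zeroLocus).Finite :=
      Set.Finite.biUnion (Finset.finite_toSet _) fun P hP =>
        Laurent2.finite_zeroLocus_inter (hs P (Finset.mem_sdiff.1 hP).1) (hPH P hP)
    refine hfin.subset fun p hp => ?_
    have hpf : Laurent2.evalAt p f = 0 := hp.1 f hf
    have h1 : Laurent2.evalAt p (UniqueFactorizationMonoid.normalizedFactors f).prod = 0 := by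
      obtain ⟨u, hu⟩ := (UniqueFactorizationMonoid.prod_normalizedFactors hf0).symm
      rw [← hu, map_mul, hpf, zero_mul]
    rw [map_multiset_prod, Multiset.prod_eq_zero_iff, Multiset.mem_map] at h1
    obtain ⟨P, hPf, hpP⟩ := h1
    have hPs : P ∈ s := Multiset.mem_toFinset.2 hPf
    have hPs' : P ∉ s' := fun h => hp.2 ((hloc p).2 ⟨P, h, hpP⟩)
    have hmem : P ∈ s \ s' := Finset.mem_sdiff.2 ⟨hPs, hPs'⟩
    exact Set.mem_biUnion hmem ⟨hpP, hp.1 _ (hH P hmem)⟩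

/-- A Laurent polynomial that vanishes at infinitely many points of the curve `λ μ ^ N = 1` is
divisible by `1 - λ μ ^ N`. -/
theorem one_sub_monomial_dvd (N : ℤ) (A : Laurent2) (S : Set ℂˣ) (hS : S.Infinite)
    (h : ∀ x ∈ S, Laurent2.evalAt (x ^ (-N), x) A = 0) :
    1 - Laurent2.monomial 1 1 N ∣ A := by
  -- The exponent map of the parametrization x ↦ (x^(-N), x): λ^a μ^b restricts to x^(b - Na).
  let φ : ℤ × ℤ →+ ℤ := AddMonoidHom.snd ℤ ℤ - N • AddMonoidHom.fst ℤ ℤ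
  let Φ : Laurent2 →+* LaurentPolynomial ℂ := AddMonoidAlgebra.mapDomainRingHom ℂ φ
  let Ψ : LaurentPolynomial ℂ →+* Laurent2 :=
    AddMonoidAlgebra.mapDomainRingHom ℂ (AddMonoidHom.inr ℤ ℤ)
  have hev : ∀ x : ℂˣ, ∀ f : Laurent2,
      LaurentPolynomial.eval₂ (RingHom.id ℂ) x (Φ f) = Laurent2.evalAt (x ^ (-N), x) f := by
    intro x f
    induction f using AddMonoidAlgebra.induction_linear with
    | zero => simp
    | add f g hf hg => rw [map_add, map_add, hf, hg, map_add]
    | single e c =>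
      obtain ⟨a, b⟩ := e
      have h1 : Φ (AddMonoidAlgebra.single (a, b) c) =
          LaurentPolynomial.C c * LaurentPolynomial.T (b - N * a) := by
        rw [← LaurentPolynomial.single_eq_C_mul_T]
        simp [Φ, φ]
      rw [h1, map_mul, LaurentPolynomial.eval₂_C, LaurentPolynomial.eval₂_T, Laurent2.evalAt_single,
        ← zpow_mul, ← zpow_add]
      congr 3
      ring
  have hzero : Φ A = 0 := LaurentPolynomial.eq_zero_of_infinite_zeros _ S hS fun x hx => by
    rw [hev, h x hx]
  let J := Ideal.span {1 - Laurent2.monomial 1 1 N}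
  -- Modulo J, λ^a μ^(Na) is 1, so λ^a μ^b is congruent to μ^(b - Na), which is its image under Ψ ∘
  -- Φ. Thus Φ A = 0 puts A into J.
  have hJ : (Ideal.Quotient.mk J).comp (Ψ.comp Φ) = Ideal.Quotient.mk J := by
    have hx : Ideal.Quotient.mk J (AddMonoidAlgebra.single ((1 : ℤ), N) 1) = 1 := by
      refine (Ideal.Quotient.eq.2 ?_).trans (map_one _)
      rw [← Ideal.neg_mem_iff, neg_sub]
      exact Ideal.mem_span_singleton_self _
    let U : Multiplicative ℤ →* Laurent2 ⧸ J :=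
      ((Ideal.Quotient.mk J : Laurent2 →* Laurent2 ⧸ J).comp (AddMonoidAlgebra.of ℂ (ℤ × ℤ))).comp
        (AddMonoidHom.toMultiplicative ((AddMonoidHom.id ℤ).prod (N • AddMonoidHom.id ℤ)))
    have hU : U = 1 := MonoidHom.ext_mint (by simpa [U] using hx)
    refine RingHom.ext fun f => ?_
    induction f using AddMonoidAlgebra.induction_linear with
    | zero => simp
    | add f g hf hg => rw [map_add, hf, hg, map_add]
    | single e c =>
      obtain ⟨a, b⟩ := e
      have h1 : Ideal.Quotient.mk J (AddMonoidAlgebra.single (a, N * a) 1) = 1 := by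
        simpa [U] using DFunLike.congr_fun hU (Multiplicative.ofAdd a)
      have h2 : (AddMonoidAlgebra.single (a, b) c : Laurent2) =
          AddMonoidAlgebra.single (a, N * a) 1 * Ψ (Φ (AddMonoidAlgebra.single (a, b) c)) := by
        have h3 : Φ (AddMonoidAlgebra.single (a, b) c) = AddMonoidAlgebra.single (b - N * a) c := by
          simp [Φ, φ, LaurentPolynomial.single_eq_C_mul_T]
        rw [h3, AddMonoidAlgebra.mapDomainRingHom_apply, AddMonoidAlgebra.mapDomain_single,
          AddMonoidAlgebra.single_mul_single]
        simp
      conv_rhs => rw [h2, map_mul, h1, one_mul]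
      rfl
  rw [← Ideal.mem_span_singleton, ← Ideal.Quotient.eq_zero_iff_mem, ← hJ]
  simp [hzero]

/-! ## Colourings of diagrams by group elements -/

section Colorings

variable {G : Type*} [Group G]

/-- The labels `b` below and `t` above a slice satisfy the Wirtinger relations. -/
def Slice.Compat (s : Slice) (b t : ℕ → G) : Prop := ∀ r ∈ s.relators b t, r = 1

/-- The labels of an elementary piece satisfy the Wirtinger relations. -/
def Piece.Compat (s : Piece) (b₀ b₁ t₀ t₁ : G) : Prop := ∀ r ∈ s.relators b₀ b₁ t₀ t₁, r = 1

theorem Slice.compat_iff {s : Slice} {b t : ℕ → G} :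
    s.Compat b t ↔ s.piece.Compat (b s.pos) (b (s.pos + 1)) (t s.pos) (t (s.pos + 1)) ∧
      (∀ i < s.pos, t i = b i) ∧
      ∀ i, t (s.pos + s.piece.outs + i) = b (s.pos + s.piece.ins + i) := by
  constructor
  · intro h
    refine ⟨fun r hr => h r (.inl (.inl hr)), fun i hi => ?_, fun i => ?_⟩
    · exact mul_inv_eq_one.1 (h _ (.inl (.inr ⟨i, hi, rfl⟩)))
    · exact mul_inv_eq_one.1 (h _ (.inr ⟨i, rfl⟩))
  · rintro ⟨h1, h2, h3⟩ r ((hr | ⟨i, hi, rfl⟩) | ⟨i, rfl⟩)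
    · exact h1 r hr
    · exact mul_inv_eq_one.2 (h2 i hi)
    · exact mul_inv_eq_one.2 (h3 i)

@[simp]
theorem Piece.compat_cup {b₀ b₁ t₀ t₁ : G} :
    Piece.cup.Compat b₀ b₁ t₀ t₁ ↔ t₁ * t₀ = 1 := by
  simp [Piece.Compat, Piece.relators]

@[simp]
theorem Piece.compat_cap {b₀ b₁ t₀ t₁ : G} :
    Piece.cap.Compat b₀ b₁ t₀ t₁ ↔ b₁ * b₀ = 1 := by
  simp [Piece.Compat, Piece.relators]

@[simp]
theorem Piece.compat_cross_true {b₀ b₁ t₀ t₁ : G} :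
    (Piece.cross true).Compat b₀ b₁ t₀ t₁ ↔ t₀ = b₀⁻¹ * b₁ * b₀ ∧ t₁ = b₀ := by
  simp only [Piece.Compat, Piece.relators, Set.mem_insert_iff, Set.mem_singleton_iff,
    forall_eq_or_imp, forall_eq, mul_inv_eq_one]
  constructor
  · rintro ⟨rfl, h⟩
    exact ⟨by rw [mul_assoc, h]; group, rfl⟩
  · rintro ⟨rfl, rfl⟩
    exact ⟨rfl, by group⟩

@[simp]
theorem Piece.compat_cross_false {b₀ b₁ t₀ t₁ : G} :
    (Piece.cross false).Compat b₀ b₁ t₀ t₁ ↔ t₀ = b₁ ∧ t₁ = b₁ * b₀ * b₁⁻¹ := by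
  simp only [Piece.Compat, Piece.relators, Set.mem_insert_iff, Set.mem_singleton_iff,
    forall_eq_or_imp, forall_eq, mul_inv_eq_one]
  constructor
  · rintro ⟨rfl, h⟩
    exact ⟨rfl, by rw [h]; group⟩
  · rintro ⟨rfl, rfl⟩
    exact ⟨rfl, by group⟩

/-- The labels above a crossing in terms of those below it. -/
def crossMap (β : Bool) (p : ℕ) (b : ℕ → G) : ℕ → G := fun i =>
  if i = p then (if β then (b p)⁻¹ * b (p + 1) * b p else b (p + 1))
  else if i = p + 1 then (if β then b p else b (p + 1) * b p * (b (p + 1))⁻¹)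
  else b i

/-- The labels above a maximum in terms of those below it. -/
def capMap (p : ℕ) (b : ℕ → G) : ℕ → G := fun i => b (if i < p then i else i + 2)

/-- The labels above a minimum with label `x` in terms of those below it. -/
def cupMap (p : ℕ) (x : G) (b : ℕ → G) : ℕ → G := fun i =>
  if i < p then b i else if i = p then x⁻¹ else if i = p + 1 then x else b (i - 2)

theorem compat_cross_iff {β : Bool} {p : ℕ} {b t : ℕ → G} :
    Slice.Compat ⟨.cross β, p⟩ b t ↔ t = crossMap β p b := by
  rw [Slice.compat_iff]
  constructor
  · rintro ⟨h1, h2, h3⟩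
    simp only [Piece.outs, Piece.ins] at h1 h2 h3
    funext i
    rcases lt_trichotomy i p with h | rfl | h
    · rw [h2 i h]
      simp [crossMap, h.ne, (h.trans (Nat.lt_succ_self p)).ne]
    · cases β <;> simp at h1 <;> simp [crossMap, h1]
    · rcases eq_or_ne i (p + 1) with rfl | h'
      · cases β <;> simp at h1 <;> simp [crossMap, h1]
      · obtain ⟨d, rfl⟩ := Nat.exists_eq_add_of_le (show p + 2 ≤ i by omega)
        rw [h3 d]
        simp [crossMap, h.ne', h']
  · rintro rfl
    refine ⟨?_, fun i hi => ?_, fun i => ?_⟩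
    · cases β <;> simp [crossMap]
    · have : i < p := hi
      simp [crossMap, this.ne, (this.trans (Nat.lt_succ_self p)).ne]
    · have h1 : p + 2 + i ≠ p := by omega
      have h2 : p + 2 + i ≠ p + 1 := by omega
      simp [crossMap, Piece.outs, Piece.ins, h1, h2]

theorem compat_cap_iff {p : ℕ} {b t : ℕ → G} :
    Slice.Compat ⟨.cap, p⟩ b t ↔ b (p + 1) * b p = 1 ∧ t = capMap p b := by
  rw [Slice.compat_iff, Piece.compat_cap]
  simp only [Piece.outs, Piece.ins, and_congr_right_iff, add_zero]
  refine fun _ => ⟨fun ⟨h2, h3⟩ => funext fun i => ?_, ?_⟩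
  · by_cases h : i < p
    · simp [capMap, h, h2]
    · obtain ⟨d, rfl⟩ := Nat.exists_eq_add_of_le (not_lt.1 h)
      simp [capMap, h3, add_right_comm]
  · rintro rfl
    exact ⟨fun i hi => by simp [capMap, hi], fun i => by simp [capMap, add_right_comm]⟩

theorem compat_cup_iff {p : ℕ} {b t : ℕ → G} :
    Slice.Compat ⟨.cup, p⟩ b t ↔ ∃ x, t = cupMap p x b := by
  rw [Slice.compat_iff, Piece.compat_cup]
  simp only [Piece.outs, Piece.ins, add_zero]
  constructor
  · rintro ⟨h1, h2, h3⟩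
    refine ⟨t (p + 1), funext fun i => ?_⟩
    rcases lt_trichotomy i p with h | rfl | h
    · simp [cupMap, h, h2]
    · simp [cupMap, eq_inv_of_mul_eq_one_right h1]
    · rcases eq_or_ne i (p + 1) with rfl | h'
      · simp [cupMap]
      · obtain ⟨d, rfl⟩ := Nat.exists_eq_add_of_le (show p + 2 ≤ i by omega)
        have : ¬ p + 2 + d < p := by omega
        have h4 : p + 2 + d - 2 = p + d := by omega
        simp [cupMap, h3, this, h', h.ne', h4]
  · rintro ⟨x, rfl⟩
    refine ⟨by simp [cupMap], fun i hi => by simp [cupMap, hi], fun i => ?_⟩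
    have h1 : ¬ p + 2 + i < p := by omega
    have h2 : p + 2 + i ≠ p := by omega
    have h3 : p + 2 + i ≠ p + 1 := by omega
    have h4 : p + 2 + i - 2 = p + i := by omega
    simp [cupMap, h1, h2, h3, h4]

/-- The tangle diagram `w` has a colouring with labels `b` at the bottom and `t` at the top, and
`L` is the set of all labels of the colouring. -/
def IsColoring : (ℕ → G) → List Slice → (ℕ → G) → Set G → Prop
  | b, [], t, L => b = t ∧ L = Set.range b
  | b, s :: w, t, L => ∃ m L', s.Compat b m ∧ IsColoring m w t L' ∧ L = Set.range b ∪ L'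

theorem IsColoring.range_bot_subset {b t : ℕ → G} {w : List Slice} {L : Set G}
    (h : IsColoring b w t L) : Set.range b ⊆ L := by
  cases w with
  | nil => exact h.2.ge
  | cons s w =>
    obtain ⟨m, L', -, -, rfl⟩ := h
    exact Set.subset_union_left

theorem IsColoring.range_top_subset {b t : ℕ → G} {w : List Slice} {L : Set G}
    (h : IsColoring b w t L) : Set.range t ⊆ L := by
  induction w generalizing b L with
  | nil => exact h.1 ▸ h.2.ge
  | cons s w ih =>
    obtain ⟨m, L', -, h, rfl⟩ := h
    exact (ih h).trans Set.subset_union_right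

theorem isColoring_append {b t : ℕ → G} {u v : List Slice} {L : Set G} :
    IsColoring b (u ++ v) t L ↔
      ∃ m L₁ L₂, IsColoring b u m L₁ ∧ IsColoring m v t L₂ ∧ L = L₁ ∪ L₂ := by
  induction u generalizing b L with
  | nil =>
    constructor
    · intro h
      exact ⟨b, _, L, ⟨rfl, rfl⟩, h, (Set.union_eq_right.2 h.range_bot_subset).symm⟩
    · rintro ⟨m, L₁, L₂, ⟨rfl, rfl⟩, h, rfl⟩
      rwa [Set.union_eq_right.2 h.range_bot_subset]
  | cons s u ih =>
    constructor
    · rintro ⟨m, L', hs, h, rfl⟩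
      obtain ⟨n, L₁, L₂, h1, h2, rfl⟩ := ih.1 h
      exact ⟨n, _, L₂, ⟨m, L₁, hs, h1, rfl⟩, h2, (Set.union_assoc _ _ _).symm⟩
    · rintro ⟨n, L₁, L₂, ⟨m, L', hs, h, rfl⟩, h2, rfl⟩
      exact ⟨m, _, hs, ih.2 ⟨n, _, _, h, h2, rfl⟩, Set.union_assoc _ _ _⟩

/-- A set of group elements that is closed under inversion and conjugation by its elements. -/
structure IsConjClosed (C : Set G) : Prop where
  inv_mem : ∀ {x}, x ∈ C → x⁻¹ ∈ C
  conj_mem : ∀ {x y}, x ∈ C → y ∈ C → y * x * y⁻¹ ∈ C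

theorem IsConjClosed.conj_mem' {C : Set G} (hC : IsConjClosed C) {x y : G} (hx : x ∈ C)
    (hy : y ∈ C) : y⁻¹ * x * y ∈ C := by
  simpa using hC.conj_mem hx (hC.inv_mem hy)

theorem Subgroup.isConjClosed (H : Subgroup G) : IsConjClosed (H : Set G) :=
  ⟨H.inv_mem, fun hx hy => H.mul_mem (H.mul_mem hy hx) (H.inv_mem hy)⟩

theorem IsConjClosed.crossMap_mem {C : Set G} (hC : IsConjClosed C) {b : ℕ → G}
    (hb : ∀ i, b i ∈ C) (β : Bool) (p i : ℕ) : crossMap β p b i ∈ C := by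
  unfold crossMap
  split_ifs
  exacts [hC.conj_mem' (hb _) (hb _), hb _, hb _, hC.conj_mem (hb _) (hb _), hb _]

theorem crossMap_crossMap (β : Bool) (p : ℕ) (b : ℕ → G) :
    crossMap (!β) p (crossMap β p b) = b := by
  funext i
  unfold crossMap
  rcases eq_or_ne i p with rfl | h1
  · cases β <;> simp [mul_assoc]
  · rcases eq_or_ne i (p + 1) with rfl | h2
    · cases β <;> simp [mul_assoc]
    · simp [h1, h2]

theorem IsConjClosed.of_crossMap_mem {C : Set G} (hC : IsConjClosed C) {b : ℕ → G} {β : Bool}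
    {p : ℕ} (h : ∀ i, crossMap β p b i ∈ C) (i : ℕ) : b i ∈ C := by
  rw [← crossMap_crossMap β p b]
  exact hC.crossMap_mem h _ _ _

/-- The labels of a colouring of `w` are determined up to inversion and conjugation by the labels
of the end points. -/
def IsRigid (G : Type*) [Group G] (w : List Slice) : Prop :=
  ∀ (b t : ℕ → G) (L C : Set G), IsColoring b w t L → IsConjClosed C →
    (∀ i, b i ∈ C) → (∀ i, t i ∈ C) → L ⊆ C

theorem isRigid_nil : IsRigid G [] := by
  rintro b t L C ⟨rfl, rfl⟩ - hb -
  exact Set.range_subset_iff.2 hb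

theorem isRigid_singleton (s : Slice) : IsRigid G [s] := by
  rintro b t L C ⟨m, L', -, ⟨rfl, rfl⟩, rfl⟩ - hb ht
  exact Set.union_subset (Set.range_subset_iff.2 hb) (Set.range_subset_iff.2 ht)

theorem isRigid_cross_cons {β : Bool} {p : ℕ} {w : List Slice} (h : IsRigid G w) :
    IsRigid G (⟨.cross β, p⟩ :: w) := by
  rintro b t L C ⟨m, L', hm, hw, rfl⟩ hC hb ht
  rw [compat_cross_iff] at hm
  subst hm
  exact Set.union_subset (Set.range_subset_iff.2 hb)
    (h _ _ _ _ hw hC (hC.crossMap_mem hb _ _) ht)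

theorem isRigid_pair {s s' : Slice}
    (h : ∀ (b m t : ℕ → G) (C : Set G), IsConjClosed C → (∀ i, b i ∈ C) → (∀ i, t i ∈ C) →
      s.Compat b m → s'.Compat m t → ∀ i, m i ∈ C) : IsRigid G [s, s'] := by
  rintro b t L C ⟨m, L', hm, ⟨n, L'', hn, ⟨rfl, rfl⟩, rfl⟩, rfl⟩ hC hb ht
  exact Set.union_subset (Set.range_subset_iff.2 hb) (Set.union_subset
    (Set.range_subset_iff.2 (h _ _ _ _ hC hb ht hm hn)) (Set.range_subset_iff.2 ht))

/-- Every interior row of a move is tied to an end row: crossings can be inverted, and the free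
label of a new minimum is recovered from the maximum or the crossing above it. For the exchange,
each strand of the middle row is unchanged either from below or to above. -/
theorem LocalMove.isRigid {l r : List Slice} (h : LocalMove l r) :
    IsRigid G l ∧ IsRigid G r := by
  cases h with
  | exchange s t p d =>
    refine ⟨isRigid_pair fun b m c C _ hb hc h1 h2 i => ?_,
      isRigid_pair fun b m c C _ hb hc h1 h2 i => ?_⟩
    all_goals
      rw [Slice.compat_iff] at h1 h2
      simp only at h1 h2
    · rcases lt_or_ge i (p + s.outs + d) with hi | hi
      · rw [← h2.2.1 i hi]; exact hc i
      · obtain ⟨e, rfl⟩ := Nat.exists_eq_add_of_le hi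
        rw [add_assoc, h1.2.2]; exact hb _
    · rcases lt_or_ge i (p + s.ins + d) with hi | hi
      · rw [h1.2.1 i hi]; exact hb i
      · obtain ⟨e, rfl⟩ := Nat.exists_eq_add_of_le hi
        rw [add_assoc, ← h2.2.2]; exact hc _
  | zigzagLeft p =>
    refine ⟨isRigid_pair fun b m t C hC hb ht h1 h2 i => ?_, isRigid_nil⟩
    rw [compat_cap_iff] at h2
    rw [compat_cup_iff] at h1
    obtain ⟨x, rfl⟩ := h1
    have hx : x = b p := by simpa [cupMap, inv_mul_eq_one] using h2.1
    subst hx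
    unfold cupMap
    split_ifs
    exacts [hb _, hC.inv_mem (hb _), hb _, hb _]
  | zigzagRight p =>
    refine ⟨isRigid_pair fun b m t C hC hb ht h1 h2 i => ?_, isRigid_nil⟩
    rw [compat_cap_iff] at h2
    rw [compat_cup_iff] at h1
    obtain ⟨x, rfl⟩ := h1
    have hx : x = (b p)⁻¹ := eq_inv_of_mul_eq_one_right (by
      have h : ¬ p + 1 + 1 < p := by omega
      have h' : p + 1 + 1 ≠ p := by omega
      simpa [cupMap, h, h'] using h2.1)
    subst hx
    unfold cupMap
    split_ifs
    exacts [hb _, hC.inv_mem (hC.inv_mem (hb _)), hC.inv_mem (hb _), hb _]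
  | slideCap b p =>
    exact ⟨isRigid_cross_cons (isRigid_singleton _), isRigid_cross_cons (isRigid_singleton _)⟩
  | slideCup b p =>
    refine ⟨isRigid_pair fun b m c C hC hb hc h1 h2 => ?_,
      isRigid_pair fun b m c C hC hb hc h1 h2 => ?_⟩
    all_goals
      rw [compat_cross_iff] at h2
      subst h2
      exact hC.of_crossMap_mem hc
  | reidemeisterOneCap b p =>
    exact ⟨isRigid_cross_cons (isRigid_singleton _), isRigid_singleton _⟩
  | reidemeisterOneCup b p =>
    refine ⟨isRigid_pair fun b m c C hC hb hc h1 h2 => ?_, isRigid_singleton _⟩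
    rw [compat_cross_iff] at h2
    subst h2
    exact hC.of_crossMap_mem hc
  | reidemeisterTwo b p =>
    exact ⟨isRigid_cross_cons (isRigid_cross_cons isRigid_nil), isRigid_nil⟩
  | reidemeisterThree b p =>
    exact ⟨isRigid_cross_cons (isRigid_cross_cons (isRigid_cross_cons isRigid_nil)),
      isRigid_cross_cons (isRigid_cross_cons (isRigid_cross_cons isRigid_nil))⟩

/-- The tangle diagram `w` has a colouring with labels `b` at the bottom and `t` at the top. -/
def IsColorable (b : ℕ → G) (w : List Slice) (t : ℕ → G) : Prop := ∃ L, IsColoring b w t L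

theorem isColorable_nil {b t : ℕ → G} : IsColorable b [] t ↔ b = t := by
  simp [IsColorable, IsColoring]

theorem isColorable_cons {b t : ℕ → G} {s : Slice} {w : List Slice} :
    IsColorable b (s :: w) t ↔ ∃ m, s.Compat b m ∧ IsColorable m w t := by
  constructor
  · rintro ⟨L, m, L', h1, h2, -⟩
    exact ⟨m, h1, L', h2⟩
  · rintro ⟨m, h1, L', h2⟩
    exact ⟨_, m, L', h1, h2, rfl⟩

/-- The two pieces act on disjoint ranges of strands, so the new middle row is glued from the bottom
row on one side of a cut and the top row on the other. -/
theorem isColorable_exchange_iff (s t : Piece) (p d : ℕ) (b c : ℕ → G) :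
    IsColorable b [⟨s, p⟩, ⟨t, p + s.outs + d⟩] c ↔
      IsColorable b [⟨t, p + s.ins + d⟩, ⟨s, p⟩] c := by
  simp only [isColorable_cons, isColorable_nil, exists_eq_right, Slice.compat_iff]
  constructor
  · rintro ⟨m, ⟨h1, h2, h3⟩, h4, h5, h6⟩
    have hb : ∀ e, b (p + s.ins + d + e) = m (p + s.outs + d + e) := fun e => by
      rw [add_assoc, add_assoc (p + s.outs), h3]
    -- Now the right piece comes first: left of it nothing has happened yet, right of it everything
    -- has.
    let m' : ℕ → G := fun i =>
      if i < p + s.ins + d then b i else c (p + s.outs + d + (i - (p + s.ins + d)))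
    have hm1 : ∀ i < p + s.ins + d, m' i = b i := fun i hi => if_pos hi
    have hm2 : ∀ e, m' (p + s.ins + d + e) = c (p + s.outs + d + e) := fun e => by
      simp [m']
    refine ⟨m', ⟨?_, hm1, fun i => ?_⟩, ?_, fun i hi => ?_, fun i => ?_⟩
    · have e0 := hb 0
      have e1 := hm2 0
      rw [add_zero, add_zero] at e0 e1
      rwa [e0, hb 1, e1, hm2 1]
    · rw [add_assoc _ t.outs, hm2, add_assoc _ t.ins, hb, ← add_assoc, ← add_assoc, h6]
    · cases s with
      | cup =>
        have e0 := h5 p (by simp only [Piece.outs]; omega)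
        have e1 := h5 (p + 1) (by simp only [Piece.outs]; omega)
        simpa [e0, e1] using h1
      | cap =>
        have e0 := hm1 p (by simp only [Piece.ins]; omega)
        have e1 := hm1 (p + 1) (by simp only [Piece.ins]; omega)
        simpa [e0, e1] using h1
      | cross β =>
        have e0 := h5 p (by simp only [Piece.outs]; omega)
        have e1 := h5 (p + 1) (by simp only [Piece.outs]; omega)
        have e2 := hm1 p (by simp only [Piece.ins]; omega)
        have e3 := hm1 (p + 1) (by simp only [Piece.ins]; omega)
        simpa only [e0, e1, e2, e3] using h1
    · rw [h5 i (by omega), hm1 i (by omega), h2 i hi]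
    · rcases lt_or_ge i d with hi | hi
      · rw [h5 _ (by omega), hm1 _ (by omega), h3]
      · obtain ⟨e, rfl⟩ := Nat.exists_eq_add_of_le hi
        rw [← add_assoc, ← add_assoc, hm2]
  · rintro ⟨m', ⟨h4, h5, h6⟩, h1, h2, h3⟩
    have hc : ∀ e, c (p + s.outs + d + e) = m' (p + s.ins + d + e) := fun e => by
      rw [add_assoc, add_assoc (p + s.ins), h3]
    let m : ℕ → G := fun i =>
      if i < p + s.outs + d then c i else b (p + s.ins + d + (i - (p + s.outs + d)))
    have hm1 : ∀ i < p + s.outs + d, m i = c i := fun i hi => if_pos hi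
    have hm2 : ∀ e, m (p + s.outs + d + e) = b (p + s.ins + d + e) := fun e => by
      simp [m]
    refine ⟨m, ⟨?_, fun i hi => ?_, fun i => ?_⟩, ?_, fun i hi => (hm1 i hi).symm, fun i => ?_⟩
    · cases s with
      | cup =>
        have e0 := hm1 p (by simp only [Piece.outs]; omega)
        have e1 := hm1 (p + 1) (by simp only [Piece.outs]; omega)
        simpa [e0, e1] using h1
      | cap =>
        have e0 := h5 p (by simp only [Piece.ins]; omega)
        have e1 := h5 (p + 1) (by simp only [Piece.ins]; omega)
        simpa [e0, e1] using h1
      | cross β =>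
        have e0 := hm1 p (by simp only [Piece.outs]; omega)
        have e1 := hm1 (p + 1) (by simp only [Piece.outs]; omega)
        have e2 := h5 p (by simp only [Piece.ins]; omega)
        have e3 := h5 (p + 1) (by simp only [Piece.ins]; omega)
        simpa only [e0, e1, e2, e3] using h1
    · rw [hm1 i (by omega), h2 i hi, h5 i (by omega)]
    · rcases lt_or_ge i d with hi | hi
      · rw [hm1 _ (by omega), h3, h5 _ (by omega)]
      · obtain ⟨e, rfl⟩ := Nat.exists_eq_add_of_le hi
        rw [← add_assoc, ← add_assoc, hm2]
    · have e0 := hc 0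
      have e1 := hm2 0
      rw [add_zero, add_zero] at e0 e1
      rwa [e0, hc 1, e1, hm2 1]
    · rw [add_assoc _ t.outs, hc, add_assoc _ t.ins, hm2, ← add_assoc, ← add_assoc, h6]

end Colorings

/-! ### Colourings under the remaining local moves, under isotopy, and their generation by maxima -/

section Colorings

variable {G : Type*} [Group G]

section Values

variable (β : Bool) (p : ℕ) (b : ℕ → G) (x : G)

theorem crossMap_of_lt {i : ℕ} (h : i < p) : crossMap β p b i = b i := by
  simp [crossMap, h.ne, (h.trans (Nat.lt_succ_self p)).ne]

theorem crossMap_of_ge {i : ℕ} (h : p + 2 ≤ i) : crossMap β p b i = b i := by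
  have h1 : i ≠ p := by omega
  have h2 : i ≠ p + 1 := by omega
  simp [crossMap, h1, h2]

theorem crossMap_true_left : crossMap true p b p = (b p)⁻¹ * b (p + 1) * b p := by simp [crossMap]
theorem crossMap_true_right : crossMap true p b (p + 1) = b p := by simp [crossMap]
theorem crossMap_false_left : crossMap false p b p = b (p + 1) := by simp [crossMap]
theorem crossMap_false_right :
    crossMap false p b (p + 1) = b (p + 1) * b p * (b (p + 1))⁻¹ := by simp [crossMap]

theorem capMap_of_lt {G : Type*} (p : ℕ) (b : ℕ → G) {i : ℕ} (h : i < p) : capMap p b i = b i := by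
  simp [capMap, h]

theorem capMap_of_ge {G : Type*} (p : ℕ) (b : ℕ → G) {i : ℕ} (h : p ≤ i) :
    capMap p b i = b (i + 2) := by
  simp [capMap, h.not_gt]

theorem cupMap_of_lt {i : ℕ} (h : i < p) : cupMap p x b i = b i := by simp [cupMap, h]

theorem cupMap_left : cupMap p x b p = x⁻¹ := by simp [cupMap]

theorem cupMap_right : cupMap p x b (p + 1) = x := by simp [cupMap]

theorem cupMap_of_ge {i : ℕ} (h : p ≤ i) : cupMap p x b (i + 2) = b i := by
  have h0 : ¬ i + 2 < p := by omega
  have h1 : i + 2 ≠ p := by omega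
  have h2 : i + 2 ≠ p + 1 := by omega
  simp [cupMap, h0, h1, h2]

end Values

theorem capMap_cupMap (p : ℕ) (x : G) (b : ℕ → G) : capMap p (cupMap p x b) = b := by
  funext i
  rcases lt_or_ge i p with h | h
  · rw [capMap_of_lt _ _ h, cupMap_of_lt _ _ _ h]
  · rw [capMap_of_ge _ _ h, cupMap_of_ge _ _ _ h]

theorem isColorable_zigzagLeft_iff (p : ℕ) (b t : ℕ → G) :
    IsColorable b [⟨.cup, p + 1⟩, ⟨.cap, p⟩] t ↔ IsColorable b [] t := by
  have hcap : capMap p (cupMap (p + 1) (b p) b) = b := by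
    funext i
    rcases lt_trichotomy i p with h | rfl | h
    · rw [capMap_of_lt _ _ h, cupMap_of_lt _ _ _ (by omega)]
    · rw [capMap_of_ge _ _ le_rfl, cupMap_right]
    · rw [capMap_of_ge _ _ h.le, cupMap_of_ge _ _ _ h]
  simp only [isColorable_cons, isColorable_nil, exists_eq_right, compat_cup_iff, compat_cap_iff]
  constructor
  · rintro ⟨_, ⟨x, rfl⟩, h, rfl⟩
    rw [cupMap_left, cupMap_of_lt _ _ _ (Nat.lt_succ_self p), inv_mul_eq_one] at h
    rw [h, hcap]
  · rintro rfl
    refine ⟨_, ⟨b p, rfl⟩, ?_, hcap.symm⟩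
    rw [cupMap_left, cupMap_of_lt _ _ _ (Nat.lt_succ_self p), inv_mul_cancel]

theorem isColorable_zigzagRight_iff (p : ℕ) (b t : ℕ → G) :
    IsColorable b [⟨.cup, p⟩, ⟨.cap, p + 1⟩] t ↔ IsColorable b [] t := by
  have hcap : capMap (p + 1) (cupMap p (b p)⁻¹ b) = b := by
    funext i
    rcases lt_trichotomy i p with h | rfl | h
    · rw [capMap_of_lt _ _ (by omega), cupMap_of_lt _ _ _ h]
    · rw [capMap_of_lt _ _ (Nat.lt_succ_self i), cupMap_left, inv_inv]
    · rw [capMap_of_ge _ _ h, cupMap_of_ge _ _ _ h.le]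
  simp only [isColorable_cons, isColorable_nil, exists_eq_right, compat_cup_iff, compat_cap_iff]
  constructor
  · rintro ⟨_, ⟨x, rfl⟩, h, rfl⟩
    rw [cupMap_right, cupMap_of_ge _ _ _ le_rfl] at h
    rw [eq_inv_of_mul_eq_one_right h, hcap]
  · rintro rfl
    refine ⟨_, ⟨(b p)⁻¹, rfl⟩, ?_, hcap.symm⟩
    rw [cupMap_right, cupMap_of_ge _ _ _ le_rfl, mul_inv_cancel]

/-- The two expressions for the label of the sliding strand agree only by virtue of the relation at
the maximum. Hence this relation is compared first, and the top rows are compared under it. -/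
theorem isColorable_slideCap_iff (β : Bool) (p : ℕ) (b t : ℕ → G) :
    IsColorable b [⟨.cross β, p⟩, ⟨.cap, p + 1⟩] t ↔
      IsColorable b [⟨.cross (!β), p + 1⟩, ⟨.cap, p⟩] t := by
  simp only [isColorable_cons, isColorable_nil, exists_eq_right, compat_cross_iff, compat_cap_iff]
  have h1 : crossMap β p b (p + 1 + 1) = b (p + 2) := crossMap_of_ge _ _ _ le_rfl
  have h2 : crossMap (!β) (p + 1) b p = b p := crossMap_of_lt _ _ _ (Nat.lt_succ_self p)
  have h3 : crossMap β p b (p + 1 + 1) * crossMap β p b (p + 1) = 1 ↔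
      crossMap (!β) (p + 1) b (p + 1) * crossMap (!β) (p + 1) b p = 1 := by
    rw [h1, h2]
    cases β
    · simp only [Bool.not_false, crossMap_false_right, crossMap_true_left, mul_eq_one_iff_eq_inv]
      constructor
      · intro h
        simp [h, mul_assoc]
      · intro h
        rw [mul_assoc, inv_mul_eq_iff_eq_mul, ← eq_mul_inv_iff_mul_eq] at h
        simp [h, mul_assoc]
    · simp only [Bool.not_true, crossMap_true_right, crossMap_false_left]
  simp only [exists_eq_left]
  rw [h3]
  refine and_congr_right fun h => ?_
  suffices capMap (p + 1) (crossMap β p b) = capMap p (crossMap (!β) (p + 1) b) by rw [this]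
  funext i
  rcases lt_trichotomy i p with hi | rfl | hi
  · rw [capMap_of_lt _ _ (by omega), capMap_of_lt _ _ hi, crossMap_of_lt _ _ _ hi,
      crossMap_of_lt _ _ _ (by omega)]
  · rw [capMap_of_lt _ _ (Nat.lt_succ_self i), capMap_of_ge _ _ le_rfl]
    rw [h2] at h
    cases β
    · rw [Bool.not_false, crossMap_true_left, mul_eq_one_iff_eq_inv, mul_assoc,
        inv_mul_eq_iff_eq_mul, ← eq_mul_inv_iff_mul_eq] at h
      rw [crossMap_false_left, Bool.not_false, show i + 2 = i + 1 + 1 from rfl,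
        crossMap_true_right]
    · rw [Bool.not_true, crossMap_false_left] at h
      rw [crossMap_true_left, Bool.not_true, show i + 2 = i + 1 + 1 from rfl,
        crossMap_false_right, eq_inv_of_mul_eq_one_left h, inv_inv]
  · rw [capMap_of_ge _ _ hi, capMap_of_ge _ _ hi.le, crossMap_of_ge _ _ _ (by omega),
      crossMap_of_ge _ _ _ (by omega)]

theorem isColorable_slideCup_iff (β : Bool) (p : ℕ) (b t : ℕ → G) :
    IsColorable b [⟨.cup, p + 1⟩, ⟨.cross β, p⟩] t ↔
      IsColorable b [⟨.cup, p⟩, ⟨.cross (!β), p + 1⟩] t := by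
  have n1 : p + 1 + 1 ≠ p := by omega
  have n2 : ¬ p + 1 + 1 < p := by omega
  -- If the strand with label b p passes over, moving the minimum to its other side conjugates the
  -- free label by b p; otherwise the label is unchanged.
  have key : ∀ x, crossMap β p (cupMap (p + 1) x b) =
      crossMap (!β) (p + 1) (cupMap p (if β then (b p)⁻¹ * x * b p else x) b) := by
    intro x
    funext i
    rcases lt_or_ge i p with h | h
    · rw [crossMap_of_lt _ _ _ h, crossMap_of_lt _ _ _ (by omega), cupMap_of_lt _ _ _ h,
        cupMap_of_lt _ _ _ (by omega)]
    · obtain ⟨d, rfl⟩ := Nat.exists_eq_add_of_le h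
      match d with
      | 0 => cases β <;> simp [crossMap, cupMap, mul_assoc, n1.symm]
      | 1 => cases β <;> simp [crossMap, cupMap, mul_assoc, n1, n2]
      | 2 => cases β <;> simp [crossMap, cupMap, mul_assoc, n1, n2]
      | d + 3 =>
        rw [crossMap_of_ge _ _ _ (by omega), crossMap_of_ge _ _ _ (by omega),
          show p + (d + 3) = p + (d + 1) + 2 by omega, cupMap_of_ge _ _ _ (by omega),
          cupMap_of_ge _ _ _ (by omega)]
  simp only [isColorable_cons, isColorable_nil, exists_eq_right, compat_cross_iff, compat_cup_iff]
  constructor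
  · rintro ⟨_, ⟨x, rfl⟩, rfl⟩
    exact ⟨_, ⟨_, rfl⟩, key x⟩
  · rintro ⟨_, ⟨y, rfl⟩, rfl⟩
    refine ⟨_, ⟨if β then b p * y * (b p)⁻¹ else y, rfl⟩, ?_⟩
    rw [key]
    cases β <;> simp [mul_assoc]

theorem isColorable_reidemeisterOneCap_iff (β : Bool) (p : ℕ) (b t : ℕ → G) :
    IsColorable b [⟨.cross β, p⟩, ⟨.cap, p⟩] t ↔ IsColorable b [⟨.cap, p⟩] t := by
  simp only [isColorable_cons, isColorable_nil, exists_eq_right, exists_eq_left, compat_cross_iff,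
    compat_cap_iff]
  have h1 : crossMap β p b (p + 1) * crossMap β p b p = b (p + 1) * b p := by
    cases β <;> simp [crossMap, mul_assoc]
  have h2 : capMap p (crossMap β p b) = capMap p b := by
    funext i
    rcases lt_or_ge i p with h | h
    · rw [capMap_of_lt _ _ h, capMap_of_lt _ _ h, crossMap_of_lt _ _ _ h]
    · rw [capMap_of_ge _ _ h, capMap_of_ge _ _ h, crossMap_of_ge _ _ _ (by omega)]
  rw [h1, h2]

theorem isColorable_reidemeisterOneCup_iff (β : Bool) (p : ℕ) (b t : ℕ → G) :
    IsColorable b [⟨.cup, p⟩, ⟨.cross β, p⟩] t ↔ IsColorable b [⟨.cup, p⟩] t := by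
  have h (x : G) : crossMap β p (cupMap p x b) = cupMap p x⁻¹ b := by
    funext i
    rcases lt_trichotomy i p with h | rfl | h
    · rw [crossMap_of_lt _ _ _ h, cupMap_of_lt _ _ _ h, cupMap_of_lt _ _ _ h]
    · cases β <;> simp [crossMap, cupMap]
    · rcases eq_or_ne i (p + 1) with rfl | h'
      · cases β <;> simp [crossMap, cupMap]
      · obtain ⟨j, rfl⟩ := Nat.exists_eq_add_of_le' (show 2 ≤ i by omega)
        rw [crossMap_of_ge _ _ _ (by omega), cupMap_of_ge _ _ _ (by omega),
          cupMap_of_ge _ _ _ (by omega)]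
  simp only [isColorable_cons, isColorable_nil, exists_eq_right, compat_cross_iff, compat_cup_iff]
  constructor
  · rintro ⟨_, ⟨x, rfl⟩, rfl⟩
    exact ⟨x⁻¹, h x⟩
  · rintro ⟨x, rfl⟩
    exact ⟨_, ⟨x⁻¹, rfl⟩, by rw [h, inv_inv]⟩

theorem isColorable_reidemeisterTwo_iff (β : Bool) (p : ℕ) (b t : ℕ → G) :
    IsColorable b [⟨.cross β, p⟩, ⟨.cross (!β), p⟩] t ↔ IsColorable b [] t := by
  simp only [isColorable_cons, isColorable_nil, exists_eq_right, exists_eq_left, compat_cross_iff,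
    crossMap_crossMap]
  exact eq_comm

theorem crossMap_braid (β : Bool) (p : ℕ) (b : ℕ → G) :
    crossMap β p (crossMap β (p + 1) (crossMap β p b)) =
      crossMap β (p + 1) (crossMap β p (crossMap β (p + 1) b)) := by
  have n1 : p + 1 + 1 ≠ p := by omega
  funext i
  rcases lt_or_ge i p with h | h
  · simp only [crossMap_of_lt _ _ _ h, crossMap_of_lt _ _ _ (h.trans (Nat.lt_succ_self p))]
  · obtain ⟨d, rfl⟩ := Nat.exists_eq_add_of_le h
    match d with
    | 0 => cases β <;> simp [crossMap, mul_assoc, n1, n1.symm]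
    | 1 => cases β <;> simp [crossMap, mul_assoc, n1, n1.symm]
    | 2 => cases β <;> simp [crossMap, mul_assoc, n1, n1.symm]
    | d + 3 =>
      have h1 : p + 1 + 2 ≤ p + (d + 3) := by omega
      have h2 : p + 2 ≤ p + (d + 3) := by omega
      simp only [crossMap_of_ge _ _ _ h1, crossMap_of_ge _ _ _ h2]

theorem LocalMove.isColorable_iff {l r : List Slice} (h : LocalMove l r) (b t : ℕ → G) :
    IsColorable b l t ↔ IsColorable b r t := by
  cases h with
  | exchange s t' p d => exact isColorable_exchange_iff s t' p d b t
  | zigzagLeft p => exact isColorable_zigzagLeft_iff p b t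
  | zigzagRight p => exact isColorable_zigzagRight_iff p b t
  | slideCap β p => exact isColorable_slideCap_iff β p b t
  | slideCup β p => exact isColorable_slideCup_iff β p b t
  | reidemeisterOneCap β p => exact isColorable_reidemeisterOneCap_iff β p b t
  | reidemeisterOneCup β p => exact isColorable_reidemeisterOneCup_iff β p b t
  | reidemeisterTwo β p => exact isColorable_reidemeisterTwo_iff β p b t
  | reidemeisterThree β p =>
    simp only [isColorable_cons, isColorable_nil, exists_eq_right, exists_eq_left,
      compat_cross_iff, crossMap_braid]

/-- Colourings of isotopic diagrams correspond to each other in such a way that each set that is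
closed under inversion and conjugation contains all labels of one iff it contains all labels of
the other. -/
theorem LinkDiagram.Move.exists_isColoring {D D' : LinkDiagram} (h : D.Move D') (b t : ℕ → G) :
    (∀ L, IsColoring b D.slices t L → ∃ L', IsColoring b D'.slices t L' ∧
      ∀ C, IsConjClosed C → (L ⊆ C ↔ L' ⊆ C)) ∧
    ∀ L, IsColoring b D'.slices t L → ∃ L', IsColoring b D.slices t L' ∧
      ∀ C, IsConjClosed C → (L ⊆ C ↔ L' ⊆ C) := by
  obtain ⟨u, l, r, v, hm, hD, hD'⟩ := h
  -- The colouring is kept outside the move. Rigidity confines the new middle labels to C, because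
  -- the end rows of the middle part also belong to the outer parts.
  have key : ∀ l r : List Slice, IsRigid G l → IsRigid G r →
      (∀ b t : ℕ → G, IsColorable b l t → IsColorable b r t) →
      ∀ L, IsColoring b (u ++ l ++ v) t L → ∃ L', IsColoring b (u ++ r ++ v) t L' ∧
        ∀ C, IsConjClosed C → (L ⊆ C ↔ L' ⊆ C) := by
    intro l r hl hr hlr L hL
    obtain ⟨n, _, L₃, hL', h3, rfl⟩ := isColoring_append.1 hL
    obtain ⟨m, L₁, L₂, h1, h2, rfl⟩ := isColoring_append.1 hL'
    obtain ⟨L₂', h2'⟩ := hlr m n ⟨L₂, h2⟩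
    refine ⟨_, isColoring_append.2 ⟨n, _, L₃, isColoring_append.2 ⟨m, L₁, L₂', h1, h2', rfl⟩,
      h3, rfl⟩, fun C hC => ?_⟩
    simp only [Set.union_subset_iff]
    have hmn : L₁ ⊆ C → L₃ ⊆ C → (∀ i, m i ∈ C) ∧ ∀ i, n i ∈ C := fun hm hn =>
      ⟨Set.range_subset_iff.1 (h1.range_top_subset.trans hm),
        Set.range_subset_iff.1 (h3.range_bot_subset.trans hn)⟩
    constructor
    · rintro ⟨⟨hL1, -⟩, hL3⟩
      exact ⟨⟨hL1, hr _ _ _ _ h2' hC (hmn hL1 hL3).1 (hmn hL1 hL3).2⟩, hL3⟩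
    · rintro ⟨⟨hL1, -⟩, hL3⟩
      exact ⟨⟨hL1, hl _ _ _ _ h2 hC (hmn hL1 hL3).1 (hmn hL1 hL3).2⟩, hL3⟩
  rw [hD, hD']
  exact ⟨key l r hm.isRigid.1 hm.isRigid.2 fun b t => (hm.isColorable_iff b t).1,
    key r l hm.isRigid.2 hm.isRigid.1 fun b t => (hm.isColorable_iff b t).2⟩

/-- The later applications are to the set of reflections and to the stabilizer of a vector. -/
theorem LinkDiagram.Isotopic.exists_isColoring {D D' : LinkDiagram} (h : D.Isotopic D')
    (b t : ℕ → G) :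
    (∀ L, IsColoring b D.slices t L → ∃ L', IsColoring b D'.slices t L' ∧
      ∀ C, IsConjClosed C → (L ⊆ C ↔ L' ⊆ C)) ∧
    ∀ L, IsColoring b D'.slices t L → ∃ L', IsColoring b D.slices t L' ∧
      ∀ C, IsConjClosed C → (L ⊆ C ↔ L' ⊆ C) := by
  induction h with
  | rel D D' h => exact h.exists_isColoring b t
  | refl D =>
    exact ⟨fun L hL => ⟨L, hL, fun _ _ => Iff.rfl⟩, fun L hL => ⟨L, hL, fun _ _ => Iff.rfl⟩⟩
  | symm D D' _ ih => exact ih.symm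
  | trans D₁ D₂ D₃ _ _ ih₁ ih₂ =>
    constructor
    · intro L hL
      obtain ⟨L', hL', h1⟩ := ih₁.1 L hL
      obtain ⟨L'', hL'', h2⟩ := ih₂.1 L' hL'
      exact ⟨L'', hL'', fun C hC => (h1 C hC).trans (h2 C hC)⟩
    · intro L hL
      obtain ⟨L', hL', h1⟩ := ih₂.2 L hL
      obtain ⟨L'', hL'', h2⟩ := ih₁.2 L' hL'
      exact ⟨L'', hL'', fun C hC => (h1 C hC).trans (h2 C hC)⟩

/-- The number of local maxima in a list of slices. -/
def numMaxima (w : List Slice) : ℕ :=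
  w.countP fun s => match s.piece with
    | .cap => true
    | _ => false

/-- The labels of a colouring are generated by those at the top and one label for each local
maximum. -/
theorem IsColoring.exists_finset_subset_closure {b t : ℕ → G} {w : List Slice} {L : Set G}
    (h : IsColoring b w t L) : ∃ S : Finset G, S.card ≤ numMaxima w ∧ (S : Set G) ⊆ L ∧
      L ⊆ Subgroup.closure (Set.range t ∪ S) := by
  classical
  -- Going down from the top row, crossings and minima give nothing new, while a maximum adds one
  -- label and its inverse.
  induction w generalizing b L with
  | nil =>
    obtain ⟨rfl, rfl⟩ := h
    exact ⟨∅, by simp, by simp, Set.subset_union_left.trans Subgroup.subset_closure⟩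
  | cons s w ih =>
    obtain ⟨m, L', hs, hw, rfl⟩ := h
    obtain ⟨S, hcard, hS, hL⟩ := ih hw
    have hm : ∀ i, m i ∈ Subgroup.closure (Set.range t ∪ S) := fun i =>
      hL (hw.range_bot_subset ⟨i, rfl⟩)
    obtain ⟨s, p⟩ := s
    cases s with
    | cross β =>
      refine ⟨S, by simpa [numMaxima] using hcard, hS.trans Set.subset_union_right,
        Set.union_subset (Set.range_subset_iff.2 ?_) hL⟩
      rw [compat_cross_iff] at hs
      subst hs
      exact (Subgroup.isConjClosed _).of_crossMap_mem hm
    | cup =>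
      refine ⟨S, by simpa [numMaxima] using hcard, hS.trans Set.subset_union_right,
        Set.union_subset (Set.range_subset_iff.2 ?_) hL⟩
      obtain ⟨x, rfl⟩ := compat_cup_iff.1 hs
      intro i
      rw [← capMap_cupMap p x b]
      exact hm _
    | cap =>
      obtain ⟨h1, rfl⟩ := compat_cap_iff.1 hs
      refine ⟨insert (b p) S, ?_, ?_, ?_⟩
      · refine (Finset.card_insert_le _ _).trans ?_
        simpa [numMaxima] using hcard
      · rw [Finset.coe_insert, Set.insert_subset_iff]
        exact ⟨.inl ⟨p, rfl⟩, hS.trans Set.subset_union_right⟩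
      · have hle : Subgroup.closure (Set.range t ∪ S) ≤
            Subgroup.closure (Set.range t ∪ ↑(insert (b p) S)) := by
          rw [Finset.coe_insert]
          exact Subgroup.closure_mono (Set.union_subset_union_right _ (Set.subset_insert _ _))
        have hp : b p ∈ Subgroup.closure (Set.range t ∪ ↑(insert (b p) S)) :=
          Subgroup.subset_closure (.inr (by simp))
        refine Set.union_subset (Set.range_subset_iff.2 fun i => ?_) (hL.trans hle)
        rcases lt_trichotomy i p with h | rfl | h
        · rw [← capMap_of_lt p b h]
          exact hle (hm i)
        · exact hp
        · rcases eq_or_ne i (p + 1) with rfl | h'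
          · rw [eq_inv_of_mul_eq_one_left h1]
            exact Subgroup.inv_mem _ hp
          · obtain ⟨j, rfl⟩ := Nat.exists_eq_add_of_le' (show 2 ≤ i by omega)
            rw [← capMap_of_ge p b (by omega)]
            exact hle (hm j)

/-- A family of labels on all levels gives a colouring. -/
theorem isColoring_of_forall_compat {w : List Slice} (f : ℕ → ℕ → G)
    (h : ∀ (j : ℕ) (s : Slice), w[j]? = some s → s.Compat (f j) (f (j + 1))) :
    IsColoring (f 0) w (f w.length) {x | ∃ j ≤ w.length, ∃ i, f j i = x} := by
  induction w generalizing f with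
  | nil =>
    refine ⟨rfl, ?_⟩
    ext x
    simp
  | cons s w ih =>
    refine ⟨f 1, _, h 0 s rfl, ih (fun j => f (j + 1)) fun j s hs => h (j + 1) s hs, ?_⟩
    ext x
    constructor
    · rintro ⟨j, hj, i, rfl⟩
      cases j with
      | zero => exact .inl ⟨i, rfl⟩
      | succ j => exact .inr ⟨j, Nat.succ_le_succ_iff.1 hj, i, rfl⟩
    · rintro (⟨i, rfl⟩ | ⟨j, hj, i, rfl⟩)
      · exact ⟨0, Nat.zero_le _, i, rfl⟩
      · exact ⟨j + 1, Nat.succ_le_succ hj, i, rfl⟩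

end Colorings

/-! ## Homomorphisms of link groups and colourings -/

theorem Slice.exists_mem_relators_map {F F' : Type*} [Group F] [Group F'] (f : F →* F') (s : Slice)
    (b t : ℕ → F) {r : F'} (hr : r ∈ s.relators (fun i => f (b i)) fun i => f (t i)) :
    ∃ r' ∈ s.relators b t, f r' = r := by
  rcases hr with (hr | ⟨i, hi, rfl⟩) | ⟨i, rfl⟩
  · have : ∃ r' ∈ s.piece.relators (b s.pos) (b (s.pos + 1)) (t s.pos) (t (s.pos + 1)),
        f r' = r := by
      revert hr
      cases s.piece with
      | cup => rintro rfl; exact ⟨_, rfl, by simp⟩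
      | cap => rintro rfl; exact ⟨_, rfl, by simp⟩
      | cross β =>
        cases β <;> rintro (rfl | rfl)
        exacts [⟨_, .inl rfl, by simp⟩, ⟨_, .inr rfl, by simp⟩, ⟨_, .inl rfl, by simp⟩,
          ⟨_, .inr rfl, by simp⟩]
    obtain ⟨r', hr', h⟩ := this
    exact ⟨r', .inl (.inl hr'), h⟩
  · exact ⟨_, .inl (.inr ⟨i, hi, rfl⟩), by simp⟩
  · exact ⟨_, .inr ⟨i, rfl⟩, by simp⟩

theorem Slice.Compat.map {G G' : Type*} [Group G] [Group G'] (f : G →* G') {s : Slice}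
    {b t : ℕ → G} (h : s.Compat b t) : s.Compat (fun i => f (b i)) fun i => f (t i) := by
  intro r hr
  obtain ⟨r', hr', rfl⟩ := s.exists_mem_relators_map f b t hr
  rw [h r' hr', map_one]

theorem IsTangle.fits_of_getElem? {n m : ℕ} {w : List Slice} (h : IsTangle n w m) {j : ℕ}
    {s : Slice} (hs : w[j]? = some s) :
    s.Fits ((w.take j).foldl (fun n s => s.width n) n) := by
  induction w generalizing n j with
  | nil => simp at hs
  | cons s' w ih =>
    cases j with
    | zero =>
      obtain rfl : s' = s := by simpa using hs
      exact h.1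
    | succ j => exact ih h.2 (by simpa using hs)

theorem IsTangle.foldl_width {n m : ℕ} {w : List Slice} (h : IsTangle n w m) :
    w.foldl (fun n s => s.width n) n = m := by
  induction w generalizing n with
  | nil => exact h
  | cons s w ih => exact ih h.2

namespace LinkDiagram

variable (D : LinkDiagram)

@[simp]
theorem strandCount_zero : D.strandCount 0 = 0 := rfl

variable {D}

theorem fits {j : ℕ} {s : Slice} (hs : D.slices[j]? = some s) : s.Fits (D.strandCount j) :=
  D.closed.fits_of_getElem? hs

theorem strandCount_succ {j : ℕ} {s : Slice} (hs : D.slices[j]? = some s) :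
    D.strandCount (j + 1) = s.width (D.strandCount j) := by
  rw [strandCount, List.take_add_one, hs]
  simp [strandCount]

theorem strandCount_of_length_le {j : ℕ} (hj : D.slices.length ≤ j) : D.strandCount j = 0 := by
  rw [strandCount, List.take_of_length_le hj]
  exact D.closed.foldl_width

theorem exists_slice {j : ℕ} (hj : 0 < D.strandCount j) : ∃ s, D.slices[j]? = some s := by
  rcases lt_or_ge j D.slices.length with h | h
  · exact ⟨_, List.getElem?_eq_getElem h⟩
  · rw [strandCount_of_length_le h] at hj
    exact absurd hj (lt_irrefl 0)

theorem gen_eq_one {j i : ℕ} (h : D.strandCount j ≤ i) : D.gen j i = 1 :=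
  PresentedGroup.one_of_mem (.inl ⟨j, i, h, rfl⟩)

theorem compat_gen {j : ℕ} {s : Slice} (hs : D.slices[j]? = some s) :
    s.Compat (D.gen j) (D.gen (j + 1)) := by
  intro r hr
  obtain ⟨r', hr', rfl⟩ := s.exists_mem_relators_map (PresentedGroup.mk D.relators)
    (fun i => FreeGroup.of (j, i)) (fun i => FreeGroup.of (j + 1, i)) hr
  exact PresentedGroup.one_of_mem (.inr ⟨j, s, hs, hr'⟩)

theorem closure_gen : Subgroup.closure {x | ∃ j i, D.gen j i = x} = ⊤ := by
  rw [← PresentedGroup.closure_range_of]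
  congr 1
  ext x
  constructor
  · rintro ⟨j, i, rfl⟩
    exact ⟨(j, i), rfl⟩
  · rintro ⟨⟨j, i⟩, rfl⟩
    exact ⟨j, i, rfl⟩

/-- The values of a homomorphism on the Wirtinger generators form a colouring. -/
theorem isColoring_of_hom {G : Type*} [Group G] (φ : D.linkGroup →* G) :
    IsColoring (fun _ => 1) D.slices (fun _ => 1) {x | ∃ j i, φ (D.gen j i) = x} := by
  have h := isColoring_of_forall_compat (w := D.slices) (fun j i => φ (D.gen j i))
    fun j s hs => (compat_gen hs).map φ
  have h0 : (fun i => φ (D.gen 0 i)) = fun _ => 1 := by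
    funext i
    rw [gen_eq_one (by simp), map_one]
  have h1 : (fun i => φ (D.gen D.slices.length i)) = fun _ => 1 := by
    funext i
    rw [gen_eq_one (by rw [strandCount_of_length_le le_rfl]; exact i.zero_le), map_one]
  rw [h0, h1] at h
  convert h using 1
  ext x
  constructor
  · rintro ⟨j, i, rfl⟩
    rcases le_total j D.slices.length with hj | hj
    · exact ⟨j, hj, i, rfl⟩
    · refine ⟨0, Nat.zero_le _, i, ?_⟩
      rw [gen_eq_one (by simp), gen_eq_one (by rw [strandCount_of_length_le hj]; exact i.zero_le)]
  · rintro ⟨j, -, i, rfl⟩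
    exact ⟨j, i, rfl⟩

/-- A family of labels that satisfies all relations defines a homomorphism on the link group. -/
theorem exists_hom {G : Type*} [Group G] (f : ℕ → ℕ → G) (h0 : ∀ i, f 0 i = 1)
    (h1 : ∀ j, D.slices.length ≤ j → ∀ i, f j i = 1)
    (h : ∀ (j : ℕ) (s : Slice), D.slices[j]? = some s → s.Compat (f j) (f (j + 1))) :
    ∃ φ : D.linkGroup →* G, ∀ j i, φ (D.gen j i) = f j i := by
  -- The relators that kill the pairs which are not strands hold automatically: the bottom row is
  -- trivial, and to the right of a piece a row is a shift of the one below.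
  have hvanish : ∀ j i, D.strandCount j ≤ i → f j i = 1 := by
    intro j
    induction j with
    | zero => exact fun i _ => h0 i
    | succ j ih =>
      intro i hi
      rcases lt_or_ge j D.slices.length with hj | hj
      · have hs := List.getElem?_eq_getElem hj
        have hfit := fits hs
        rw [strandCount_succ hs] at hi
        have hc := (Slice.compat_iff.1 (h _ _ hs)).2.2
        generalize D.slices[j] = s at *
        simp only [Slice.Fits, Slice.width] at hfit hi
        obtain ⟨e, rfl⟩ := Nat.exists_eq_add_of_le (show s.pos + s.piece.outs ≤ i by omega)
        rw [hc]
        exact ih _ (by omega)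
      · exact h1 _ (hj.trans (Nat.le_succ j)) i
  have hrel : ∀ r ∈ D.relators, FreeGroup.lift (fun x : ℕ × ℕ => f x.1 x.2) r = 1 := by
    rintro r (⟨j, i, hi, rfl⟩ | ⟨j, s, hs, hr⟩)
    · simpa using hvanish j i hi
    · have key : ∀ r, (∀ x y : ℕ → FreeGroup (ℕ × ℕ), r ∈ s.relators x y →
          FreeGroup.lift (fun x : ℕ × ℕ => f x.1 x.2) r ∈ s.relators
            (fun i => FreeGroup.lift (fun x : ℕ × ℕ => f x.1 x.2) (x i))
            (fun i => FreeGroup.lift (fun x : ℕ × ℕ => f x.1 x.2) (y i))) := by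
        rintro r x y ((hr | ⟨i, hi, rfl⟩) | ⟨i, rfl⟩)
        · refine .inl (.inl ?_)
          revert hr
          cases s.piece with
          | cup => rintro rfl; exact map_mul _ _ _
          | cap => rintro rfl; exact map_mul _ _ _
          | cross β =>
            cases β <;> rintro (rfl | rfl)
            exacts [.inl (by simp), .inr (by simp), .inl (by simp), .inr (by simp)]
        · exact .inl (.inr ⟨i, hi, by simp⟩)
        · exact .inr ⟨i, by simp⟩
      have := key r _ _ hr
      simp only [FreeGroup.lift_apply_of] at this
      exact h j s hs _ this
  exact ⟨PresentedGroup.toGroup hrel, fun j i => PresentedGroup.toGroup.of hrel⟩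

/-! ## Meridional rank and bridge number -/

theorem gen_isMeridian_or (j i : ℕ) : D.gen j i = 1 ∨ D.IsMeridian (D.gen j i) := by
  rcases lt_or_ge i (D.strandCount j) with h | h
  · exact .inr ⟨j, i, h, .inl (IsConj.refl _)⟩
  · exact .inl (gen_eq_one h)

/-- The group of a link is generated by at most as many meridians as the diagram has maxima. -/
theorem exists_meridians (D : LinkDiagram) : ∃ S : Finset D.linkGroup, S.card ≤ D.maxima ∧
    (∀ g ∈ S, D.IsMeridian g) ∧ Subgroup.closure (S : Set D.linkGroup) = ⊤ := by
  classical
  obtain ⟨S, hcard, hS, hL⟩ :=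
    (isColoring_of_hom (MonoidHom.id D.linkGroup)).exists_finset_subset_closure
  -- Pairs beyond the strands contribute the label 1, which need not be a meridian.
  refine ⟨S.erase 1, (Finset.card_erase_le).trans hcard, fun g hg => ?_, ?_⟩
  · obtain ⟨hg1, hgS⟩ := Finset.mem_erase.1 hg
    obtain ⟨j, i, rfl⟩ := hS hgS
    exact (gen_isMeridian_or j i).resolve_left hg1
  · rw [eq_top_iff, ← closure_gen, Subgroup.closure_le]
    refine hL.trans ?_
    rw [SetLike.coe_subset_coe, Subgroup.closure_le]
    rintro x (⟨i, rfl⟩ | hx)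
    · exact Subgroup.one_mem _
    · rcases eq_or_ne x 1 with rfl | hne
      · exact Subgroup.one_mem _
      · exact Subgroup.subset_closure (Finset.mem_coe.2 (Finset.mem_erase.2 ⟨hne, hx⟩))

theorem meridionalRank_le_maxima (D : LinkDiagram) : D.meridionalRank ≤ D.maxima := by
  obtain ⟨S, hcard, hS⟩ := D.exists_meridians
  exact le_trans (Nat.sInf_le (show S.card ∈ _ from ⟨S, rfl, hS⟩)) hcard

theorem bridgeNumber_le_maxima (D : LinkDiagram) : D.bridgeNumber ≤ D.maxima :=
  Nat.sInf_le ⟨D, .refl D, rfl⟩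

end LinkDiagram

/-! ## Reflections -/

section Reflections

variable {V : Type*} [AddCommGroup V] [Module ℂ V]

/-- The invertible endomorphisms that differ from the identity by an endomorphism of rank at most
one. -/
def reflections (V : Type*) [AddCommGroup V] [Module ℂ V] : Set (V →ₗ[ℂ] V)ˣ :=
  {g | ∃ (φ : V →ₗ[ℂ] ℂ) (v : V), ∀ x, (g : V →ₗ[ℂ] V) x = x + φ x • v}

theorem conj_mem_reflections {g : (V →ₗ[ℂ] V)ˣ} (hg : g ∈ reflections V) (y : (V →ₗ[ℂ] V)ˣ) :
    y * g * y⁻¹ ∈ reflections V := by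
  obtain ⟨φ, v, h⟩ := hg
  refine ⟨φ.comp (y⁻¹ : (V →ₗ[ℂ] V)ˣ).val, y.val v, fun x => ?_⟩
  rw [Units.val_mul, Units.val_mul, Module.End.mul_apply, Module.End.mul_apply, h, map_add,
    map_smul, ← Module.End.mul_apply, ← Units.val_mul, mul_inv_cancel]
  rfl

theorem isConjClosed_reflections : IsConjClosed (reflections V) where
  inv_mem := by
    rintro g ⟨φ, v, h⟩
    refine ⟨-φ.comp (g⁻¹ : (V →ₗ[ℂ] V)ˣ).val, v, fun x => ?_⟩
    have h1 := h ((g⁻¹ : (V →ₗ[ℂ] V)ˣ).val x)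
    rw [← Module.End.mul_apply, ← Units.val_mul, mul_inv_cancel, Units.val_one,
      Module.End.one_apply] at h1
    simp only [LinearMap.neg_apply, LinearMap.comp_apply, neg_smul, ← sub_eq_add_neg]
    exact eq_sub_of_add_eq h1.symm
  conj_mem := fun hx _ => conj_mem_reflections hx _

/-- Fewer reflections than the dimension have a common fixed vector. -/
theorem exists_fixed_vector [FiniteDimensional ℂ V] (S : Finset (V →ₗ[ℂ] V)ˣ)
    (hS : (S : Set (V →ₗ[ℂ] V)ˣ) ⊆ reflections V) (hcard : S.card < Module.finrank ℂ V) :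
    ∃ x : V, x ≠ 0 ∧ ∀ g ∈ S, (g : V →ₗ[ℂ] V) x = x := by
  choose φ v h using fun g : S => hS g.2
  let F : V →ₗ[ℂ] (S → ℂ) := LinearMap.pi φ
  have : F.ker ≠ ⊥ := by
    apply LinearMap.ker_ne_bot_of_finrank_lt
    simpa using hcard
  obtain ⟨x, hx, hx0⟩ := Submodule.exists_mem_ne_zero_of_ne_bot this
  refine ⟨x, hx0, fun g hg => ?_⟩
  have h0 : φ ⟨g, hg⟩ x = 0 := congrFun (LinearMap.mem_ker.1 hx) ⟨g, hg⟩
  rw [h ⟨g, hg⟩, h0, zero_smul, add_zero]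

/-- The stabilizer of a vector. -/
def vectorStabilizer (x : V) : Subgroup (V →ₗ[ℂ] V)ˣ where
  carrier := {g | (g : V →ₗ[ℂ] V) x = x}
  one_mem' := rfl
  mul_mem' := fun {g h} hg hh => by
    change ((g * h : (V →ₗ[ℂ] V)ˣ) : V →ₗ[ℂ] V) x = x
    rw [Units.val_mul, Module.End.mul_apply, show h.val x = x from hh, show g.val x = x from hg]
  inv_mem' := fun {g} hg => by
    change ((g⁻¹ : (V →ₗ[ℂ] V)ˣ) : V →ₗ[ℂ] V) x = x
    conv_lhs => rw [← show g.val x = x from hg]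
    rw [← Module.End.mul_apply, ← Units.val_mul, inv_mul_cancel]
    rfl

/-- An irreducible representation of dimension at least two fixes no nonzero vector. -/
theorem Representation.IsIrreducible.eq_zero_of_fixed {Γ : Type*} [Group Γ]
    {ρ : Representation ℂ Γ V} (hρ : ρ.IsIrreducible) (hV : 1 < Module.finrank ℂ V) {x : V}
    (hx : ∀ g, ρ g x = x) : x = 0 := by
  by_contra hx0
  let W : Subrepresentation ρ :=
    ⟨Submodule.span ℂ {x}, fun g y hy => by
      obtain ⟨c, rfl⟩ := Submodule.mem_span_singleton.1 hy
      rw [map_smul, hx]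
      exact hy⟩
  have hxW : x ∈ W.toSubmodule := Submodule.mem_span_singleton_self x
  rcases hρ.eq_bot_or_eq_top W with h | h
  · rw [h] at hxW
    exact hx0 hxW
  · have h1 : W.toSubmodule = ⊤ := by rw [h]; rfl
    have h2 : Module.finrank ℂ (Submodule.span ℂ {x}) = Module.finrank ℂ V := by
      rw [show Submodule.span ℂ {x} = ⊤ from h1, finrank_top]
    rw [finrank_span_singleton hx0] at h2
    omega

end Reflections

namespace LinkDiagram

variable {V : Type*} [AddCommGroup V] [Module ℂ V] [FiniteDimensional ℂ V] {D : LinkDiagram}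

/-- The dimension of an irreducible representation by reflections is a lower bound for the
meridional rank. -/
theorem finrank_le_meridionalRank (ρ : Representation ℂ D.linkGroup V) (hρ : ρ.IsIrreducible)
    (hV : 1 < Module.finrank ℂ V) (h : ∀ j i, ρ.asGroupHom (D.gen j i) ∈ reflections V) :
    Module.finrank ℂ V ≤ D.meridionalRank := by
  classical
  obtain ⟨S₀, -, hS₀⟩ := D.exists_meridians
  refine le_csInf ⟨_, S₀, rfl, hS₀⟩ ?_
  rintro _ ⟨S, rfl, hS, hclosure⟩
  by_contra! hlt
  obtain ⟨x, hx0, hx⟩ := exists_fixed_vector (S.image ρ.asGroupHom) (by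
    intro g hg
    obtain ⟨s, hs, rfl⟩ := Finset.mem_image.1 (Finset.mem_coe.1 hg)
    obtain ⟨j, i, -, hc | hc⟩ := hS s hs
    all_goals
      obtain ⟨c, rfl⟩ := isConj_iff.1 hc
      simp only [map_mul, map_inv]
    · exact conj_mem_reflections (h j i) _
    · exact conj_mem_reflections (isConjClosed_reflections.inv_mem (h j i)) _)
    (Finset.card_image_le.trans_lt hlt)
  refine hx0 (hρ.eq_zero_of_fixed hV fun g => ?_)
  have hle : Subgroup.closure (S : Set D.linkGroup) ≤
      (vectorStabilizer x).comap ρ.asGroupHom := by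
    rw [Subgroup.closure_le]
    exact fun s hs => hx _ (Finset.mem_image_of_mem _ hs)
  rw [hclosure] at hle
  exact hle (Subgroup.mem_top g)

/-- The dimension of an irreducible representation by reflections is a lower bound for the bridge
number. -/
theorem finrank_le_bridgeNumber (ρ : Representation ℂ D.linkGroup V) (hρ : ρ.IsIrreducible)
    (hV : 1 < Module.finrank ℂ V) (h : ∀ j i, ρ.asGroupHom (D.gen j i) ∈ reflections V) :
    Module.finrank ℂ V ≤ D.bridgeNumber := by
  refine le_csInf ⟨_, D, .refl D, rfl⟩ ?_
  rintro _ ⟨D', hD, rfl⟩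
  by_contra! hlt
  -- The correspondence is used twice for the same pair of colourings: forwards with reflections, to
  -- find a vector fixed by the labels of D', and backwards with its stabilizer, to see that the
  -- labels of D fix it.
  obtain ⟨L', hL', hC⟩ := (hD.exists_isColoring _ _).1 _ (isColoring_of_hom ρ.asGroupHom)
  have hL'C : L' ⊆ reflections V := (hC _ isConjClosed_reflections).1 (by
    rintro _ ⟨j, i, rfl⟩
    exact h j i)
  obtain ⟨S, hcard, hS, hgen⟩ := hL'.exists_finset_subset_closure
  obtain ⟨x, hx0, hx⟩ := exists_fixed_vector S (hS.trans hL'C) (lt_of_le_of_lt hcard hlt)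
  refine hx0 (hρ.eq_zero_of_fixed hV fun g => ?_)
  have h1 : L' ⊆ vectorStabilizer x := by
    refine hgen.trans ?_
    rw [SetLike.coe_subset_coe, Subgroup.closure_le]
    rintro g (⟨i, rfl⟩ | hg)
    · exact Subgroup.one_mem _
    · exact hx g hg
  have h2 := (hC _ (Subgroup.isConjClosed (vectorStabilizer x))).2 h1
  have hle : Subgroup.closure {x | ∃ j i, D.gen j i = x} ≤
      (vectorStabilizer x).comap ρ.asGroupHom := by
    rw [Subgroup.closure_le]
    rintro _ ⟨j, i, rfl⟩
    exact h2 ⟨j, i, rfl⟩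
  rw [closure_gen] at hle
  exact hle (Subgroup.mem_top g)

end LinkDiagram

/-! ## Colourings with transported vectors -/

section Transport

variable {G X : Type*} [Group G] [MulAction G X]

/-- The condition on vectors at an elementary piece: they do not change along the strands, except
that under a crossing they are transported by the label of the over strand. -/
def Piece.Transports (b₀ b₁ t₀ t₁ : G × X) : Piece → Prop
  | cup => t₀.2 = t₁.2
  | cap => b₀.2 = b₁.2
  | cross true => t₁.2 = b₀.2 ∧ b₀.1 • t₀.2 = b₁.2
  | cross false => t₀.2 = b₁.2 ∧ b₁.1⁻¹ • t₁.2 = b₀.2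

/-- The condition on vectors at a slice. -/
structure Slice.Transports (s : Slice) (b t : ℕ → G × X) : Prop where
  piece : s.piece.Transports (b s.pos) (b (s.pos + 1)) (t s.pos) (t (s.pos + 1))
  left : ∀ i < s.pos, (t i).2 = (b i).2
  right : ∀ i, (t (s.pos + s.piece.outs + i)).2 = (b (s.pos + s.piece.ins + i)).2

theorem turn_left (p : ℕ) : 2 * p + 1 - p = p + 1 := by omega

theorem turn_right (p : ℕ) : 2 * p + 1 - (p + 1) = p := by omega

namespace LinkDiagram

variable {D : LinkDiagram} (φ : D.linkGroup →* G) (u : ℕ → ℕ → X)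

/-- The letter is nontrivial only when the traveller passes under a crossing, and there it is the
over label, or its inverse, by which `Piece.Transports` moves the vector. -/
theorem letter_smul_step_up {j : ℕ} {s : Slice} (hs : D.slices[j]? = some s)
    (h : s.Transports (fun i => (φ (D.gen j i), u j i)) fun i => (φ (D.gen (j + 1) i), u (j + 1) i))
    (i : ℕ) :
    φ (D.letter ⟨j, i, true⟩) • u (D.step ⟨j, i, true⟩).level (D.step ⟨j, i, true⟩).pos =
      u j i := by
  obtain ⟨s, p⟩ := s
  obtain ⟨h1, h2, h3⟩ := h
  simp only at h1 h2 h3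
  simp only [step, hs, if_true, Slice.travelUp]
  split_ifs with hi hi'
  · have hl : D.letter ⟨j, i, true⟩ = 1 := by
      cases s with
      | cross β => cases β <;> simp [letter, hs] <;> omega
      | _ => simp [letter, hs]
    rw [hl, map_one, one_smul, h2 i hi]
  · have hl : D.letter ⟨j, i, true⟩ = 1 := by
      cases s with
      | cross β =>
        simp only [Piece.ins] at hi'
        cases β <;> simp [letter, hs] <;> omega
      | _ => simp [letter, hs]
    obtain ⟨e, rfl⟩ := Nat.exists_eq_add_of_le hi'
    rw [hl, map_one, one_smul, ← h3 e,
      show p + s.outs + e = p + s.ins + e - s.ins + s.outs by omega]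
  · cases s with
    | cup =>
      simp only [Piece.ins] at hi'
      omega
    | cap =>
      simp only [Piece.Transports] at h1
      have : i = p ∨ i = p + 1 := by simp only [Piece.ins] at hi'; omega
      rcases this with rfl | rfl
      · simp [letter, hs, turn_left, h1]
      · simp [letter, hs, turn_right, h1]
    | cross β =>
      have : i = p ∨ i = p + 1 := by simp only [Piece.ins] at hi'; omega
      cases β <;> simp only [Piece.Transports] at h1 <;> rcases this with rfl | rfl
      · simp [letter, hs, turn_left, h1.2]
      · simp [letter, hs, turn_right, h1.1]
      · simp [letter, hs, turn_left, h1.1]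
      · simp [letter, hs, turn_right, h1.2]

theorem letter_smul_step_down {j : ℕ} {s : Slice} (hs : D.slices[j]? = some s)
    (h : s.Transports (fun i => (φ (D.gen j i), u j i)) fun i => (φ (D.gen (j + 1) i), u (j + 1) i))
    (i : ℕ) :
    φ (D.letter ⟨j + 1, i, false⟩) •
        u (D.step ⟨j + 1, i, false⟩).level (D.step ⟨j + 1, i, false⟩).pos = u (j + 1) i := by
  obtain ⟨s, p⟩ := s
  obtain ⟨h1, h2, h3⟩ := h
  simp only at h1 h2 h3
  have hlab := Slice.compat_iff.1 ((compat_gen hs).map φ)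
  have hins : s.flip.ins = s.outs := by cases s <;> rfl
  have houts : s.flip.outs = s.ins := by cases s <;> rfl
  simp only [step, hs, Bool.false_eq_true, if_false, Slice.travelDown, Slice.travelUp, hins, houts]
  split_ifs with hi hi'
  · have hl : D.letter ⟨j + 1, i, false⟩ = 1 := by
      cases s with
      | cross β => cases β <;> simp [letter, hs] <;> omega
      | _ => simp [letter, hs]
    rw [hl, map_one, one_smul, h2 i hi]
  · have hl : D.letter ⟨j + 1, i, false⟩ = 1 := by
      cases s with
      | cross β =>
        simp only [Piece.outs] at hi'
        cases β <;> simp [letter, hs] <;> omega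
      | _ => simp [letter, hs]
    obtain ⟨e, rfl⟩ := Nat.exists_eq_add_of_le hi'
    rw [hl, map_one, one_smul, h3 e,
      show p + s.ins + e = p + s.outs + e - s.outs + s.ins by omega]
  · cases s with
    | cap =>
      simp only [Piece.outs] at hi'
      omega
    | cup =>
      simp only [Piece.Transports] at h1
      have : i = p ∨ i = p + 1 := by simp only [Piece.outs] at hi'; omega
      rcases this with rfl | rfl
      · simp [letter, hs, Piece.flip, turn_left, h1]
      · simp [letter, hs, Piece.flip, turn_right, h1]
    | cross β =>
      have : i = p ∨ i = p + 1 := by simp only [Piece.outs] at hi'; omega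
      cases β <;> simp only [Piece.Transports] at h1 <;> rcases this with rfl | rfl
      · simp [letter, hs, Piece.flip, turn_left, h1.1]
      · simp [letter, hs, Piece.flip, turn_right, ← h1.2]
      · simp [letter, hs, Piece.flip, turn_left, ← h1.2]
      · simp [letter, hs, Piece.flip, turn_right, h1.1]

/-- The product of the first `n` letters transports vectors along the path. -/
theorem prod_letters_smul (a : Traveller) (n : ℕ)
    (h : ∀ k < n, φ (D.letter (D.step^[k] a)) •
      u (D.step^[k + 1] a).level (D.step^[k + 1] a).pos =
        u (D.step^[k] a).level (D.step^[k] a).pos) :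
    φ (((List.range n).map fun k => D.letter (D.step^[k] a)).prod) •
      u (D.step^[n] a).level (D.step^[n] a).pos = u a.level a.pos := by
  induction n with
  | zero => simp
  | succ n ih =>
    rw [List.range_succ, List.map_append, List.prod_append, map_mul, List.map_singleton,
      List.prod_singleton, mul_smul, h n (Nat.lt_succ_self n)]
    exact ih fun k hk => h k (hk.trans (Nat.lt_succ_self n))

/-- If vectors can be transported consistently along the whole diagram, then the blackboard framed
longitude fixes them. -/
theorem blackboardLongitude_smul
    (h : ∀ (j : ℕ) (s : Slice), D.slices[j]? = some s →
      s.Transports (fun i => (φ (D.gen j i), u j i)) fun i => (φ (D.gen (j + 1) i), u (j + 1) i))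
    (a : Traveller) : φ (D.blackboardLongitude a) • u a.level a.pos = u a.level a.pos := by
  have key : ∀ a : Traveller, φ (D.letter a) • u (D.step a).level (D.step a).pos =
      u a.level a.pos := by
    rintro ⟨j, i, up⟩
    cases up with
    | true =>
      rcases hs : D.slices[j]? with _ | s
      · simp [letter, step, hs]
      · exact letter_smul_step_up φ u hs (h j s hs) i
    | false =>
      cases j with
      | zero => simp [letter, step]
      | succ j =>
        rcases hs : D.slices[j]? with _ | s
        · simp [letter, step, hs]
        · exact letter_smul_step_down φ u hs (h j s hs) i
  have h1 := prod_letters_smul φ u a (Function.minimalPeriod D.step a) fun k _ => by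
    rw [Function.iterate_succ_apply']
    exact key _
  rwa [Function.iterate_minimalPeriod] at h1

/-- In an abelian quotient of the link group, the meridian does not change along the link. -/
theorem map_meridianAt_step {A : Type*} [CommGroup A] (φ : D.linkGroup →* A) (a : Traveller) :
    φ (D.meridianAt (D.step a)) = φ (D.meridianAt a) := by
  obtain ⟨j, i, up⟩ := a
  cases up with
  | true =>
    rcases hs : D.slices[j]? with _ | ⟨s, p⟩
    · simp [step, hs]
    obtain ⟨h1, h2, h3⟩ := Slice.compat_iff.1 ((compat_gen hs).map φ)
    simp only at h1 h2 h3
    by_cases hi : i < p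
    · simp [step, hs, Slice.travelUp, meridianAt, hi, h2 i hi]
    by_cases hi' : p + s.ins ≤ i
    · obtain ⟨e, rfl⟩ := Nat.exists_eq_add_of_le hi'
      simp [step, hs, Slice.travelUp, meridianAt, hi, ← h3 e,
        show p + s.ins + e - s.ins + s.outs = p + s.outs + e by omega]
    · cases s with
      | cup => simp only [Piece.ins] at hi'; omega
      | cap =>
        have : i = p ∨ i = p + 1 := by simp only [Piece.ins] at hi'; omega
        simp only [Piece.compat_cap] at h1
        rcases this with rfl | rfl
        · simp [step, hs, Slice.travelUp, meridianAt, Piece.ins,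
            turn_left, inv_eq_of_mul_eq_one_right h1]
        · simp [step, hs, Slice.travelUp, meridianAt, Piece.ins,
            turn_right, inv_eq_of_mul_eq_one_left h1]
      | cross β =>
        have : i = p ∨ i = p + 1 := by simp only [Piece.ins] at hi'; omega
        rcases this with rfl | rfl <;> cases β <;>
          simp only [Piece.compat_cross_true, Piece.compat_cross_false] at h1 <;>
          simp [step, hs, Slice.travelUp, meridianAt, Piece.ins,
            turn_left, turn_right, h1.1, h1.2]
  | false =>
    cases j with
    | zero => simp [step]
    | succ j =>
      rcases hs : D.slices[j]? with _ | ⟨s, p⟩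
      · simp [step, hs]
      obtain ⟨h1, h2, h3⟩ := Slice.compat_iff.1 ((compat_gen hs).map φ)
      have hins : s.flip.ins = s.outs := by cases s <;> rfl
      have houts : s.flip.outs = s.ins := by cases s <;> rfl
      simp only at h1 h2 h3
      by_cases hi : i < p
      · simp [step, hs, Slice.travelDown, Slice.travelUp, meridianAt, hi, h2 i hi]
      by_cases hi' : p + s.outs ≤ i
      · obtain ⟨e, rfl⟩ := Nat.exists_eq_add_of_le hi'
        simp [step, hs, Slice.travelDown, Slice.travelUp, meridianAt, hi, h3 e, hins, houts,
          show p + s.outs + e - s.outs + s.ins = p + s.ins + e by omega]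
      · cases s with
        | cap => simp only [Piece.outs] at hi'; omega
        | cup =>
          have : i = p ∨ i = p + 1 := by simp only [Piece.outs] at hi'; omega
          simp only [Piece.compat_cup] at h1
          rcases this with rfl | rfl
          · simp [step, hs, Slice.travelDown, Slice.travelUp, meridianAt, Piece.ins, Piece.flip,
              turn_left, inv_eq_of_mul_eq_one_left h1]
          · simp [step, hs, Slice.travelDown, Slice.travelUp, meridianAt, Piece.ins, Piece.flip,
              turn_right, inv_eq_of_mul_eq_one_right h1]
        | cross β =>
          have : i = p ∨ i = p + 1 := by simp only [Piece.outs] at hi'; omega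
          rcases this with rfl | rfl <;> cases β <;>
            simp only [Piece.compat_cross_true, Piece.compat_cross_false] at h1 <;>
            simp [step, hs, Slice.travelDown, Slice.travelUp, meridianAt, Piece.ins, Piece.flip,
              turn_left, turn_right, h1.1,
              h1.2]

end LinkDiagram

end Transport

/-! ## Periodicity of the traveller -/

theorem Slice.travelDown_of_travelUp {s : Slice} {i k : ℕ} (h : s.travelUp i = .inl k) :
    s.travelDown k = .inl i := by
  obtain ⟨s, p⟩ := s
  revert h
  cases s <;> simp only [travelDown, travelUp, Piece.flip, Piece.ins, Piece.outs] <;> grind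

theorem Slice.travelUp_of_travelDown {s : Slice} {i k : ℕ} (h : s.travelDown i = .inl k) :
    s.travelUp k = .inl i := by
  obtain ⟨s, p⟩ := s
  revert h
  cases s <;> simp only [travelDown, travelUp, Piece.flip, Piece.ins, Piece.outs] <;> grind

theorem Slice.travelUp_of_travelUp {s : Slice} {i k : ℕ} (h : s.travelUp i = .inr k) :
    s.travelUp k = .inr i := by
  obtain ⟨s, p⟩ := s
  revert h
  cases s <;> simp only [travelUp, Piece.ins, Piece.outs] <;> grind

theorem Slice.travelDown_of_travelDown {s : Slice} {i k : ℕ} (h : s.travelDown i = .inr k) :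
    s.travelDown k = .inr i := Slice.travelUp_of_travelUp h

/-- A traveller on a strand that moves up from below a slice or down from above it. -/
theorem Slice.travelUp_lt {s : Slice} {n i : ℕ} (hs : s.Fits n) (hi : i < n) :
    (∀ k, s.travelUp i = .inl k → k < s.width n) ∧ ∀ k, s.travelUp i = .inr k → k < n := by
  obtain ⟨s, p⟩ := s
  revert hs
  cases s <;> simp only [travelUp, Fits, width, Piece.ins, Piece.outs] <;> grind

theorem Slice.travelDown_lt {s : Slice} {n i : ℕ} (hs : s.Fits n) (hi : i < s.width n) :
    (∀ k, s.travelDown i = .inl k → k < n) ∧ ∀ k, s.travelDown i = .inr k → k < s.width n := by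
  obtain ⟨s, p⟩ := s
  revert hs hi
  cases s <;>
    simp only [travelDown, travelUp, Fits, width, Piece.ins, Piece.outs, Piece.flip] <;> grind

/-- The traveller turns around. -/
def Traveller.reverse (a : Traveller) : Traveller := ⟨a.level, a.pos, !a.up⟩

namespace LinkDiagram

variable (D : LinkDiagram)

/-- The travellers that are on a strand of the diagram. -/
def travellers : Set Traveller := {a | a.pos < D.strandCount a.level}

variable {D}

/-- The second part is reversibility of the walk; it makes `step` injective on the strands of the
diagram. -/
theorem step_mem_travellers {a : Traveller} (ha : a ∈ D.travellers) :
    D.step a ∈ D.travellers ∧ D.step (D.step a).reverse = a.reverse := by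
  obtain ⟨j, i, up⟩ := a
  have ha' : i < D.strandCount j := ha
  cases up with
  | true =>
    obtain ⟨s, hs⟩ := exists_slice (by omega : 0 < D.strandCount j)
    obtain ⟨h1, h2⟩ := Slice.travelUp_lt (fits hs) ha'
    rcases h : s.travelUp i with k | k
    · simp only [step, hs, if_true, h, Traveller.reverse, Bool.not_true, Bool.false_eq_true,
        if_false, s.travelDown_of_travelUp h, and_true]
      change k < D.strandCount (j + 1)
      rw [strandCount_succ hs]
      exact h1 k h
    · simp only [step, hs, if_true, h, Traveller.reverse, Bool.not_true, Bool.not_false,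
        s.travelUp_of_travelUp h, and_true]
      exact h2 k h
  | false =>
    cases j with
    | zero => simp at ha'
    | succ j =>
      have hlt : j < D.slices.length := by
        by_contra! hle
        rw [strandCount_of_length_le (hle.trans (Nat.le_succ j))] at ha'
        omega
      obtain ⟨s, hs⟩ : ∃ s, D.slices[j]? = some s := ⟨_, List.getElem?_eq_getElem hlt⟩
      rw [strandCount_succ hs] at ha'
      obtain ⟨h1, h2⟩ := Slice.travelDown_lt (fits hs) ha'
      rcases h : s.travelDown i with k | k
      · simp only [step, hs, if_true, h, Traveller.reverse, Bool.not_false, Bool.false_eq_true,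
          if_false, s.travelUp_of_travelDown h, and_true]
        exact h1 k h
      · simp only [step, hs, h, Traveller.reverse, Bool.not_true, Bool.not_false,
          Bool.false_eq_true, if_false, s.travelDown_of_travelDown h, and_true]
        change k < D.strandCount (j + 1)
        rw [strandCount_succ hs]
        exact h2 k h

theorem finite_travellers : D.travellers.Finite := by
  have h : (⋃ j ∈ Set.Iio D.slices.length, ⋃ i ∈ Set.Iio (D.strandCount j),
      Set.range fun up : Bool => Traveller.mk j i up).Finite :=
    (Set.finite_Iio _).biUnion fun j _ => (Set.finite_Iio _).biUnion fun i _ => Set.finite_range _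
  refine h.subset ?_
  rintro ⟨j, i, up⟩ ha
  have ha' : i < D.strandCount j := ha
  have hj : j < D.slices.length := by
    by_contra! hle
    rw [strandCount_of_length_le hle] at ha'
    omega
  exact Set.mem_biUnion hj (Set.mem_biUnion ha' ⟨up, rfl⟩)

/-- An injective self-map of a finite set is periodic. Hence the minimal period is positive, and the
blackboard longitude really is a product over a full turn. -/
theorem mem_periodicPts_step {a : Traveller} (ha : a ∈ D.travellers) :
    a ∈ Function.periodicPts D.step := by
  have hmaps : Set.MapsTo D.step D.travellers D.travellers := fun a ha =>
    (step_mem_travellers ha).1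
  have hinj : Set.InjOn D.step D.travellers := by
    intro x hx y hy hxy
    have h : x.reverse = y.reverse := by
      rw [← (step_mem_travellers hx).2, ← (step_mem_travellers hy).2, hxy]
    obtain ⟨xl, xp, xu⟩ := x
    obtain ⟨yl, yp, yu⟩ := y
    simpa [Traveller.reverse] using h
  have : Finite D.travellers := finite_travellers
  have hper := Function.Injective.mem_periodicPts (hmaps.restrict_inj.2 hinj) ⟨a, ha⟩
  obtain ⟨n, hn, h⟩ := hper
  refine ⟨n, hn, ?_⟩
  have h' := congrArg Subtype.val (show _ = _ from h)
  rwa [hmaps.iterate_restrict] at h'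

end LinkDiagram

/-! ### Rows with prescribed entries -/

section Rows

variable {α : Type*} {p : ℕ} {r : ℕ → α} {d : α}

/-- The row of values with `x` and `y` on the strands `p` and `p + 1`. -/
def columnRow (p : ℕ) (r : ℕ → α) (x y : α) : ℕ → α := fun i =>
  if i = p then x else if i = p + 1 then y else r i

theorem columnRow_left {x y : α} : columnRow p r x y p = x := by simp [columnRow]

theorem columnRow_right {x y : α} : columnRow p r x y (p + 1) = y := by simp [columnRow]

theorem columnRow_of_lt {x y : α} {i : ℕ} (h : i < p) : columnRow p r x y i = r i := by
  have h1 : i ≠ p := by omega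
  have h2 : i ≠ p + 1 := by omega
  simp [columnRow, h1, h2]

theorem columnRow_of_ge {x y : α} {i : ℕ} : columnRow p r x y (p + 2 + i) = r (p + 2 + i) := by
  have h1 : p + 2 + i ≠ p := by omega
  have h2 : p + 2 + i ≠ p + 1 := by omega
  simp [columnRow, h1, h2]

/-- The row with the given values on the first strands and `d` elsewhere. -/
def listRow (d : α) (l : List α) : ℕ → α := fun i => l.getD i d

theorem listRow_append_of_lt (l : List α) (r : List (α)) {i : ℕ}
    (hi : i < l.length) : listRow d (l ++ r) i = listRow d l i :=
  List.getD_append _ _ _ _ hi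

theorem listRow_append_add (l : List α) (r : List (α)) (i : ℕ) :
    listRow d (l ++ r) (l.length + i) = listRow d r i := by
  rw [listRow, List.getD_append_right _ _ _ _ (Nat.le_add_right _ _), Nat.add_sub_cancel_left]
  rfl

end Rows

/-! ### Colourings with vectors on pretzel diagrams -/

section TransportColorings

variable {G X : Type*} [Group G] [MulAction G X]

/-- `w` has a colouring by group elements together with transported vectors, with the given values
at the bottom and at the top. -/
def IsTransportColorable : (ℕ → G × X) → List Slice → (ℕ → G × X) → Prop
  | b, [], t => b = t
  | b, s :: w, t => ∃ m : ℕ → G × X, s.Compat (fun i => (b i).1) (fun i => (m i).1) ∧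
      s.Transports b m ∧ IsTransportColorable m w t

theorem IsTransportColorable.append {b m t : ℕ → G × X} {u v : List Slice}
    (h : IsTransportColorable b u m) (h' : IsTransportColorable m v t) :
    IsTransportColorable b (u ++ v) t := by
  induction u generalizing b with
  | nil => exact h ▸ h'
  | cons s u ih =>
    obtain ⟨n, h1, h2, h3⟩ := h
    exact ⟨n, h1, h2, ih h3⟩

theorem IsTransportColorable.exists_family {b t : ℕ → G × X} {w : List Slice}
    (h : IsTransportColorable b w t) : ∃ f : ℕ → ℕ → G × X, f 0 = b ∧
      (∀ j, w.length ≤ j → f j = t) ∧ ∀ (j : ℕ) (s : Slice), w[j]? = some s →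
        s.Compat (fun i => (f j i).1) (fun i => (f (j + 1) i).1) ∧
          s.Transports (f j) (f (j + 1)) := by
  induction w generalizing b with
  | nil => exact ⟨fun _ => b, rfl, fun j _ => h, by simp⟩
  | cons s w ih =>
    obtain ⟨m, h1, h2, h3⟩ := h
    obtain ⟨f, hf0, hft, hf⟩ := ih h3
    refine ⟨fun j => Nat.casesOn j b f, rfl, fun j hj => ?_, fun j s' hs => ?_⟩
    · cases j with
      | zero => simp at hj
      | succ j => exact hft j (by simpa using hj)
    · cases j with
      | zero =>
        obtain rfl : s = s' := by simpa using hs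
        change s.Compat _ (fun i => (f 0 i).1) ∧ s.Transports b (f 0)
        rw [hf0]
        exact ⟨h1, h2⟩
      | succ j => exact hf j s' (by simpa using hs)

/-! ### A single column of half twists -/

section Column

variable {p : ℕ} {r : ℕ → G × X}

theorem crossing_columnRow {β : Bool} {b₀ b₁ t₀ t₁ : G × X}
    (hc : (Piece.cross β).Compat b₀.1 b₁.1 t₀.1 t₁.1)
    (ht : (Piece.cross β).Transports b₀ b₁ t₀ t₁) :
    Slice.Compat ⟨.cross β, p⟩ (fun i => (columnRow p r b₀ b₁ i).1)
        (fun i => (columnRow p r t₀ t₁ i).1) ∧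
      Slice.Transports ⟨.cross β, p⟩ (columnRow p r b₀ b₁) (columnRow p r t₀ t₁) := by
  refine ⟨Slice.compat_iff.2 ⟨?_, fun i hi => ?_, fun i => ?_⟩, ⟨?_, fun i hi => ?_, fun i => ?_⟩⟩
  · simpa only [columnRow_left, columnRow_right] using hc
  · simp only [columnRow_of_lt hi]
  · simp only [Piece.ins, Piece.outs, columnRow_of_ge]
  · simpa only [columnRow_left, columnRow_right] using ht
  · simp only [columnRow_of_lt hi]
  · simp only [Piece.ins, Piece.outs, columnRow_of_ge]

variable {S : ℤ → G × X} (hlab : ∀ i, (S i).1 * (S (i + 1)).1 = (S (i + 1)).1 * (S (i + 2)).1)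
  (hvec : ∀ i, (S (i + 1)).1 • (S (i + 2)).2 = (S i).2)

include hlab hvec

/-- S lists the successive arcs of the column, a row showing S (i + 1) and S i. A positive half
twist replaces i by i + 1, and a negative one, in the next lemma, replaces it by i - 1; the
hypotheses are the conditions at one crossing. -/
theorem isTransportColorable_replicate_true (n : ℕ) (i : ℤ) :
    IsTransportColorable (columnRow p r (S (i + 1)) (S i)) (List.replicate n ⟨.cross true, p⟩)
      (columnRow p r (S (i + n + 1)) (S (i + n))) := by
  induction n generalizing i with
  | zero => simp [IsTransportColorable]
  | succ n ih =>
    obtain ⟨h1, h2⟩ := crossing_columnRow (p := p) (r := r) (β := true) (b₀ := S (i + 1))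
      (b₁ := S i) (t₀ := S (i + 2)) (t₁ := S (i + 1))
      (by rw [Piece.compat_cross_true, mul_assoc, hlab, inv_mul_cancel_left]; exact ⟨rfl, rfl⟩)
      ⟨rfl, hvec i⟩
    refine ⟨_, h1, h2, ?_⟩
    have := ih (i + 1)
    rw [show i + 1 + 1 = i + 2 by ring] at this
    convert this using 3 <;> push_cast <;> ring

theorem isTransportColorable_replicate_false (n : ℕ) (i : ℤ) :
    IsTransportColorable (columnRow p r (S (i + 1)) (S i)) (List.replicate n ⟨.cross false, p⟩)
      (columnRow p r (S (i - n + 1)) (S (i - n))) := by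
  induction n generalizing i with
  | zero => simp [IsTransportColorable]
  | succ n ih =>
    have hl := hlab (i - 1)
    have hv := hvec (i - 1)
    rw [show i - 1 + 1 = i by ring, show i - 1 + 2 = i + 1 by ring] at hl hv
    obtain ⟨h1, h2⟩ := crossing_columnRow (p := p) (r := r) (β := false) (b₀ := S (i + 1))
      (b₁ := S i) (t₀ := S i) (t₁ := S (i - 1))
      (by rw [Piece.compat_cross_false, ← hl, mul_inv_cancel_right]; exact ⟨rfl, rfl⟩)
      ⟨rfl, by rw [← hv, inv_smul_smul]⟩
    refine ⟨_, h1, h2, ?_⟩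
    have := ih (i - 1)
    rw [show i - 1 + 1 = i by ring] at this
    convert this using 3 <;> push_cast <;> ring

theorem isTransportColorable_twists (c : ℤ) :
    IsTransportColorable (columnRow p r (S 1) (S 0)) (twists p c)
      (columnRow p r (S (c + 1)) (S c)) := by
  unfold twists
  rcases le_or_gt 0 c with h | h
  · have := isTransportColorable_replicate_true (p := p) (r := r) hlab hvec c.natAbs 0
    rw [decide_eq_true h]
    rwa [zero_add, zero_add, Int.natAbs_of_nonneg h] at this
  · have := isTransportColorable_replicate_false (p := p) (r := r) hlab hvec c.natAbs 0
    rw [decide_eq_false h.not_ge]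
    rwa [zero_add, zero_sub, Int.ofNat_natAbs_of_nonpos h.le, neg_neg] at this

end Column

/-- The labels and vectors on the successive arcs of a column of half twists: `x` consists of those
with even, and `y` of those with odd index. -/
structure IsTwistSequence (x y : ℤ → G × X) : Prop where
  label_even : ∀ j, (x j).1 * (y j).1 = (y j).1 * (x (j + 1)).1
  label_odd : ∀ j, (y j).1 * (x (j + 1)).1 = (x (j + 1)).1 * (y (j + 1)).1
  vector_even : ∀ j, (y j).1 • (x (j + 1)).2 = (x j).2
  vector_odd : ∀ j, (x (j + 1)).1 • (y (j + 1)).2 = (y j).2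

namespace IsTwistSequence

variable {x y : ℤ → G × X} (h : IsTwistSequence x y) (p : ℕ) (r : ℕ → G × X)

include h

theorem isTransportColorable (k : ℤ) :
    IsTransportColorable (columnRow p r (y 0) (x 0)) (twists p (2 * k))
        (columnRow p r (y k) (x k)) ∧
      IsTransportColorable (columnRow p r (y 0) (x 0)) (twists p (2 * k + 1))
        (columnRow p r (x (k + 1)) (y k)) := by
  -- The two alternating sequences are interleaved; each full turn advances the index by 2.
  let S : ℤ → G × X := fun i => if i % 2 = 0 then x (i / 2) else y (i / 2)
  have h0 : ∀ j, S (2 * j) = x j := fun j => by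
    simp [S]
  have h1 : ∀ j, S (2 * j + 1) = y j := fun j => by
    have e1 : (2 * j + 1) % 2 = 1 := by omega
    have e2 : (2 * j + 1) / 2 = j := by omega
    simp only [S, e1, e2, one_ne_zero, if_false]
  have h2 : ∀ j, S (2 * j + 2) = x (j + 1) := fun j => by
    rw [← h0 (j + 1)]; congr 1; ring
  have h3 : ∀ j, S (2 * j + 1 + 2) = y (j + 1) := fun j => by
    rw [← h1 (j + 1)]; congr 1; ring
  have h4 : ∀ j, S (2 * j + 1 + 1) = x (j + 1) := fun j => by
    rw [← h0 (j + 1)]; congr 1; ring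
  have hlab : ∀ i, (S i).1 * (S (i + 1)).1 = (S (i + 1)).1 * (S (i + 2)).1 := by
    intro i
    obtain ⟨j, rfl | rfl⟩ := Int.even_or_odd' i
    · rw [h0, h1, h2, h.label_even]
    · rw [h1, h4, h3, h.label_odd]
  have hvec : ∀ i, (S (i + 1)).1 • (S (i + 2)).2 = (S i).2 := by
    intro i
    obtain ⟨j, rfl | rfl⟩ := Int.even_or_odd' i
    · rw [h0, h1, h2, h.vector_even]
    · rw [h1, h4, h3, h.vector_odd]
  have e0 : S 0 = x 0 := h0 0
  have e1 : S 1 = y 0 := h1 0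
  have := isTransportColorable_twists (p := p) (r := r) hlab hvec
  rw [e0, e1] at this
  have t1 := this (2 * k)
  have t2 := this (2 * k + 1)
  rw [h0, h1] at t1
  rw [h1, h4] at t2
  exact ⟨t1, t2⟩

end IsTwistSequence

theorem cup_listRow {d x y : G × X} (l r : List (G × X)) (h : y.1 * x.1 = 1) (h' : x.2 = y.2) :
    Slice.Compat ⟨.cup, l.length⟩ (fun i => (listRow d (l ++ r) i).1)
        (fun i => (listRow d (l ++ x :: y :: r) i).1) ∧
      Slice.Transports ⟨.cup, l.length⟩ (listRow d (l ++ r)) (listRow d (l ++ x :: y :: r)) := by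
  have hx : listRow d (l ++ x :: y :: r) l.length = x := listRow_append_add l (x :: y :: r) 0
  have hy : listRow d (l ++ x :: y :: r) (l.length + 1) = y := listRow_append_add l (x :: y :: r) 1
  have hl : ∀ i < l.length, listRow d (l ++ x :: y :: r) i = listRow d (l ++ r) i := fun i hi => by
    rw [listRow_append_of_lt _ _ hi, listRow_append_of_lt _ _ hi]
  have hr : ∀ i, listRow d (l ++ x :: y :: r) (l.length + 2 + i) =
      listRow d (l ++ r) (l.length + 0 + i) := fun i => by
    rw [add_assoc, add_zero, listRow_append_add, listRow_append_add, add_comm 2 i]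
    rfl
  refine ⟨Slice.compat_iff.2 ⟨Piece.compat_cup.2 ?_, fun i hi => congrArg Prod.fst (hl i hi),
    fun i => congrArg Prod.fst (hr i)⟩, ?_, fun i hi => congrArg Prod.snd (hl i hi),
    fun i => congrArg Prod.snd (hr i)⟩
  · simpa only [hx, hy] using h
  · simpa only [hx, hy, Piece.Transports] using h'

/-- The conditions at a maximum are those at a minimum read upside down. -/
theorem cap_listRow {d x y : G × X} (l r : List (G × X)) (h : y.1 * x.1 = 1) (h' : x.2 = y.2) :
    Slice.Compat ⟨.cap, l.length⟩ (fun i => (listRow d (l ++ x :: y :: r) i).1)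
        (fun i => (listRow d (l ++ r) i).1) ∧
      Slice.Transports ⟨.cap, l.length⟩ (listRow d (l ++ x :: y :: r)) (listRow d (l ++ r)) := by
  obtain ⟨hc, ht⟩ := cup_listRow (d := d) l r h h'
  obtain ⟨c1, c2, c3⟩ := Slice.compat_iff.1 hc
  obtain ⟨t1, t2, t3⟩ := ht
  exact ⟨Slice.compat_iff.2 ⟨Piece.compat_cap.2 (Piece.compat_cup.1 c1), fun i hi => (c2 i hi).symm,
    fun i => (c3 i).symm⟩, t1, fun i hi => (t2 i hi).symm, fun i => (t3 i).symm⟩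

/-- Three columns of labels and vectors that fit together at the arcs define a homomorphism on the
group of the pretzel knot, with vectors that are transported along the diagram. -/
theorem exists_hom_pretzel {d : G × X} {x₁ y₁ x₂ y₂ x₃ y₃ : ℤ → G × X} {k : ℤ} (hd : d.1 = 1)
    (h₁ : IsTwistSequence x₁ y₁) (h₂ : IsTwistSequence x₂ y₂) (h₃ : IsTwistSequence x₃ y₃)
    (ha : (x₃ 0).1 * (y₁ 0).1 = 1)
    (hb : (y₂ 0).1 * (x₁ 0).1 = 1) (hb' : (x₁ 0).2 = (y₂ 0).2)
    (hc : (y₃ 0).1 * (x₂ 0).1 = 1) (hc' : (x₂ 0).2 = (y₃ 0).2)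
    (ht : (x₂ 2).1 * (x₁ (-1)).1 = 1) (ht' : (x₁ (-1)).2 = (x₂ 2).2)
    (hu : (x₃ (k + 1)).1 * (y₂ 1).1 = 1) (hu' : (y₂ 1).2 = (x₃ (k + 1)).2)
    (hv : (y₃ k).1 * (y₁ (-1)).1 = 1) (hv' : (y₁ (-1)).2 = (y₃ k).2) :
    ∃ (φ : (pretzel (-2) 3 (2 * k + 1)).linkGroup →* G) (u : ℕ → ℕ → X),
      (φ ((pretzel (-2) 3 (2 * k + 1)).gen 1 0) = (y₁ 0).1 ∧
        φ ((pretzel (-2) 3 (2 * k + 1)).gen 2 1) = (x₁ 0).1 ∧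
        φ ((pretzel (-2) 3 (2 * k + 1)).gen 3 3) = (x₂ 0).1) ∧
      (u 1 0 = (y₁ 0).2 ∧ u 1 1 = (x₃ 0).2) ∧
      ∀ (j : ℕ) (s : Slice), (pretzel (-2) 3 (2 * k + 1)).slices[j]? = some s →
        (j = 0 → (y₁ 0).2 = (x₃ 0).2) →
        s.Transports (fun i => (φ ((pretzel (-2) 3 (2 * k + 1)).gen j i), u j i))
          fun i => (φ ((pretzel (-2) 3 (2 * k + 1)).gen (j + 1) i), u (j + 1) i) := by
  set D := pretzel (-2) 3 (2 * k + 1) with hD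
  have hcol : IsTransportColorable (listRow d [y₁ 0, x₁ 0, y₂ 0, x₂ 0, y₃ 0, x₃ 0])
      (D.slices.drop 3) fun _ => d := by
    -- The numbers of half twists are -2 = 2(-1), 3 = 2 · 1 + 1 and 2k+1. The odd columns end with
    -- the even-indexed arc on the left, so that the top row is y₁(-1), x₁(-1), x₂ 2, y₂ 1, x₃(k+1),
    -- y₃ k.
    have t₁ := (h₁.isTransportColorable 0
      (listRow d [y₁ 0, x₁ 0, y₂ 0, x₂ 0, y₃ 0, x₃ 0]) (-1)).1
    have t₂ := (h₂.isTransportColorable 2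
      (listRow d [y₁ (-1), x₁ (-1), y₂ 0, x₂ 0, y₃ 0, x₃ 0]) 1).2
    have t₃ := (h₃.isTransportColorable 4
      (listRow d [y₁ (-1), x₁ (-1), x₂ 2, y₂ 1, y₃ 0, x₃ 0]) k).2
    change IsTransportColorable _ (twists 0 (-2) ++ (twists 2 3 ++ (twists 4 (2 * k + 1) ++
      [⟨.cap, 1⟩, ⟨.cap, 1⟩, ⟨.cap, 0⟩]))) _
    have r₁ : ∀ a b a' b' x₂ x₃ x₄ x₅ : G × X,
        columnRow 0 (listRow d [a, b, x₂, x₃, x₄, x₅]) a' b' =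
        listRow d [a', b', x₂, x₃, x₄, x₅] := by
      intros
      funext i
      rcases i with _ | _ | _ | _ | _ | _ | i <;> rfl
    have r₂ : ∀ a b a' b' x₀ x₁ x₄ x₅ : G × X,
        columnRow 2 (listRow d [x₀, x₁, a, b, x₄, x₅]) a' b' =
        listRow d [x₀, x₁, a', b', x₄, x₅] := by
      intros
      funext i
      rcases i with _ | _ | _ | _ | _ | _ | i <;> rfl
    have r₃ : ∀ a b a' b' x₀ x₁ x₂ x₃ : G × X,
        columnRow 4 (listRow d [x₀, x₁, x₂, x₃, a, b]) a' b' =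
        listRow d [x₀, x₁, x₂, x₃, a', b'] := by
      intros
      funext i
      rcases i with _ | _ | _ | _ | _ | _ | i <;> rfl
    rw [r₁, r₁] at t₁
    rw [r₂, r₂] at t₂
    rw [r₃, r₃] at t₃
    refine t₁.append (t₂.append (t₃.append ?_))
    obtain ⟨c1, c2⟩ := cap_listRow (d := d) [y₁ (-1)] [y₂ 1, x₃ (k + 1), y₃ k] ht ht'
    obtain ⟨c3, c4⟩ := cap_listRow (d := d) [y₁ (-1)] [y₃ k] hu hu'
    obtain ⟨c5, c6⟩ := cap_listRow (d := d) [] [] hv hv'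
    exact ⟨_, c1, c2, _, c3, c4, _, c5, c6, rfl⟩
  obtain ⟨f, hf0, hft, hf⟩ := hcol.exists_family
  let g : ℕ → ℕ → G × X
    | 0 => fun _ => d
    | 1 => listRow d [y₁ 0, x₃ 0]
    | 2 => listRow d [y₁ 0, x₁ 0, y₂ 0, x₃ 0]
    | j + 3 => f j
  have e₃ : g 3 = listRow d [y₁ 0, x₁ 0, y₂ 0, x₂ 0, y₃ 0, x₃ 0] := hf0
  -- Equality of the vectors at the outer minimum, slice 0, is kept as an antecedent: the framing
  -- computation uses vectors that jump exactly there.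
  have hg : ∀ (j : ℕ) (s : Slice), D.slices[j]? = some s →
      s.Compat (fun i => (g j i).1) (fun i => (g (j + 1) i).1) ∧
        ((j = 0 → (y₁ 0).2 = (x₃ 0).2) → s.Transports (g j) (g (j + 1))) := by
    intro j s hs
    match j, hs with
    | 0, hs =>
      obtain rfl : (⟨.cup, 0⟩ : Slice) = s := Option.some.inj hs
      refine ⟨Slice.compat_iff.2 ⟨Piece.compat_cup.2 ha, fun i hi => absurd hi (Nat.not_lt_zero i),
        fun i => ?_⟩, fun h => ⟨h rfl, fun i hi => absurd hi (Nat.not_lt_zero i), fun i => ?_⟩⟩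
      · exact congrArg Prod.fst (listRow_append_add (d := d) [y₁ 0, x₃ 0] [] i)
      · exact congrArg Prod.snd (listRow_append_add (d := d) [y₁ 0, x₃ 0] [] i)
    | 1, hs =>
      obtain rfl : (⟨.cup, 1⟩ : Slice) = s := Option.some.inj hs
      obtain ⟨c1, c2⟩ := cup_listRow (d := d) [y₁ 0] [x₃ 0] hb hb'
      exact ⟨c1, fun _ => c2⟩
    | 2, hs =>
      obtain rfl : (⟨.cup, 3⟩ : Slice) = s := Option.some.inj hs
      obtain ⟨c1, c2⟩ := cup_listRow (d := d) [y₁ 0, x₁ 0, y₂ 0] [x₃ 0] hc hc'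
      rw [e₃]
      exact ⟨c1, fun _ => c2⟩
    | j + 3, hs =>
      obtain ⟨c1, c2⟩ := hf j s (by rwa [List.getElem?_drop, add_comm])
      exact ⟨c1, fun _ => c2⟩
  obtain ⟨φ, hφ⟩ := D.exists_hom (fun j i => (g j i).1) (fun _ => hd) (fun j hj i => by
    obtain ⟨j, rfl⟩ : ∃ j', j = j' + 3 := Nat.exists_eq_add_of_le' (le_trans (by
      simp [hD, pretzel]) hj)
    change (f j i).1 = 1
    rw [hft j (by rw [List.length_drop]; omega), hd]) fun j s hs => (hg j s hs).1
  refine ⟨φ, fun j i => (g j i).2, ⟨hφ 1 0, hφ 2 1, ?_⟩, ⟨rfl, rfl⟩, fun j s hs h => ?_⟩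
  · rw [hφ, e₃]
    rfl
  · simp only [hφ]
    exact (hg j s hs).2 h

end TransportColorings

/-! ### Labels determined by those at the minima -/

namespace LinkDiagram

variable {D : LinkDiagram} {G : Type*} [Group G]

/-- The labels of a colouring belong to every set that is closed under conjugation and inversion and
contains the labels at the minima. -/
theorem map_gen_mem (φ : D.linkGroup →* G) {C : Set G} (hC : IsConjClosed C) (h1 : 1 ∈ C)
    (h : ∀ j p, D.slices[j]? = some ⟨.cup, p⟩ → φ (D.gen (j + 1) p) ∈ C) (j i : ℕ) :
    φ (D.gen j i) ∈ C := by
  induction j generalizing i with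
  | zero =>
    rw [gen_eq_one (by simp), map_one]
    exact h1
  | succ j ih =>
    rcases hs : D.slices[j]? with _ | ⟨s, p⟩
    · rw [gen_eq_one, map_one]
      · exact h1
      · rw [strandCount_of_length_le (by simp at hs; omega)]
        exact i.zero_le
    have hc := (compat_gen hs).map φ
    cases s with
    | cup =>
      obtain ⟨x, hx⟩ := compat_cup_iff.1 hc
      have hp := h j p hs
      rw [show φ (D.gen (j + 1) p) = x⁻¹ by rw [congrFun hx p, cupMap_left]] at hp
      have hx' : x ∈ C := by simpa using hC.inv_mem hp
      rw [show φ (D.gen (j + 1) i) = _ from congrFun hx i]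
      unfold cupMap
      split_ifs
      exacts [ih _, hp, hx', ih _]
    | cap =>
      rw [show φ (D.gen (j + 1) i) = _ from congrFun (compat_cap_iff.1 hc).2 i]
      exact ih _
    | cross β =>
      rw [show φ (D.gen (j + 1) i) = _ from congrFun (compat_cross_iff.1 hc) i]
      exact hC.crossMap_mem ih β p i

theorem map_gen_mem_pretzel {a b c : ℤ} (φ : (pretzel a b c).linkGroup →* G) {C : Set G}
    (hC : IsConjClosed C) (h1 : 1 ∈ C) (ha : φ ((pretzel a b c).gen 1 0) ∈ C)
    (hb : φ ((pretzel a b c).gen 2 1) ∈ C) (hc : φ ((pretzel a b c).gen 3 3) ∈ C) (j i : ℕ) :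
    φ ((pretzel a b c).gen j i) ∈ C := by
  refine map_gen_mem φ hC h1 (fun j p hs => ?_) j i
  match j, hs with
  | 0, hs =>
    obtain rfl : 0 = p := congrArg Slice.pos (Option.some.inj hs)
    exact ha
  | 1, hs =>
    obtain rfl : 1 = p := congrArg Slice.pos (Option.some.inj hs)
    exact hb
  | 2, hs =>
    obtain rfl : 3 = p := congrArg Slice.pos (Option.some.inj hs)
    exact hc
  | j + 3, hs =>
    exfalso
    have h : (twists 0 a ++ (twists 2 b ++ (twists 4 c ++
        [⟨.cap, 1⟩, ⟨.cap, 1⟩, ⟨.cap, 0⟩])))[j]? = some ⟨.cup, p⟩ := hs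
    have := List.mem_of_getElem? h
    simp [twists] at this

end LinkDiagram

/-! ### Twist sequences from two group elements, a recurrence and a root of unity -/

section TwistSequences

variable {G X : Type*} [Group G] [MulAction G X]

/-- Commuting labels that fix each other's vectors are unchanged by twisting; this serves the column
with -2 half twists. -/
theorem isTwistSequence_const {a b : G} {u v : X} (h : a * b = b * a) (hu : b • u = u)
    (hv : a • v = v) : IsTwistSequence (fun _ => (a, u)) fun _ => (b, v) :=
  ⟨fun _ => h, fun _ => h.symm, fun _ => hu, fun _ => hv⟩

/-- A full turn conjugates both labels by ab. Transport of u through b gives b⁻¹u = (ab)⁻¹(au) =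
ν(ab)⁻¹u, as u is an eigenvector of a; hence one factor ν for each turn. -/
theorem isTwistSequence_of_smul {H : Type*} [Group H] [MulAction H X] [SMulCommClass G H X]
    {a b : G} {u v : X} {ν : H} (hu : a • u = ν • u) (hv : b • v = ν • v) :
    IsTwistSequence
      (fun j => ((a * b) ^ (-j) * a * (a * b) ^ j, (ν ^ j) • (a * b) ^ (-j) • u))
      fun j => ((a * b) ^ (-j) * b * (a * b) ^ j, (ν ^ j) • (a * b) ^ (-j) • v) := by
  have hu' : a⁻¹ • ν • u = u := by rw [← hu, inv_smul_smul]
  have hv' : b⁻¹ • ν • v = v := by rw [← hv, inv_smul_smul]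
  refine ⟨fun j => ?_, fun j => ?_, fun j => ?_, fun j => ?_⟩
  -- With b = a⁻¹w the powers of ab become powers of a single letter, within the reach of `group`.
  · generalize hw : a * b = w
    obtain rfl : b = a⁻¹ * w := by rw [← hw, inv_mul_cancel_left]
    group
  · generalize hw : a * b = w
    obtain rfl : b = a⁻¹ * w := by rw [← hw, inv_mul_cancel_left]
    group
  · have e : (a * b) ^ (-j) * b * (a * b) ^ j * (a * b) ^ (-(j + 1)) = (a * b) ^ (-j) * a⁻¹ := by
      generalize hw : a * b = w
      obtain rfl : b = a⁻¹ * w := by rw [← hw, inv_mul_cancel_left]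
      group
    simp only
    rw [smul_comm, ← mul_smul, e, zpow_add_one, mul_smul, mul_smul, ← smul_comm _ ν,
      ← smul_comm _ ν, hu']
  · have e : (a * b) ^ (-(j + 1)) * a * (a * b) ^ (j + 1) * (a * b) ^ (-(j + 1)) =
        (a * b) ^ (-j) * b⁻¹ := by
      generalize hw : a * b = w
      obtain rfl : b = a⁻¹ * w := by rw [← hw, inv_mul_cancel_left]
      group
    simp only
    rw [smul_comm, ← mul_smul, e, zpow_add_one, mul_smul, mul_smul, ← smul_comm _ ν,
      ← smul_comm _ ν, hv']

end TwistSequences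

/-- A linear recurrence over the integers with the characteristic roots `-ξ²` and `-ξ⁻²`. -/
theorem recurrence_eq {W : Type*} [AddCommGroup W] [Module ℂ W] {ξ : ℂ} (h0 : ξ ≠ 0)
    (h1 : ξ ^ 2 ≠ 1) {k : ℤ} (hk : ξ ^ (2 * k + 1) = (-1) ^ k) {p q : ℤ → W}
    (hp : ∀ j, p (j + 1) = p j - (ξ + ξ⁻¹) • q j)
    (hq : ∀ j, q (j + 1) = (ξ + ξ⁻¹) • p j + (1 - (ξ + ξ⁻¹) ^ 2) • q j) :
    q k = p 0 ∧ p (k + 1) = -q 0 := by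
  -- For η = ξ and for η = ξ⁻¹ the combination p - ηq is multiplied by -η² in each step, and (-η²)^k
  -- = η⁻¹.
  have key : ∀ η : ℂ, η ≠ 0 → ξ + ξ⁻¹ = η + η⁻¹ → η ^ (2 * k + 1) = (-1) ^ k →
      p k - η • q k = η⁻¹ • p 0 - q 0 := by
    intro η hη ht hηk
    have hstep : ∀ j, p (j + 1) - η • q (j + 1) = (-η ^ 2) • (p j - η • q j) := by
      intro j
      rw [hp, hq, ht]
      match_scalars <;> field_simp <;> ring
    have hη2 : -η ^ 2 ≠ 0 := neg_ne_zero.2 (pow_ne_zero 2 hη)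
    have hall : ∀ j : ℤ, p j - η • q j = ((-η ^ 2) ^ j) • (p 0 - η • q 0) := by
      intro j
      induction j using Int.induction_on with
      | zero => simp
      | succ j ih => rw [hstep, ih, zpow_add_one₀ hη2, smul_smul, mul_comm]
      | pred j ih =>
        have h := hstep (-j - 1)
        rw [sub_add_cancel, ih] at h
        rw [zpow_sub_one₀ hη2, mul_comm, mul_smul, h, inv_smul_smul₀ hη2]
    have hpow : (-η ^ 2) ^ k = η⁻¹ := by
      have e1 : (-η ^ 2) ^ k = (-1) ^ k * η ^ (2 * k) := by
        rw [neg_eq_neg_one_mul, mul_zpow, zpow_mul, zpow_ofNat]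
      have e2 : η ^ (2 * k) = (-1) ^ k * η⁻¹ := by
        rw [← hηk, zpow_add_one₀ hη, mul_inv_cancel_right₀ hη]
      rw [e1, e2, ← mul_assoc, ← mul_zpow]
      simp
    rw [hall, hpow, smul_sub, smul_smul, inv_mul_cancel₀ hη, one_smul]
  have k1 := key ξ h0 rfl hk
  have k2 := key ξ⁻¹ (inv_ne_zero h0) (by rw [inv_inv, add_comm]) (by
    rw [inv_zpow, hk, ← inv_zpow]
    simp)
  rw [inv_inv] at k2
  -- Since ξ² ≠ 1 the two eigencombinations are independent, so q k can be solved for.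
  have hne : ξ - ξ⁻¹ ≠ 0 := by
    intro h
    apply h1
    field_simp at h
    linear_combination h
  have hqk : q k = p 0 := by
    have : (ξ - ξ⁻¹) • q k = (ξ - ξ⁻¹) • p 0 := by
      rw [sub_smul, sub_smul]
      linear_combination (norm := module) k2 - k1
    exact smul_right_injective W hne this
  refine ⟨hqk, ?_⟩
  rw [hp, hqk]
  rw [hqk] at k1
  rw [eq_neg_iff_add_eq_zero, add_smul]
  linear_combination (norm := module) k1

/-- A suitable root of `±1`. -/
theorem exists_root {k : ℤ} (hk : k ≠ -1) (hk' : k ≠ 0) : ∃ ξ : ℂ, ξ ≠ 0 ∧ ξ ^ 2 ≠ 1 ∧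
    ξ ^ (2 * k + 1) = (-1) ^ k ∧ ξ + ξ⁻¹ ≠ 0 ∧ ∃ r : ℝ, (ξ + ξ⁻¹) ^ 2 = (r : ℂ) ^ 2 := by
  obtain ⟨n, hn⟩ : ∃ n, n = (2 * k + 1).natAbs := ⟨_, rfl⟩
  have hn3 : 3 ≤ n := by omega
  have hodd : n % 2 = 1 := by omega
  -- The order n = |2k+1| is odd, and at least 3 because k ≠ -1, 0. The root sought is ξ = (-1)^k ζ.
  have hζ := Complex.isPrimitiveRoot_exp n (by omega)
  set ζ := Complex.exp (2 * Real.pi * Complex.I / n)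
  have hζ0 : ζ ≠ 0 := hζ.ne_zero (by omega)
  have hs : ((-1 : ℂ) ^ k) ^ 2 = 1 := by
    rw [← zpow_natCast, ← zpow_mul, mul_comm, zpow_mul]
    simp
  have hs0 : (-1 : ℂ) ^ k ≠ 0 := zpow_ne_zero _ (by norm_num)
  have hsinv : ((-1 : ℂ) ^ k)⁻¹ = (-1) ^ k := by
    rw [inv_eq_iff_eq_inv]
    field_simp
    exact hs
  -- This excludes both ξ² = 1 and ξ² = -1, the latter being equivalent to ξ + ξ⁻¹ = 0.
  have h4 : ζ ^ 4 ≠ 1 := by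
    intro h
    have h4 := hζ.dvd_of_pow_eq_one 4 h
    have := Nat.le_of_dvd (by norm_num) h4
    interval_cases n <;> omega
  have hsq : ((-1) ^ k * ζ) ^ 2 = ζ ^ 2 := by rw [mul_pow, hs, one_mul]
  refine ⟨(-1) ^ k * ζ, mul_ne_zero hs0 hζ0, ?_, ?_, ?_, 2 * ζ.re, ?_⟩
  · rw [hsq]
    intro h
    apply h4
    rw [show ζ ^ 4 = (ζ ^ 2) ^ 2 by ring, h, one_pow]
  · have h1 : ζ ^ (2 * k + 1) = 1 := by
      rw [hζ.zpow_eq_one_iff_dvd, hn]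
      exact Int.natAbs_dvd.2 dvd_rfl
    rw [mul_zpow, h1, mul_one, zpow_add_one₀ hs0, zpow_mul, zpow_ofNat, hs, one_zpow, one_mul]
  · intro h
    have h2 : ((-1) ^ k * ζ) ^ 2 = -1 := by
      have hne : (-1 : ℂ) ^ k * ζ ≠ 0 := mul_ne_zero hs0 hζ0
      generalize (-1 : ℂ) ^ k * ζ = z at *
      field_simp at h
      linear_combination h
    rw [hsq] at h2
    apply h4
    rw [show ζ ^ 4 = (ζ ^ 2) ^ 2 by ring, h2]
    norm_num
  -- As |ζ| = 1, ξ + ξ⁻¹ = (-1)^k · 2 Re ζ; its square is the square of a real number, which later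
  -- gives positivity.
  · have hinv : ζ⁻¹ = (starRingEnd ℂ) ζ :=
      Complex.inv_eq_conj (hζ.norm'_eq_one (by omega))
    rw [mul_inv, hsinv, ← mul_add, hinv, Complex.add_conj, mul_pow, hs, one_mul]

/-! ### Reflections and the Artin relations between them -/

section ReflectionGroups

variable {V : Type*} [AddCommGroup V] [Module ℂ V]

/-- The reflection `x ↦ x + ψ x • v` with the nontrivial eigenvalue `μ`. -/
noncomputable def reflectionUnit (ψ : V →ₗ[ℂ] ℂ) (v : V) (μ : ℂˣ) (h : ψ v = μ - 1) :
    (V →ₗ[ℂ] V)ˣ where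
  val := LinearMap.id + ψ.smulRight v
  inv := LinearMap.id - (μ : ℂ)⁻¹ • ψ.smulRight v
  val_inv := by
    refine LinearMap.ext fun x => ?_
    simp only [Module.End.mul_apply, LinearMap.add_apply, LinearMap.sub_apply, LinearMap.id_apply,
      LinearMap.smul_apply, LinearMap.smulRight_apply, map_sub, map_smul, h,
      Module.End.one_apply]
    match_scalars
    · ring
    · linear_combination (-ψ x) * inv_mul_cancel₀ μ.ne_zero
  inv_val := by
    refine LinearMap.ext fun x => ?_
    simp only [Module.End.mul_apply, LinearMap.add_apply, LinearMap.sub_apply, LinearMap.id_apply,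
      LinearMap.smul_apply, LinearMap.smulRight_apply, map_add, map_smul, h,
      Module.End.one_apply]
    match_scalars
    · ring
    · linear_combination (-ψ x) * inv_mul_cancel₀ μ.ne_zero

section

variable {ψ : V →ₗ[ℂ] ℂ} {v : V} {μ : ℂˣ} {h : ψ v = μ - 1}

theorem reflectionUnit_smul (x : V) : reflectionUnit ψ v μ h • x = x + ψ x • v := rfl

theorem reflectionUnit_mem : reflectionUnit ψ v μ h ∈ reflections V := ⟨ψ, v, fun _ => rfl⟩

theorem reflectionUnit_smul_self : reflectionUnit ψ v μ h • v = μ • v := by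
  rw [reflectionUnit_smul, h, Units.smul_def]
  module

theorem reflectionUnit_smul_of_eq_zero {x : V} (hx : ψ x = 0) : reflectionUnit ψ v μ h • x = x := by
  rw [reflectionUnit_smul, hx, zero_smul, add_zero]

end

theorem units_end_ext {f g : (V →ₗ[ℂ] V)ˣ} (h : ∀ x : V, f • x = g • x) : f = g :=
  Units.ext (LinearMap.ext h)

variable {φ ψ : V →ₗ[ℂ] ℂ} {v w : V} {μ : ℂˣ} {hφ : φ v = μ - 1} {hψ : ψ w = μ - 1}

theorem reflectionUnit_commute (h1 : φ w = 0) (h2 : ψ v = 0) :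
    reflectionUnit φ v μ hφ * reflectionUnit ψ w μ hψ =
      reflectionUnit ψ w μ hψ * reflectionUnit φ v μ hφ := by
  refine units_end_ext fun x => ?_
  simp only [mul_smul, reflectionUnit_smul, map_add, map_smul, h1, h2, smul_eq_mul]
  module

/-- On expanding both sides, the coefficients of v and w differ by multiples of φ w * ψ v + μ. -/
theorem reflectionUnit_braid (h : φ w * ψ v = -μ) :
    reflectionUnit φ v μ hφ * reflectionUnit ψ w μ hψ * reflectionUnit φ v μ hφ =
      reflectionUnit ψ w μ hψ * reflectionUnit φ v μ hφ * reflectionUnit ψ w μ hψ := by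
  refine units_end_ext fun x => ?_
  simp only [mul_smul, reflectionUnit_smul, map_add, map_smul, hφ, hψ, smul_eq_mul]
  match_scalars
  · ring
  · linear_combination φ x * h
  · linear_combination (-ψ x) * h

/-- Up to the factor μ, CA acts on v and w by the recurrence with characteristic roots -ξ² and -ξ⁻².
The condition on ξ makes (CA)^k take w to a multiple of v, and dually φ ∘ (CA)^k a multiple of ψ;
together these give A(CA)^k = (CA)^k C. The value (-1)^k rather than its negative fixes the signs of
the vectors, which matter for the longitude. -/
theorem reflectionUnit_zpow {ξ : ℂ} (h0 : ξ ≠ 0) (h1 : ξ ^ 2 ≠ 1) {k : ℤ}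
    (hk : ξ ^ (2 * k + 1) = (-1) ^ k) (h2 : φ w = μ * (ξ + ξ⁻¹)) (h3 : ψ v = -(ξ + ξ⁻¹)) :
    (reflectionUnit ψ w μ hψ * reflectionUnit φ v μ hφ) ^ k • w = μ ^ k • v ∧
      (reflectionUnit ψ w μ hψ * reflectionUnit φ v μ hφ) ^ (k + 1) • v = -(μ ^ (k + 1) • w) ∧
      reflectionUnit φ v μ hφ * (reflectionUnit ψ w μ hψ * reflectionUnit φ v μ hφ) ^ k =
        (reflectionUnit ψ w μ hψ * reflectionUnit φ v μ hφ) ^ k * reflectionUnit ψ w μ hψ := by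
  set t := ξ + ξ⁻¹ with ht
  set A := reflectionUnit φ v μ hφ with hA
  set C := reflectionUnit ψ w μ hψ with hC
  have hAx : ∀ x, A • x = x + φ x • v := fun x => rfl
  have hCx : ∀ x, C • x = x + ψ x • w := fun x => rfl
  have hμ : ∀ x : V, μ • x = (μ : ℂ) • x := fun x => rfl
  have hv : (C * A) • v = μ • (v - t • w) := by
    rw [mul_smul, hA, reflectionUnit_smul_self, smul_comm, hCx, h3, hμ, hμ]
    module
  have hw : (C * A) • w = μ • (t • v + (1 - t ^ 2) • w) := by
    simp only [mul_smul, hAx, hCx, map_add, map_smul, h2, h3, hψ, smul_eq_mul, hμ]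
    module
  have hφ' : ∀ x, φ ((C * A) • x) = μ * (t * ψ x + (1 - t ^ 2) * φ x) := by
    intro x
    simp only [mul_smul, hAx, hCx, map_add, map_smul, h2, h3, hφ, smul_eq_mul]
    ring
  have hψ' : ∀ x, ψ ((C * A) • x) = μ * (ψ x - t * φ x) := by
    intro x
    simp only [mul_smul, hAx, hCx, map_add, map_smul, h3, hψ, smul_eq_mul]
    ring
  have hsucc : ∀ (j : ℤ) (x : V), μ ^ (-(j + 1)) • (C * A) ^ (j + 1) • (μ • x) =
      μ ^ (-j) • (C * A) ^ j • ((C * A) • x) := by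
    intro j x
    rw [zpow_add_one, mul_smul, smul_comm (C * A) μ, smul_comm ((C * A) ^ j) μ, smul_smul,
      neg_add, zpow_add, zpow_neg_one, inv_mul_cancel_right]
  have hscal : ∀ (g : (V →ₗ[ℂ] V)ˣ) (c : ℂ) (x : V), g • c • x = c • g • x :=
    fun g c x => g.val.map_smul c x
  -- Dividing by μ^j turns `hv` and `hw` into the normalized recurrence.
  obtain ⟨r1, r2⟩ := recurrence_eq h0 h1 hk (p := fun j => μ ^ (-j) • (C * A) ^ j • v)
    (q := fun j => μ ^ (-j) • (C * A) ^ j • w) (fun j => by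
      have h := hsucc j (μ⁻¹ • v)
      simp only [smul_inv_smul] at h
      rw [h, smul_comm (C * A) (μ⁻¹ : ℂˣ), hv, inv_smul_smul, smul_sub, hscal, smul_sub,
        smul_comm _ t]) (fun j => by
      have h := hsucc j (μ⁻¹ • w)
      simp only [smul_inv_smul] at h
      rw [h, smul_comm (C * A) (μ⁻¹ : ℂˣ), hw, inv_smul_smul, smul_add, hscal, hscal, smul_add,
        smul_comm (μ ^ (-j)) t, smul_comm (μ ^ (-j)) (1 - t ^ 2)])
  -- The covectors ψ and φ, evaluated along the orbit of x, obey the same recurrence in the roles of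
  -- p and q.
  have hdual : ∀ x, φ ((C * A) ^ k • x) = μ ^ k * ψ x := by
    have hneg : ∀ j : ℤ, ((μ ^ (-(j + 1)) : ℂˣ) : ℂ) * μ = (μ ^ (-j) : ℂˣ) := by
      intro j
      rw [← Units.val_mul, neg_add, zpow_add, zpow_neg_one, inv_mul_cancel_right]
    intro x
    obtain ⟨r, -⟩ := recurrence_eq h0 h1 hk
      (p := fun j => ((μ ^ (-j) : ℂˣ) : ℂ) * ψ ((C * A) ^ j • x))
      (q := fun j => ((μ ^ (-j) : ℂˣ) : ℂ) * φ ((C * A) ^ j • x)) (fun j => by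
        rw [add_comm j 1, zpow_add, zpow_one, mul_smul, hψ', add_comm 1 j, ← mul_assoc, hneg,
          smul_eq_mul]
        ring) (fun j => by
        rw [add_comm j 1, zpow_add, zpow_one, mul_smul, hφ', add_comm 1 j, ← mul_assoc, hneg,
          smul_eq_mul, smul_eq_mul]
        ring)
    simp only [neg_zero, zpow_zero, one_smul, Units.val_one, one_mul] at r
    rw [← r, zpow_neg, ← mul_assoc, ← Units.val_zpow_eq_zpow_val, Units.mul_inv, one_mul]
  simp only [neg_zero, zpow_zero, one_smul] at r1 r2
  have e1 : (C * A) ^ k • w = μ ^ k • v := by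
    rw [← r1, zpow_neg, smul_inv_smul]
  refine ⟨e1, ?_, units_end_ext fun x => ?_⟩
  · rw [← smul_neg, ← r2, zpow_neg, smul_inv_smul]
  · have hμk : ∀ x : V, μ ^ k • x = ((μ : ℂ) ^ k) • x := fun x => by
      rw [Units.smul_def, Units.val_zpow_eq_zpow_val]
    rw [mul_smul, mul_smul, hAx, hdual, hCx, smul_add, hscal, e1, hμk, smul_smul, mul_comm]

end ReflectionGroups

/-! ### A criterion for irreducibility -/

section Irreducibility

variable {V Γ ι : Type*} [AddCommGroup V] [Module ℂ V] [Group Γ]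

/-- A representation is irreducible if some elements act as reflections in vectors that span the
space and are connected to each other, and whose covectors have no common zero. -/
theorem isIrreducible_of_reflections [Nontrivial V] (ρ : Representation ℂ Γ V) (g : ι → Γ)
    {ψ : ι → V →ₗ[ℂ] ℂ} {e : ι → V} (hρ : ∀ i x, ρ (g i) x = x + ψ i x • e i)
    (hspan : Submodule.span ℂ (Set.range e) = ⊤) (hψ : ∀ x, (∀ i, ψ i x = 0) → x = 0)
    (hconn : ∀ i j, Relation.ReflTransGen (fun i j => ψ j (e i) ≠ 0) i j) : ρ.IsIrreducible := by
  -- The difference g_i x - x = ψ_i(x) e_i lies in W.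
  have hmem : ∀ (W : Subrepresentation ρ) (i : ι) (x : V), x ∈ W.toSubmodule → ψ i x ≠ 0 →
      e i ∈ W.toSubmodule := by
    intro W i x hx hne
    have h1 := W.toSubmodule.sub_mem (W.apply_mem_toSubmodule (g i) hx) hx
    rw [hρ, add_sub_cancel_left] at h1
    exact (W.toSubmodule.smul_mem_iff hne).1 h1
  refine { exists_pair_ne := ⟨⊥, ⊤, fun h => ?_⟩, eq_bot_or_eq_top := fun W => ?_ }
  · exact bot_ne_top (congrArg Subrepresentation.toSubmodule h : (⊥ : Submodule ℂ V) = ⊤)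
  · by_cases hW : W.toSubmodule = ⊥
    · exact .inl (Subrepresentation.toSubmodule_injective hW)
    · refine .inr (Subrepresentation.toSubmodule_injective ?_)
      obtain ⟨x, hx, hx0⟩ := Submodule.exists_mem_ne_zero_of_ne_bot hW
      obtain ⟨i, hi⟩ : ∃ i, ψ i x ≠ 0 := by
        by_contra! h
        exact hx0 (hψ x h)
      have he : ∀ j, e j ∈ W.toSubmodule := by
        intro j
        induction hconn i j with
        | refl => exact hmem W i x hx hi
        | tail _ hne ih => exact hmem W _ _ ih hne
      refine eq_top_iff.2 (hspan ▸ Submodule.span_le.2 ?_)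
      rintro _ ⟨j, rfl⟩
      exact he j

end Irreducibility

/-- An element that acts as a reflection with an eigenvalue `μ ≠ 1` makes a representation KCH. -/
theorem LinkDiagram.isKCH_of_reflection {D : LinkDiagram} {V : Type*} [AddCommGroup V] [Module ℂ V]
    [FiniteDimensional ℂ V] (ρ : Representation ℂ D.linkGroup V) {m : D.linkGroup}
    (hm : D.IsMeridian m) {ψ : V →ₗ[ℂ] ℂ} {v : V} (hρ : ∀ x, ρ m x = x + ψ x • v) (h : ψ v ≠ 0) :
    D.IsKCH ρ := by
  have hv : v ≠ 0 := by
    rintro rfl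
    exact h (map_zero ψ)
  have hψ : ψ ≠ 0 := by
    rintro rfl
    exact h rfl
  have h1 : Module.End.eigenspace (ρ m) 1 = ψ.ker := by
    ext x
    rw [Module.End.mem_eigenspace_iff, hρ, one_smul, add_eq_left, smul_eq_zero, LinearMap.mem_ker]
    simp [hv]
  refine ⟨m, hm, ?_, ?_⟩
  · refine eq_top_iff.2 fun x _ => ?_
    -- The first summand lies in ker ψ, the second on the line of v, whose eigenvalue is 1 + ψ v.
    have hx : x = (x - (ψ x / ψ v) • v) + (ψ x / ψ v) • v := by rw [sub_add_cancel]
    rw [hx]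
    refine Submodule.add_mem _ (Submodule.mem_iSup_of_mem 1 ?_)
      (Submodule.mem_iSup_of_mem (1 + ψ v) ?_)
    · rw [h1, LinearMap.mem_ker, map_sub, map_smul, smul_eq_mul, div_mul_cancel₀ _ h, sub_self]
    · refine Submodule.smul_mem _ _ ?_
      rw [Module.End.mem_eigenspace_iff, hρ, add_smul, one_smul]
  · rw [h1, Module.Dual.finrank_ker_add_one_of_ne_zero hψ]

/-- The representations of the group of a pretzel knot that are given by three reflections. -/
theorem exists_hom_reflections {V : Type*} [AddCommGroup V] [Module ℂ V] {μ : ℂˣ} {ξ : ℂ} {k : ℤ}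
    (h0 : ξ ≠ 0) (h1 : ξ ^ 2 ≠ 1) (hk : ξ ^ (2 * k + 1) = (-1) ^ k) {e : Fin 3 → V}
    {ψ : Fin 3 → V →ₗ[ℂ] ℂ}
    (hψ : ∀ i j, ψ i (e j) =
      !![(μ : ℂ) - 1, 0, μ * (ξ + ξ⁻¹); 0, μ - 1, -(μ : ℂ); -(ξ + ξ⁻¹), 1, μ - 1] i j) :
    ∃ φ : (pretzel (-2) 3 (2 * k + 1)).linkGroup →* (V →ₗ[ℂ] V)ˣ,
      (∃ g : Fin 3 → (pretzel (-2) 3 (2 * k + 1)).linkGroup,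
        g 0 = (pretzel (-2) 3 (2 * k + 1)).gen 1 0 ∧ ∀ i x, φ (g i) • x = x + ψ i x • e i) ∧
      (∀ j i, φ ((pretzel (-2) 3 (2 * k + 1)).gen j i) ∈ reflections V) ∧
      φ ((pretzel (-2) 3 (2 * k + 1)).blackboardLongitude ⟨1, 0, true⟩) • e 0 = e 0 := by
  have hAA : ψ 0 (e 0) = μ - 1 := hψ 0 0
  have hAB : ψ 0 (e 1) = 0 := hψ 0 1
  have hAC : ψ 0 (e 2) = μ * (ξ + ξ⁻¹) := hψ 0 2
  have hBA : ψ 1 (e 0) = 0 := hψ 1 0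
  have hBB : ψ 1 (e 1) = μ - 1 := hψ 1 1
  have hBC : ψ 1 (e 2) = -μ := hψ 1 2
  have hCA : ψ 2 (e 0) = -(ξ + ξ⁻¹) := hψ 2 0
  have hCB : ψ 2 (e 1) = 1 := hψ 2 1
  have hCC : ψ 2 (e 2) = μ - 1 := hψ 2 2
  obtain ⟨z1, z2, z3⟩ := reflectionUnit_zpow (hφ := hAA) (hψ := hCC) h0 h1 hk hAC hCA
  have hcomm := reflectionUnit_commute (hφ := hAA) (hψ := hBB) hAB hBA
  have hbraid := reflectionUnit_braid (hφ := hBB) (hψ := hCC) (by rw [hBC, hCB, mul_one])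
  have hAx : ∀ x, reflectionUnit _ _ _ hAA • x = x + ψ 0 x • e 0 := fun x => rfl
  have hBx : ∀ x, reflectionUnit _ _ _ hBB • x = x + ψ 1 x • e 1 := fun x => rfl
  have hCx : ∀ x, reflectionUnit _ _ _ hCC • x = x + ψ 2 x • e 2 := fun x => rfl
  have mA : reflectionUnit _ _ _ hAA ∈ reflections V := reflectionUnit_mem
  have mB : reflectionUnit _ _ _ hBB ∈ reflections V := reflectionUnit_mem
  have mC : reflectionUnit _ _ _ hCC ∈ reflections V := reflectionUnit_mem
  have hA : reflectionUnit _ _ _ hAA • e 0 = μ • e 0 := reflectionUnit_smul_self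
  have hB : reflectionUnit _ _ _ hBB • e 1 = μ • e 1 := reflectionUnit_smul_self
  have hC : reflectionUnit _ _ _ hCC • e 2 = μ • e 2 := reflectionUnit_smul_self
  have hA' : reflectionUnit _ _ _ hAA • e 1 = e 1 := reflectionUnit_smul_of_eq_zero hAB
  have hB' : reflectionUnit _ _ _ hBB • e 0 = e 0 := reflectionUnit_smul_of_eq_zero hBA
  generalize reflectionUnit _ _ _ hAA = A at *
  generalize reflectionUnit _ _ _ hBB = B at *
  generalize reflectionUnit _ _ _ hCC = C at *
  have hμ : ∀ x : V, μ • x = (μ : ℂ) • x := fun x => rfl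
  -- `w1`, `w2` are the vector forms and `b1`, `b2` the label forms of the braid relation, for the
  -- column with three half twists.
  have w1 : (C * B) • e 2 = -(μ • e 1) := by
    simp only [mul_smul, hBx, hCx, map_add, map_smul, hBC, hCB, hCC, smul_eq_mul, hμ]
    module
  have w2 : (C * B) • (C * B) • e 1 = μ • μ • e 2 := by
    simp only [mul_smul, hBx, hCx, map_add, map_smul, hBB, hBC, hCB, hCC, smul_eq_mul, hμ]
    module
  have b1 : C * B * C = B * (C * B) := by rw [← mul_assoc, hbraid]
  have b2 : C * ((C * B) * (C * B)) = (C * B) * (C * B) * B := by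
    calc C * ((C * B) * (C * B)) = C * (C * B * C) * B := by group
      _ = C * (B * C * B) * B := by rw [hbraid]
      _ = (C * B) * (C * B) * B := by group
  have hN : A⁻¹ * C⁻¹ = (C * A)⁻¹ := (mul_inv_rev C A).symm
  -- The relation `z3`, with one more factor C on the left and A on the right.
  have c1 : (C * A) ^ (k + 1) * A = C * (C * A) ^ (k + 1) := by
    calc (C * A) ^ (k + 1) * A = C * (A * (C * A) ^ k) * A := by
          rw [add_comm, zpow_add, zpow_one]; group
      _ = C * ((C * A) ^ k * (C * A)) := by rw [z3]; group
      _ = C * (C * A) ^ (k + 1) := by rw [zpow_add_one]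
  have hconj : ∀ {a b g : (V →ₗ[ℂ] V)ˣ}, g * a = b * g → g * a⁻¹ * g⁻¹ * b = 1 := by
    intro a b g h
    rw [eq_mul_inv_iff_mul_eq.2 h.symm]
    group
  obtain ⟨φ, u, ⟨g1, g2, g3⟩, ⟨u1, -⟩, hu⟩ := exists_hom_pretzel (G := (V →ₗ[ℂ] V)ˣ) (X := V)
    (d := (1, 0)) (k := k) rfl
    -- The bottom row is A, B⁻¹ | B, C | C⁻¹, A⁻¹ with vectors e 0, e 1 | e 1, e 2 | e 2, e 0, so
    -- that labels at each minimum are inverse to each other and vectors agree. Because of the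
    -- inverses, the third column has eigenvalue μ⁻¹ and product A⁻¹C⁻¹ = (CA)⁻¹.
    (isTwistSequence_const (a := B⁻¹) (b := A) (u := e 1) (v := e 0)
      (by rw [inv_mul_eq_iff_eq_mul, ← mul_assoc, ← hcomm, mul_inv_cancel_right]) hA'
      (by rw [inv_smul_eq_iff, hB']))
    (isTwistSequence_of_smul hC hB)
    (isTwistSequence_of_smul (a := A⁻¹) (b := C⁻¹) (ν := μ⁻¹) (u := e 0) (v := e 2)
      (by rw [inv_smul_eq_iff, smul_comm, hA, inv_smul_smul])
      (by rw [inv_smul_eq_iff, smul_comm, hC, inv_smul_smul]))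
    (by simp) (by simp) (by simp) (by simp) (by simp)
    -- Maximum between the first and the second column: the labels and vectors of B and e 1 must
    -- come back.
    (by
      rw [mul_inv_eq_one]
      change (C * B) ^ (-2 : ℤ) * C * (C * B) ^ (2 : ℤ) = B
      rw [zpow_neg, mul_assoc, inv_mul_eq_iff_eq_mul, zpow_ofNat, pow_two, b2])
    (by
      change e 1 = μ ^ (2 : ℤ) • (C * B) ^ (-2 : ℤ) • e 2
      rw [zpow_neg, smul_comm, eq_inv_smul_iff, zpow_ofNat, zpow_ofNat, pow_two, pow_two, mul_smul,
        w2, mul_smul])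
    (by
      simp only [hN, inv_zpow', zpow_neg, zpow_one, inv_inv]
      rw [show (C * B)⁻¹ * B * (C * B) = C by rw [mul_assoc, ← b1, inv_mul_cancel_left]]
      exact hconj c1)
    -- Between the second and the third column both vectors are -e 2: the sign in `w1` meets the one
    -- in `z2`.
    (by
      simp only [hN, inv_zpow', neg_neg, zpow_one, zpow_neg_one]
      rw [z2, smul_neg, zpow_neg, inv_smul_smul, smul_comm, inv_smul_eq_iff, smul_neg, w1, neg_neg])
    (by
      simp only [hN, inv_zpow', neg_neg]
      rw [zpow_neg]
      exact hconj z3.symm)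
    (by
      simp only [hN, inv_zpow', neg_neg]
      rw [z1, zpow_neg, inv_smul_smul])
  -- The label at the second minimum is B⁻¹, so its generator is inverted to obtain B.
  refine ⟨φ, ⟨![(pretzel (-2) 3 (2 * k + 1)).gen 1 0, ((pretzel (-2) 3 (2 * k + 1)).gen 2 1)⁻¹,
    (pretzel (-2) 3 (2 * k + 1)).gen 3 3], rfl, fun i x => ?_⟩, ?_, ?_⟩
  · fin_cases i
    · exact g1 ▸ hAx x
    · change φ (((pretzel (-2) 3 (2 * k + 1)).gen 2 1)⁻¹) • x = _
      rw [map_inv, g2, inv_inv]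
      exact hBx x
    · change φ ((pretzel (-2) 3 (2 * k + 1)).gen 3 3) • x = _
      rw [g3]
      simpa using hCx x
  · refine LinkDiagram.map_gen_mem_pretzel φ isConjClosed_reflections
      ⟨0, 0, fun x => by simp⟩ ?_ ?_ ?_
    · rw [g1]
      exact mA
    · rw [g2]
      exact isConjClosed_reflections.inv_mem mB
    · rw [g3]
      simpa using mC
  · have := LinkDiagram.blackboardLongitude_smul φ u (fun j s hs => hu j s hs fun _ => by simp)
      ⟨1, 0, true⟩
    simpa only [u1] using this

theorem strandCount_pretzel_one {a b c : ℤ} : (pretzel a b c).strandCount 1 = 2 := rfl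

/-- For every positive real `μ ≠ 1` there is an irreducible KCH representation of degree `3` of the
group of the pretzel knot, such that the blackboard framed longitude fixes the eigenvector of the
meridian to the eigenvalue `μ`. -/
theorem exists_representation {k : ℤ} (hk : k ≠ -1) (hk' : k ≠ 0) {μ : ℂˣ} {r : ℝ}
    (hr : 0 < r) (hr1 : r ≠ 1) (hμ : (μ : ℂ) = r) :
    ∃ ρ : Representation ℂ (pretzel (-2) 3 (2 * k + 1)).linkGroup (Fin 3 → ℂ),
      (pretzel (-2) 3 (2 * k + 1)).IsKCH ρ ∧ ρ.IsIrreducible ∧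
      (∀ j i, ρ.asGroupHom ((pretzel (-2) 3 (2 * k + 1)).gen j i) ∈ reflections (Fin 3 → ℂ)) ∧
      ∃ v : Fin 3 → ℂ, v ≠ 0 ∧ ρ ((pretzel (-2) 3 (2 * k + 1)).gen 1 0) v = (μ : ℂ) • v ∧
        ρ ((pretzel (-2) 3 (2 * k + 1)).blackboardLongitude ⟨1, 0, true⟩) v = v := by
  obtain ⟨ξ, h0, h1, hξ, ht, s, hs⟩ := exists_root hk hk'
  set t := ξ + ξ⁻¹ with htdef
  -- The vectors are the standard basis and the covectors are the rows of Q, so every relation is a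
  -- condition on entries of Q.
  let Q : Matrix (Fin 3) (Fin 3) ℂ := !![(μ : ℂ) - 1, 0, μ * t; 0, μ - 1, -(μ : ℂ); -t, 1, μ - 1]
  let ψ : Fin 3 → (Fin 3 → ℂ) →ₗ[ℂ] ℂ := fun i => (LinearMap.proj i).comp (Matrix.toLin' Q)
  let e : Fin 3 → Fin 3 → ℂ := fun j => Pi.single j 1
  have hψ : ∀ i j, ψ i (e j) = Q i j := fun i j => by
    simp [ψ, e, Matrix.toLin'_apply]
  have hμ1 : (μ : ℂ) - 1 ≠ 0 := by
    rw [hμ, sub_ne_zero]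
    exact_mod_cast hr1
  -- This is det Q divided by μ - 1. For real μ = r > 0 and t² = s² it is a positive number.
  have hdet : ((μ : ℂ) - 1) ^ 2 + μ + μ * t ^ 2 ≠ 0 := by
    rw [hs, hμ]
    have : 0 < (r - 1) ^ 2 + r + r * s ^ 2 := by positivity
    exact_mod_cast this.ne'
  obtain ⟨φ, ⟨g, hg0, hg⟩, hrefl, hl⟩ :=
    exists_hom_reflections (μ := μ) h0 h1 hξ (e := e) (ψ := ψ) hψ
  let ρ : Representation ℂ (pretzel (-2) 3 (2 * k + 1)).linkGroup (Fin 3 → ℂ) :=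
    (Units.coeHom ((Fin 3 → ℂ) →ₗ[ℂ] (Fin 3 → ℂ))).comp φ
  have hρ : ∀ i x, ρ (g i) x = x + ψ i x • e i := hg
  have he0 : e 0 ≠ 0 := by simp [e]
  refine ⟨ρ, ?_, ?_, fun j i => ?_, e 0, he0, ?_, hl⟩
  · refine LinkDiagram.isKCH_of_reflection ρ (m := g 0) ?_ (hρ 0) ?_
    · rw [hg0]
      exact ⟨1, 0, by rw [strandCount_pretzel_one]; norm_num, .inl (IsConj.refl _)⟩
    · rw [hψ]
      exact hμ1
  · refine isIrreducible_of_reflections ρ g hρ ?_ (fun x hx => ?_) ?_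
    · rw [eq_top_iff]
      intro x _
      rw [pi_eq_sum_univ' x]
      exact Submodule.sum_mem _ fun i _ => Submodule.smul_mem _ _ (Submodule.subset_span ⟨i, by
        ext j; simp [e, Pi.single_apply, eq_comm]⟩)
    · have x0 : ((μ : ℂ) - 1) * x 0 + μ * t * x 2 = 0 := by
        have := hx 0
        simpa [ψ, Q, Matrix.toLin'_apply, Matrix.mulVec, dotProduct, Fin.sum_univ_three] using this
      have x1 : ((μ : ℂ) - 1) * x 1 + -μ * x 2 = 0 := by
        have := hx 1
        simpa [ψ, Q, Matrix.toLin'_apply, Matrix.mulVec, dotProduct, Fin.sum_univ_three] using this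
      have x2 : -t * x 0 + x 1 + ((μ : ℂ) - 1) * x 2 = 0 := by
        have := hx 2
        simpa [ψ, Q, Matrix.toLin'_apply, Matrix.mulVec, dotProduct, Fin.sum_univ_three] using this
      have h2 : x 2 = 0 := by
        refine (mul_eq_zero.1
          (?_ : (((μ : ℂ) - 1) ^ 2 + μ + μ * t ^ 2) * x 2 = 0)).resolve_left hdet
        linear_combination t * x0 - x1 + ((μ : ℂ) - 1) * x2
      rw [h2] at x0 x1
      have h3 : x 0 = 0 := (mul_eq_zero.1 (by linear_combination x0)).resolve_left hμ1
      have h4 : x 1 = 0 := (mul_eq_zero.1 (by linear_combination x1)).resolve_left hμ1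
      funext i
      fin_cases i
      exacts [h3, h4, h2]
    · have e02 : ψ 2 (e 0) ≠ 0 := by rw [hψ]; exact neg_ne_zero.2 ht
      have e20 : ψ 0 (e 2) ≠ 0 := by rw [hψ]; exact mul_ne_zero μ.ne_zero ht
      have e21 : ψ 1 (e 2) ≠ 0 := by rw [hψ]; exact neg_ne_zero.2 μ.ne_zero
      have e12 : ψ 2 (e 1) ≠ 0 := by rw [hψ]; exact one_ne_zero
      -- Every reflection is linked in both directions to the one with index 2, that is, to C.
      have hto : ∀ i, Relation.ReflTransGen (fun i j => ψ j (e i) ≠ 0) i 2 := by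
        intro i
        fin_cases i
        exacts [.single e02, .single e12, .refl]
      have hof : ∀ i, Relation.ReflTransGen (fun i j => ψ j (e i) ≠ 0) 2 i := by
        intro i
        fin_cases i
        exacts [.single e20, .single e21, .refl]
      exact fun i j => (hto i).trans (hof j)
  · have : ρ.asGroupHom ((pretzel (-2) 3 (2 * k + 1)).gen j i) =
        φ ((pretzel (-2) 3 (2 * k + 1)).gen j i) := Units.ext rfl
    rw [this]
    exact hrefl j i
  · rw [← hg0, hρ, hψ]
    change e 0 + ((μ : ℂ) - 1) • e 0 = _
    module

/-! ### Abelian quotients of the pretzel group -/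

section Abelian

variable {A : Type*} [CommGroup A]

theorem crossMap_eq_swap (β : Bool) (p : ℕ) (b : ℕ → A) :
    crossMap β p b = fun i => b (Equiv.swap p (p + 1) i) := by
  funext i
  unfold crossMap
  split_ifs with h1 h2 h3 h4
  · subst h1
    rw [Equiv.swap_apply_left, mul_right_comm, inv_mul_cancel, one_mul]
  · subst h1
    rw [Equiv.swap_apply_left]
  · subst h3
    rw [Equiv.swap_apply_right]
  · subst h3
    rw [Equiv.swap_apply_right, mul_right_comm, mul_inv_cancel, one_mul]
  · rw [Equiv.swap_apply_of_ne_of_ne h1 h3]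

/-- With commuting labels a crossing only exchanges its two strands, so only the parity of c
matters. -/
theorem IsColorable.twists_eq {b t : ℕ → A} {p : ℕ} {c : ℤ} (h : IsColorable b (twists p c) t) :
    t = if Even c then b else fun i => b (Equiv.swap p (p + 1) i) := by
  have key : ∀ (n : ℕ) (b : ℕ → A),
      IsColorable b (List.replicate n ⟨.cross (decide (0 ≤ c)), p⟩) t →
        t = if Even n then b else fun i => b (Equiv.swap p (p + 1) i) := by
    intro n
    induction n with
    | zero => exact fun b h => by simpa using (isColorable_nil.1 h).symm
    | succ n ih =>
      intro b h
      rw [List.replicate_succ, isColorable_cons] at h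
      obtain ⟨m, hm, h⟩ := h
      rw [compat_cross_iff, crossMap_eq_swap] at hm
      rw [ih m h, hm]
      by_cases hn : Even n <;> simp [hn, Nat.even_add_one]
  simpa only [Int.natAbs_even] using key _ _ h

theorem isColorable_append {b t : ℕ → A} {u v : List Slice} (h : IsColorable b (u ++ v) t) :
    ∃ m, IsColorable b u m ∧ IsColorable m v t := by
  obtain ⟨L, h⟩ := h
  obtain ⟨m, L₁, L₂, h1, h2, -⟩ := isColoring_append.1 h
  exact ⟨m, ⟨L₁, h1⟩, L₂, h2⟩

namespace LinkDiagram

variable {a b c : ℤ}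

/-- In an abelian quotient, the meridians at the minima of a pretzel knot are determined by one
meridian. -/
theorem map_gen_pretzel (ha : Even a) (hb : ¬ Even b) (hc : ¬ Even c)
    (φ : (pretzel a b c).linkGroup →* A) :
    φ ((pretzel a b c).gen 2 1) = (φ ((pretzel a b c).gen 1 0))⁻¹ ∧
      φ ((pretzel a b c).gen 3 3) = φ ((pretzel a b c).gen 1 0) := by
  obtain ⟨c0, -, -⟩ := Slice.compat_iff.1 ((compat_gen
    (show (pretzel a b c).slices[0]? = some ⟨.cup, 0⟩ from rfl)).map φ)
  obtain ⟨c1, -, r1⟩ := Slice.compat_iff.1 ((compat_gen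
    (show (pretzel a b c).slices[1]? = some ⟨.cup, 1⟩ from rfl)).map φ)
  obtain ⟨-, l2, r2⟩ := Slice.compat_iff.1 ((compat_gen
    (show (pretzel a b c).slices[2]? = some ⟨.cup, 3⟩ from rfl)).map φ)
  have e0 : φ ((pretzel a b c).gen 1 1) * φ ((pretzel a b c).gen 1 0) = 1 := Piece.compat_cup.1 c0
  have e1 : φ ((pretzel a b c).gen 2 2) * φ ((pretzel a b c).gen 2 1) = 1 := Piece.compat_cup.1 c1
  have e2 : φ ((pretzel a b c).gen 3 1) = φ ((pretzel a b c).gen 2 1) := l2 1 (by norm_num)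
  have e3 : φ ((pretzel a b c).gen 3 2) = φ ((pretzel a b c).gen 2 2) := l2 2 (by norm_num)
  have e4 : φ ((pretzel a b c).gen 2 3) = φ ((pretzel a b c).gen 1 1) := r1 0
  have e5 : φ ((pretzel a b c).gen 3 5) = φ ((pretzel a b c).gen 2 3) := r2 0
  have hcol := isColoring_of_forall_compat (w := (pretzel a b c).slices.drop 3)
    (fun j i => φ ((pretzel a b c).gen (j + 3) i))
    fun j s hs => by
      have := (compat_gen (D := pretzel a b c) (j := j + 3)
        (by rwa [List.getElem?_drop, add_comm] at hs)).map φ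
      rwa [add_right_comm] at this
  have hcol' : IsColorable _ (twists 0 a ++ (twists 2 b ++ (twists 4 c ++
    [⟨.cap, 1⟩, ⟨.cap, 1⟩, ⟨.cap, 0⟩]))) _ := ⟨_, hcol⟩
  obtain ⟨m₁, h1, hcol'⟩ := isColorable_append hcol'
  obtain ⟨m₂, h2, hcol'⟩ := isColorable_append hcol'
  obtain ⟨m₃, h3, hcol'⟩ := isColorable_append hcol'
  have t1 := h1.twists_eq
  have t2 := h2.twists_eq
  have t3 := h3.twists_eq
  rw [if_pos ha] at t1
  rw [if_neg hb] at t2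
  rw [if_neg hc] at t3
  simp only [isColorable_cons, compat_cap_iff] at hcol'
  obtain ⟨m₄, ⟨f1, rfl⟩, m₅, ⟨f2, -⟩, -⟩ := hcol'
  -- The first two maxima join the top strands 1, 2 and 3, 4. The odd columns exchange their
  -- strands, so these come from the bottom strands 1, 3 and 2, 5.
  have f1' : φ ((pretzel a b c).gen 3 3) * φ ((pretzel a b c).gen 3 1) = 1 := by
    rw [t3, t2, t1] at f1
    exact f1
  have f2' : φ ((pretzel a b c).gen 3 5) * φ ((pretzel a b c).gen 3 2) = 1 := by
    rw [t3, t2, t1] at f2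
    exact f2
  have g1 : φ ((pretzel a b c).gen 2 1) = (φ ((pretzel a b c).gen 1 0))⁻¹ := by
    rw [e5, e4, e3, eq_inv_of_mul_eq_one_left e0, eq_inv_of_mul_eq_one_left e1, ← mul_inv,
      inv_eq_one] at f2'
    exact eq_inv_of_mul_eq_one_right f2'
  refine ⟨g1, ?_⟩
  rw [e2, g1, mul_inv_eq_one] at f1'
  exact f1'

/-- The labels at the minima are powers of one meridian; agreement then spreads, since the diagonal
of A × A is closed under inversion and conjugation. -/
theorem hom_ext_pretzel (ha : Even a) (hb : ¬ Even b) (hc : ¬ Even c)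
    {φ ψ : (pretzel a b c).linkGroup →* A}
    (h : φ ((pretzel a b c).gen 1 0) = ψ ((pretzel a b c).gen 1 0)) : φ = ψ := by
  obtain ⟨h1, h2⟩ := map_gen_pretzel ha hb hc φ
  obtain ⟨h3, h4⟩ := map_gen_pretzel ha hb hc ψ
  have hC : IsConjClosed {x : A × A | x.1 = x.2} :=
    ⟨fun {x} hx => by simpa using hx, fun {x y} hx hy => by
      simpa using hx⟩
  exact PresentedGroup.ext fun x => map_gen_mem_pretzel (φ.prod ψ) hC rfl h
    (show φ _ = ψ _ by rw [h1, h3, h]) (show φ _ = ψ _ by rw [h2, h4, h]) x.1 x.2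

end LinkDiagram

end Abelian

/-! ## The framing -/

section Framing

variable (k : ℤ)

namespace LinkDiagram

/-- If vectors can be transported consistently along a diagram except at its first minimum, then the
blackboard framed longitude maps the vector at one end to the vector at the other one. -/
theorem blackboardLongitude_smul_of_cup {D : LinkDiagram} {A X : Type*} [CommGroup A]
    [MulAction A X] (hD : D.slices[0]? = some ⟨.cup, 0⟩) (φ : D.linkGroup →* A) (u : ℕ → ℕ → X)
    (hφ : (φ (D.gen 1 0))⁻¹ ≠ φ (D.gen 1 0))
    (hu : ∀ (j : ℕ) (s : Slice), D.slices[j]? = some s → j ≠ 0 →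
      s.Transports (fun i => (φ (D.gen j i), u j i)) fun i => (φ (D.gen (j + 1) i), u (j + 1) i)) :
    φ (D.blackboardLongitude ⟨1, 0, true⟩) • u 1 1 = u 1 0 := by
  have h2 : D.strandCount 1 = 2 := strandCount_succ hD
  set a : Traveller := ⟨1, 0, true⟩ with ha
  have hat : a ∈ D.travellers := by
    change 0 < D.strandCount 1
    omega
  have hmem : ∀ n, D.step^[n] a ∈ D.travellers := by
    intro n
    induction n with
    | zero => exact hat
    | succ n ih =>
      rw [Function.iterate_succ_apply']
      exact (step_mem_travellers ih).1
  have hmer : ∀ n, φ (D.meridianAt (D.step^[n] a)) = φ (D.gen 1 0) := by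
    intro n
    induction n with
    | zero => rfl
    | succ n ih => rw [Function.iterate_succ_apply', map_meridianAt_step, ih]
  have hpos := Function.minimalPeriod_pos_of_mem_periodicPts (mem_periodicPts_step hat)
  obtain ⟨n, hn⟩ := Nat.exists_eq_succ_of_ne_zero hpos.ne'
  have hper : D.step (D.step^[n] a) = a := by
    rw [← Function.iterate_succ_apply' D.step, ← hn, Function.iterate_minimalPeriod]
  -- By reversibility, the starting point can only be reached through the first minimum from its
  -- other leg.
  have hlast : D.step^[n] a = ⟨1, 1, false⟩ := by
    have h := (step_mem_travellers (hmem n)).2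
    rw [hper] at h
    have h' : (⟨1, 1, true⟩ : Traveller) = (D.step^[n] a).reverse := by
      rw [← h]
      simp [ha, Traveller.reverse, step, hD, Slice.travelDown, Slice.travelUp, Piece.flip,
        Piece.ins]
    generalize D.step^[n] a = z at h'
    obtain ⟨l, p, up⟩ := z
    simp only [Traveller.reverse, Traveller.mk.injEq] at h' ⊢
    obtain ⟨rfl, rfl, h'⟩ := h'
    simpa using h'
  -- No earlier step meets the first minimum. Going down on strand 1 there would close the path
  -- before its period; going down on strand 0 would invert the meridian, whose abelian image is
  -- constant along the path.
  have hprod := prod_letters_smul φ u a n fun i hi => by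
    rw [Function.iterate_succ_apply']
    have h1 := hmem i
    have hm := hmer i
    have h3 : D.step^[i] a ≠ ⟨1, 1, false⟩ := by
      intro h
      have hp : Function.IsPeriodicPt D.step (i + 1) a := by
        rw [Function.IsPeriodicPt, Function.IsFixedPt, Function.iterate_succ_apply', h, ← hlast,
          hper]
      have := hp.minimalPeriod_le (Nat.succ_pos i)
      omega
    generalize D.step^[i] a = z at h1 hm h3
    obtain ⟨l, p, up⟩ := z
    have hl : l ≠ 0 := by
      rintro rfl
      exact Nat.not_lt_zero _ h1
    obtain ⟨j, rfl⟩ := Nat.exists_eq_succ_of_ne_zero hl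
    cases up with
    | true =>
      obtain ⟨s, hs⟩ := exists_slice (Nat.zero_lt_of_lt h1)
      exact letter_smul_step_up φ u hs (hu _ s hs hl) p
    | false =>
      have hj : j < D.slices.length := by
        by_contra! hle
        have h1' : p < D.strandCount (j + 1) := h1
        rw [strandCount_of_length_le (hle.trans (Nat.le_succ j))] at h1'
        exact Nat.not_lt_zero _ h1'
      refine letter_smul_step_down φ u (List.getElem?_eq_getElem hj)
        (hu _ _ (List.getElem?_eq_getElem hj) ?_) p
      rintro rfl
      have hp : p < D.strandCount 1 := h1
      rw [h2] at hp
      interval_cases p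
      · exact hφ ((map_inv φ _).symm.trans hm)
      · exact absurd rfl h3
  have hletter : D.letter (D.step^[n] a) = 1 := by
    rw [hlast]
    simp [letter, hD]
  rw [hlast] at hprod
  rw [blackboardLongitude, hn, Nat.succ_eq_add_one, List.range_succ, List.map_append,
    List.prod_append, List.map_singleton, List.prod_singleton, hletter, mul_one]
  exact hprod

end LinkDiagram

/-- The linking number of the blackboard framed longitude of the pretzel knot with the knot. -/
theorem exists_linking_hom : ∃ χ : (pretzel (-2) 3 (2 * k + 1)).linkGroup →* Multiplicative ℤ,
    χ ((pretzel (-2) 3 (2 * k + 1)).gen 1 0) = Multiplicative.ofAdd 1 ∧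
      χ ((pretzel (-2) 3 (2 * k + 1)).blackboardLongitude ⟨1, 0, true⟩) =
        Multiplicative.ofAdd (2 * k + 6) := by
  set q : Multiplicative ℤ := Multiplicative.ofAdd 1 with hq
  have hq1 : ∀ n : ℤ, q • n = 1 + n := fun n => rfl
  have hq2 : ∀ n : ℤ, q⁻¹ • n = -1 + n := fun n => rfl
  -- All labels are q or q⁻¹, and the integers record translations at undercrossings. Starting from
  -- 0 at y₁ 0, the columns and the other arcs force the constants. The outer minimum then carries 0
  -- and -6 - 2k on its two legs, and this gap is the linking number.
  obtain ⟨χ, u, ⟨g1, -, -⟩, ⟨u0, u1⟩, hu⟩ := exists_hom_pretzel (k := k) (d := (1, 0))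
    (x₁ := fun j : ℤ => (q⁻¹, -4 - k - j)) (y₁ := fun j : ℤ => (q, j))
    (x₂ := fun j : ℤ => (q, -1 - k - j)) (y₂ := fun j : ℤ => (q, -4 - k - j))
    (x₃ := fun j : ℤ => (q⁻¹, -6 - 2 * k + j)) (y₃ := fun j : ℤ => (q⁻¹, -1 - k + j)) rfl
    ⟨fun _ => mul_comm _ _, fun _ => mul_comm _ _, fun j => by simp only [hq1]; ring,
      fun j => by simp only [hq2]; ring⟩
    ⟨fun _ => mul_comm _ _, fun _ => mul_comm _ _, fun j => by simp only [hq1]; ring,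
      fun j => by simp only [hq1]; ring⟩
    ⟨fun _ => mul_comm _ _, fun _ => mul_comm _ _, fun j => by simp only [hq2]; ring,
      fun j => by simp only [hq2]; ring⟩
    (inv_mul_cancel _) (mul_inv_cancel _) rfl (inv_mul_cancel _) (by ring) (mul_inv_cancel _)
    (by ring) (inv_mul_cancel _) (by ring) (inv_mul_cancel _) (by ring)
  refine ⟨χ, g1, ?_⟩
  have h : Multiplicative.toAdd (χ ((pretzel (-2) 3 (2 * k + 1)).blackboardLongitude
      ⟨1, 0, true⟩)) + u 1 1 = u 1 0 :=
    LinkDiagram.blackboardLongitude_smul_of_cup rfl χ u (by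
      rw [g1]
      exact fun h => absurd (congrArg Multiplicative.toAdd h) (by norm_num [hq]))
      fun j s hs hj => hu j s hs fun h => absurd h hj
  rw [u0, u1] at h
  apply Multiplicative.toAdd.injective
  rw [toAdd_ofAdd]
  linarith

-- The abelianization factors through χ, so the correction exponent is minus the linking number of
-- the blackboard longitude.
open LinkDiagram in
theorem isPeripheralPair_pretzel : (pretzel (-2) 3 (2 * k + 1)).IsPeripheralPair
    ((pretzel (-2) 3 (2 * k + 1)).gen 1 0)
    ((pretzel (-2) 3 (2 * k + 1)).blackboardLongitude ⟨1, 0, true⟩ *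
      (pretzel (-2) 3 (2 * k + 1)).gen 1 0 ^ (-(2 * k + 6))) := by
  refine ⟨⟨1, 0, true⟩, Nat.two_pos, rfl, ⟨_, rfl⟩, ?_⟩
  obtain ⟨χ, h1, h2⟩ := exists_linking_hom k
  have h : (Abelianization.of : (pretzel (-2) 3 (2 * k + 1)).linkGroup →* _) =
      (zpowersHom _ (Abelianization.of ((pretzel (-2) 3 (2 * k + 1)).gen 1 0))).comp χ := by
    refine hom_ext_pretzel (by decide) (by decide) (by simp) ?_
    rw [MonoidHom.comp_apply, h1]
    simp
  rw [← Abelianization.ker_of, MonoidHom.mem_ker, map_mul, h, MonoidHom.comp_apply,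
    MonoidHom.comp_apply, map_zpow, h1, h2]
  rw [zpowersHom_apply, toAdd_ofAdd, zpowersHom_apply, toAdd_zpow, toAdd_ofAdd,
    ← zpow_add, smul_eq_mul, mul_one, add_neg_cancel, zpow_zero]

end Framing

/-! ### Points on the curve and conclusion -/

theorem maxima_pretzel (a b c : ℤ) : (pretzel a b c).maxima = 3 := by
  simp [LinkDiagram.maxima, pretzel, twists, List.countP_append, List.countP_replicate]

theorem Representation.zpow_apply_of_apply_eq_smul {Γ V : Type*} [Group Γ] [AddCommGroup V]
    [Module ℂ V] (ρ : Representation ℂ Γ V) {m : Γ} {v : V} {μ : ℂˣ} (h : ρ m v = (μ : ℂ) • v)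
    (e : ℤ) : ρ (m ^ e) v = ((μ ^ e : ℂˣ) : ℂ) • v := by
  induction e using Int.induction_on with
  | zero => simp
  | succ n ih =>
    rw [zpow_add_one, map_mul, Module.End.mul_apply, h, map_smul, ih, smul_smul, zpow_add_one,
      Units.val_mul, mul_comm]
  | pred n ih =>
    have h' : ρ m⁻¹ v = ((μ⁻¹ : ℂˣ) : ℂ) • v := by
      have h2 : ρ m⁻¹ (ρ m v) = v := by
        rw [← Module.End.mul_apply, ← map_mul, inv_mul_cancel, map_one, Module.End.one_apply]
      rw [h, map_smul] at h2
      rw [← h2, smul_smul, ← Units.val_mul, inv_mul_cancel, Units.val_one, one_smul, h2]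
    rw [zpow_sub_one, map_mul, Module.End.mul_apply, h', map_smul, ih, smul_smul, zpow_sub_one,
      Units.val_mul, mul_comm]

/-- The points of the curve `λ μ ^ (2 * k + 6) = 1` that come from KCH representations. -/
theorem mem_kchPoints_pretzel {k : ℤ} (hk : k ≠ -1) (hk' : k ≠ 0) {μ : ℂˣ} {r : ℝ}
    (hr : 0 < r) (hr1 : r ≠ 1) (hμ : (μ : ℂ) = r) :
    (μ ^ (-(2 * k + 6)), μ) ∈ (pretzel (-2) 3 (2 * k + 1)).kchPoints 3 := by
  obtain ⟨ρ, hρ, -, -, v, hv, hm, hl⟩ := exists_representation hk hk' hr hr1 hμ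
  refine ⟨ρ, hρ, _, _, isPeripheralPair_pretzel k, ?_, v, hv, hm, ?_⟩
  · intro h
    have h1 : (μ : ℂ) = 1 := congrArg Units.val h
    rw [hμ] at h1
    exact hr1 (by exact_mod_cast h1)
  · rw [map_mul, Module.End.mul_apply, ρ.zpow_apply_of_apply_eq_smul hm, map_smul, hl]

theorem infinite_units_real : {μ : ℂˣ | ∃ r : ℝ, 0 < r ∧ r ≠ 1 ∧ (μ : ℂ) = r}.Infinite := by
  refine Set.infinite_of_injective_forall_mem
    (f := fun n : ℕ => Units.mk0 ((n : ℂ) + 2) (by exact_mod_cast (Nat.succ_ne_zero (n + 1))))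
    (fun m n h => ?_) fun n => ⟨n + 2, by positivity, ?_, by simp⟩
  · have := congrArg Units.val h
    simpa using this
  · have : (0 : ℝ) ≤ n := n.cast_nonneg
    intro h
    linarith

theorem theorem1p4 (k : ℤ) (hk : k ≠ -1) (hk' : k ≠ 0) :
    (∃ ρ : Representation ℂ (pretzel (-2) 3 (2 * k + 1)).linkGroup (Fin 3 → ℂ),
      (pretzel (-2) 3 (2 * k + 1)).IsKCH ρ ∧ ρ.IsIrreducible) ∧
    (∃ A, (pretzel (-2) 3 (2 * k + 1)).IsAPolynomial 3 A) ∧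
    (∀ A, (pretzel (-2) 3 (2 * k + 1)).IsAPolynomial 3 A →
      1 - Laurent2.monomial 1 1 (2 * k + 6) ∣ A) ∧
    (pretzel (-2) 3 (2 * k + 1)).meridionalRank = 3 ∧
    (pretzel (-2) 3 (2 * k + 1)).bridgeNumber = 3 := by
  -- Any positive real μ ≠ 1 would do; μ = 2 is chosen.
  obtain ⟨ρ, hρ, hirr, hrefl, -⟩ := exists_representation hk hk' (μ := Units.mk0 2 two_ne_zero)
    (r := 2) two_pos (by norm_num) (by simp)
  have hdim : Module.finrank ℂ (Fin 3 → ℂ) = 3 := by simp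
  refine ⟨⟨ρ, hρ, hirr⟩, exists_squarefree_zeroLocus _, fun A hA => ?_, le_antisymm ?_ ?_,
    le_antisymm ?_ ?_⟩
  · obtain ⟨-, -, hfin⟩ := hA
    have hinj : Function.Injective fun μ : ℂˣ => (μ ^ (-(2 * k + 6)), μ) :=
      fun x y h => congrArg Prod.snd h
    -- The finitely many points of the closure where A does not vanish are removed, leaving
    -- infinitely many zeros of A on the curve.
    refine one_sub_monomial_dvd (2 * k + 6) A _
      (infinite_units_real.sdiff (hfin.preimage hinj.injOn)) ?_
    rintro μ ⟨⟨r, hr, hr1, hμ⟩, hnot⟩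
    by_contra hA
    exact hnot ⟨subset_zariskiClosure _ (mem_kchPoints_pretzel hk hk' hr hr1 hμ), hA⟩
  · exact (LinkDiagram.meridionalRank_le_maxima _).trans (maxima_pretzel _ _ _).le
  · have := LinkDiagram.finrank_le_meridionalRank ρ hirr (by rw [hdim]; norm_num) hrefl
    rwa [hdim] at this
  · exact (LinkDiagram.bridgeNumber_le_maxima _).trans (maxima_pretzel _ _ _).le
  · have := LinkDiagram.finrank_le_bridgeNumber ρ hirr (by rw [hdim]; norm_num) hrefl
    rwa [hdim] at this
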